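/- An automaton $\mathcal{T}=(Q,\Sigma,\delta)$ consists of a non-empty finite set $Q$ of states, a non-empty finite alphabet $\Sigma$ and a set $\delta\subseteq Q\times\Sigma\times\Sigma\times Q$ of transitions; $(q,a,b,p)\in\delta$ is a transition from $q$ to $p$ with input $a$ and output $b$. It is a $\mathscr{G}$-automaton if for every $q\in Q$ and $a\in\Sigma$ there is exactly one transition starting in $q$ with input $a$ (it is deterministic and complete), and for every $q\in Q$ and $b\in\Sigma$ there is at most one transition starting in $q$ with output $b$ (it is inverse-deterministic). The inverse automaton $\overline{\mathcal{T}}$ has as states a disjoint copy $\overline{Q}=\{\overline{q}\mid q\in Q\}$ of $Q$ and as transitions all $(\overline{q},b,a,\overline{p})$ with $(q,a,b,p)\in\delta$. Every $q\in Q\cup\overline{Q}$ induces a map $q\circ{}:\Sigma^*\to\Sigma^*$ which sends an input word to the output word of the run on it that starts in $q$. The uniform word problem for automaton groups (without rational constraints) is the following decision problem. Input: a $\mathscr{G}$-automaton $\mathcal{T}=(Q,\Sigma,\delta)$ and finite, possibly empty, sequences $q_1,\dots,q_n$ and $p_1,\dots,p_m$ of elements of $Q\cup\overline{Q}$. Question: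 is $q_n q_{n-1}\cdots q_1\circ u=p_m p_{m-1}\cdots p_1\circ u$ for all $u\in\Sigma^*$? Here $q_n\cdots q_1\circ{}$ is the composition in which $q_1\circ{}$ is applied first, and the empty sequence acts as the identity. Proposition. The uniform word problem for automaton groups is $\mathrm{NL}$-hard under many-one log-space reductions. That is, for every decision problem $P$ that is decided by a non-deterministic Turing machine (with a read-only input tape) all of whose computations on inputs of length $\ell$ use $O(\log \ell)$ positions on the work tapes, there is a function $f$ that maps the instances of $P$ to instances of the uniform word problem for automaton groups, such that $x$ has a positive answer if and only if $f(x)$ has one, and such that $f$ is computed by a deterministic Turing machine (with a read-only input tape and a write-only output tape) that uses $O(\log \ell)$ positions on its work tapes on inputs of length $\ell$. -/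

import Mathlib

namespace AutWP

/-! ## Turing machines with a read-only input tape -/

/-- What the head on the input tape reads: a letter of the input or one of the two end markers. -/
inductive InputSymbol (α : Type) : Type
  | leftEnd : InputSymbol α
  | letter (a : α) : InputSymbol α
  | rightEnd : InputSymbol α

/-- Head movements. -/
inductive Move : Type
  | left : Move
  | stay : Move
  | right : Move

/-- The content of cell `i` of the input tape on input `w`: cell `0` holds the left end marker,
cells `1, …, |w|` hold the letters of `w`, and then comes the right end marker. -/
def inputCell {α : Type} (w : List α) (i : ℕ) : InputSymbol α :=
  if i = 0 then InputSymbol.leftEnd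
  else match w[i - 1]? with
    | some a => InputSymbol.letter a
    | none => InputSymbol.rightEnd

/-- What a machine does in one step: the new state, the symbols written to the work tapes, the
movements of the input head and of the work heads, and possibly a letter for the output tape. -/
structure Action (State Work β : Type) (k : ℕ) : Type where
  state : State
  write : Fin k → Work
  inputMove : Move
  workMove : Fin k → Move
  output : Option β

/-- A non-deterministic multi-tape Turing machine with a read-only input tape (input alphabet `α`),
finitely many work tapes which are infinite to the right, and a write-only output tape (output
alphabet `β`). -/
structure Machine (α β : Type) : Type 1 where
  State : Type
  finite_state : Finite State
  Work : Type
  finite_work : Finite Work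
  blank : Work
  numTapes : ℕ
  start : State
  accepting : Set State
  trans : State → InputSymbol α → (Fin numTapes → Work) → Set (Action State Work β numTapes)

namespace Machine

variable {α β : Type}

/-- Configurations of a machine. -/
structure Cfg (M : Machine α β) : Type where
  state : M.State
  inputHead : ℕ
  head : Fin M.numTapes → ℕ
  tape : Fin M.numTapes → ℕ → M.Work
  output : List β

/-- The initial configuration: all heads are on the leftmost cells, all work tapes are blank. -/
def init (M : Machine α β) : M.Cfg where
  state := M.start
  inputHead := 0
  head := fun _ => 0
  tape := fun _ _ => M.blank
  output := []

/-- Moving a work head; a head on the leftmost cell that is told to move left stays there. -/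
def moveWork : Move → ℕ → ℕ
  | Move.left, i => i - 1
  | Move.stay, i => i
  | Move.right, i => i + 1

/-- Moving the head on the input tape, which never leaves the cells `0, …, n + 1`, where `n` is the
length of the input. -/
def moveInput (n : ℕ) (d : Move) (i : ℕ) : ℕ :=
  min (moveWork d i) (n + 1)

/-- The configuration that results from performing an action. -/
def perform (M : Machine α β) (n : ℕ) (c : M.Cfg)
    (a : Action M.State M.Work β M.numTapes) : M.Cfg where
  state := a.state
  inputHead := moveInput n a.inputMove c.inputHead
  head := fun i => moveWork (a.workMove i) (c.head i)
  tape := fun i => Function.update (c.tape i) (c.head i) (a.write i)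
  output := c.output ++ a.output.toList

/-- One step of a computation on input `w`. -/
def Step (M : Machine α β) (w : List α) (c c' : M.Cfg) : Prop :=
  ∃ a ∈ M.trans c.state (inputCell w c.inputHead) (fun i => c.tape i (c.head i)),
    c' = M.perform w.length c a

/-- `c` occurs in some computation on input `w`. -/
def Reachable (M : Machine α β) (w : List α) (c : M.Cfg) : Prop :=
  Relation.ReflTransGen (M.Step w) M.init c

/-- Some computation on input `w` reaches an accepting state. -/
def Accepts (M : Machine α β) (w : List α) : Prop :=
  ∃ c, M.Reachable w c ∧ c.state ∈ M.accepting

/-- At most one transition is applicable at any time. -/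
def Deterministic (M : Machine α β) : Prop :=
  ∀ q x g, (M.trans q x g).Subsingleton

/-- A computation on input `w` halts with `v` on the output tape. -/
def HaltsWith (M : Machine α β) (w : List α) (v : List β) : Prop :=
  ∃ c, M.Reachable w c ∧ (∀ c', ¬ M.Step w c c') ∧ c.output = v

/-- On every input `w` from the set `D`, all computations use at most `s |w|` positions on any work
tape (as the heads start on cell `0` and move by at most one cell at a time, the positions used up
to some moment are `0, …, m`, where `m` is the largest position of the head so far). -/
def SpaceBoundedOn (M : Machine α β) (D : Set (List α)) (s : ℕ → ℕ) : Prop :=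
  ∀ w ∈ D, ∀ c, M.Reachable w c → ∀ i, c.head i + 1 ≤ s w.length

end Machine

/-! ## Decision problems, space classes, log-space reductions, hardness -/

/-- A decision problem: a type of instances, which are written as words over a finite alphabet, and
the set of instances with a positive answer. -/
structure DecisionProblem : Type 1 where
  Inst : Type
  Alphabet : Type
  finite_alphabet : Finite Alphabet
  encode : Inst → List Alphabet
  encode_injective : Function.Injective encode
  yes : Set Inst

/-- `s ∈ O(f)`. -/
def InBigO (s : ℕ → ℕ) (f : ℕ → ℝ) : Prop :=
  (fun n => (s n : ℝ)) =O[Filter.atTop] f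

/-- The decision problems decided by a non-deterministic Turing machine which is bounded in space by
a function in `O(f)`. -/
def NSpace (f : ℕ → ℝ) : Set DecisionProblem :=
  {P | ∃ M : Machine P.Alphabet Empty, ∃ s : ℕ → ℕ, InBigO s f ∧
    M.SpaceBoundedOn (Set.range P.encode) s ∧
    ∀ x : P.Inst, M.Accepts (P.encode x) ↔ x ∈ P.yes}

/-- Non-deterministic logarithmic space. -/
def NL : Set DecisionProblem :=
  NSpace (fun n => Real.log n)

/-- `P` is many-one log-space reducible to `R`. -/
def LogSpaceReducible (P R : DecisionProblem) : Prop :=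
  ∃ f : P.Inst → R.Inst, (∀ x, x ∈ P.yes ↔ f x ∈ R.yes) ∧
    ∃ M : Machine P.Alphabet R.Alphabet, ∃ s : ℕ → ℕ, M.Deterministic ∧
      InBigO s (fun n => Real.log n) ∧
      M.SpaceBoundedOn (Set.range P.encode) s ∧
      ∀ x : P.Inst, M.HaltsWith (P.encode x) (R.encode (f x))

/-- `R` is hard for the class `C` under many-one log-space reductions. -/
def IsHardFor (R : DecisionProblem) (C : Set DecisionProblem) : Prop :=
  ∀ P ∈ C, LogSpaceReducible P R

/-! ## Automata -/

/-- A synchronous finite-state transducer with states `Q`, input alphabet `A` and output alphabet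
`B`, given by its set of transitions: `(q, a, b, p)` is the transition from `q` to `p` with input
`a` and output `b`. -/
structure Automaton (Q A B : Type) : Type where
  δ : Set (Q × A × B × Q)

namespace Automaton

variable {Q A B : Type}

/-- Every state has at most one outgoing transition for each input letter. -/
def IsDeterministic (T : Automaton Q A B) : Prop :=
  ∀ q a, {t ∈ T.δ | t.1 = q ∧ t.2.1 = a}.encard ≤ 1

/-- Every state has at least one outgoing transition for each input letter. -/
def IsComplete (T : Automaton Q A B) : Prop :=
  ∀ q a, 1 ≤ {t ∈ T.δ | t.1 = q ∧ t.2.1 = a}.encard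

/-- The inverse automaton: input and output are swapped. -/
def inverse (T : Automaton Q A B) : Automaton Q B A where
  δ := {t | (t.1, t.2.2.1, t.2.1, t.2.2.2) ∈ T.δ}

/-- A complete, deterministic and inverse-deterministic automaton whose input and output alphabet
coincide. -/
def IsGAutomaton (T : Automaton Q A A) : Prop :=
  T.IsDeterministic ∧ T.inverse.IsDeterministic ∧ T.IsComplete

/-- The union of `T` and its inverse, whose states form a disjoint copy of those of `T`: `Sum.inl q`
is the state `q` and `Sum.inr q` is the state `q⁻¹`. -/
def withInverse (T : Automaton Q A A) : Automaton (Q ⊕ Q) A A where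
  δ := {t | (∃ q a b p, (q, a, b, p) ∈ T.δ ∧ t = (Sum.inl q, a, b, Sum.inl p)) ∨
    ∃ q a b p, (q, a, b, p) ∈ T.inverse.δ ∧ t = (Sum.inr q, a, b, Sum.inr p)}

/-- `T.Run q u v p`: there is a run from `q` to `p` with input word `u` and output word `v`. -/
inductive Run (T : Automaton Q A B) : Q → List A → List B → Q → Prop
  | nil (q : Q) : Run T q [] [] q
  | cons {q p r : Q} {a : A} {b : B} {u : List A} {v : List B} :
      (q, a, b, p) ∈ T.δ → Run T p u v r → Run T q (a :: u) (b :: v) r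

/-- The partial map `q ∘` from input words to output words that a state `q` of a deterministic
automaton induces. -/
noncomputable def stateMap (T : Automaton Q A B) (q : Q) : List A →. List B :=
  fun u => ⟨∃ v, ∃ p, T.Run q u v p, fun h => h.choose⟩

/-- The partial map `qₙ ⋯ q₂ q₁ ∘` (the map of `q₁` is applied first) for the sequence
`[q₁, q₂, …, qₙ]` of states; it is the identity for the empty sequence. -/
noncomputable def seqMap (T : Automaton Q A A) (qs : List Q) : List A →. List A :=
  qs.foldl (fun f q => (T.stateMap q).comp f) (PFun.id (List A))

end Automaton

/-! ## The uniform word problem for automaton groups -/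

/-- An instance: a `𝒢`-automaton `T` with a non-empty finite state set and a non-empty finite
alphabet, and two finite sequences `q₁, …, qₙ` and `p₁, …, pₘ` of states of `T` and of its
inverse. -/
structure WPInstance : Type where
  numStates : ℕ
  numStates_pos : 0 < numStates
  numLetters : ℕ
  numLetters_pos : 0 < numLetters
  T : Automaton (Fin numStates) (Fin numLetters) (Fin numLetters)
  isGAutomaton : T.IsGAutomaton
  left : List (Fin numStates ⊕ Fin numStates)
  right : List (Fin numStates ⊕ Fin numStates)

/-- The alphabet in which instances are written. -/
inductive Symbol : Type
  | bit (b : Bool) : Symbol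
  | comma : Symbol
  | semicolon : Symbol

/-- A natural number is written in binary (least significant bit first), followed by a comma. -/
def encodeNum (n : ℕ) : List Symbol :=
  n.bits.map Symbol.bit ++ [Symbol.comma]

/-- A transition is written as its four components. -/
def encodeTransition {k s : ℕ} (t : Fin k × Fin s × Fin s × Fin k) : List Symbol :=
  encodeNum t.1 ++ encodeNum t.2.1 ++ encodeNum t.2.2.1 ++ encodeNum t.2.2.2

/-- A state `q` or `q⁻¹` is written as a sign bit followed by the number of `q`. -/
def encodeSigned {k : ℕ} : Fin k ⊕ Fin k → List Symbol
  | Sum.inl q => Symbol.bit false :: encodeNum q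
  | Sum.inr q => Symbol.bit true :: encodeNum q

open Classical in
/-- The transitions of an automaton, listed in lexicographical order. -/
noncomputable def listTransitions {k s : ℕ} (T : Automaton (Fin k) (Fin s) (Fin s)) :
    List (Fin k × Fin s × Fin s × Fin k) :=
  (List.finRange k ×ˢ List.finRange s ×ˢ List.finRange s ×ˢ List.finRange k).filter (· ∈ T.δ)

/-- An instance is written as the number of states, the number of letters, the list of transitions
and the two sequences of states. -/
noncomputable def encodeInstance (I : WPInstance) : List Symbol :=
  encodeNum I.numStates ++ encodeNum I.numLetters ++
    (listTransitions I.T).flatMap encodeTransition ++ [Symbol.semicolon] ++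
    I.left.flatMap encodeSigned ++ [Symbol.semicolon] ++
    I.right.flatMap encodeSigned ++ [Symbol.semicolon]

theorem finite_symbol : Finite Symbol := by
  let f : Symbol → Option (Option Bool) := fun x =>
    match x with
    | Symbol.bit b => some (some b)
    | Symbol.comma => some none
    | Symbol.semicolon => none
  refine Finite.of_injective f ?_
  intro x y h
  cases x <;> cases y <;> simp_all [f]

theorem bits_injective : Function.Injective Nat.bits := by
  intro m
  induction m using Nat.strong_induction_on with
  | _ m ih =>
    intro n h
    have h1 : m.bodd = n.bodd := by rw [Nat.bodd_eq_bits_head, Nat.bodd_eq_bits_head, h]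
    have h2 : m.div2.bits = n.div2.bits := by
      rw [Nat.div2_bits_eq_tail, Nat.div2_bits_eq_tail, h]
    have em := Nat.bodd_add_div2 m
    have en := Nat.bodd_add_div2 n
    by_cases hm : m = 0
    · subst hm
      by_contra hn
      have : n.bits.length = 0 := by rw [← h]; simp
      rw [Nat.size_eq_bits_len, Nat.size_eq_zero] at this
      exact hn this.symm
    · have h3 := ih m.div2 (by rw [Nat.div2_val]; omega) h2
      rw [← em, ← en, h1, h3]

theorem encodeNum_append {m n : ℕ} {r r' : List Symbol}
    (h : encodeNum m ++ r = encodeNum n ++ r') : m = n ∧ r = r' := by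
  have key : ∀ (l l' : List Bool), l.map Symbol.bit ++ [Symbol.comma] ++ r =
      l'.map Symbol.bit ++ [Symbol.comma] ++ r' → l = l' ∧ r = r' := by
    intro l
    induction l with
    | nil => intro l' h; cases l' <;> simp_all
    | cons a l ih =>
      intro l' h
      cases l' with
      | nil => simp at h
      | cons b l' =>
        simp only [List.map_cons, List.cons_append, List.cons.injEq, Symbol.bit.injEq] at h
        obtain ⟨h1, h2⟩ := ih l' h.2
        exact ⟨by rw [h.1, h1], h2⟩
  obtain ⟨h1, h2⟩ := key _ _ h
  exact ⟨bits_injective h1, h2⟩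

theorem encodeTransition_append {k s : ℕ} (t t' : Fin k × Fin s × Fin s × Fin k)
    (r r' : List Symbol) (h : encodeTransition t ++ r = encodeTransition t' ++ r') :
    t = t' ∧ r = r' := by
  simp only [encodeTransition, List.append_assoc] at h
  obtain ⟨h1, h⟩ := encodeNum_append h
  obtain ⟨h2, h⟩ := encodeNum_append h
  obtain ⟨h3, h⟩ := encodeNum_append h
  obtain ⟨h4, h⟩ := encodeNum_append h
  exact ⟨Prod.ext (Fin.ext h1) (Prod.ext (Fin.ext h2) (Prod.ext (Fin.ext h3) (Fin.ext h4))), h⟩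

theorem encodeSigned_append {k : ℕ} (q q' : Fin k ⊕ Fin k)
    (r r' : List Symbol) (h : encodeSigned q ++ r = encodeSigned q' ++ r') :
    q = q' ∧ r = r' := by
  cases q <;> cases q' <;>
    simp only [encodeSigned, List.cons_append, List.cons.injEq, Symbol.bit.injEq, true_and,
      Bool.false_eq_true, Bool.true_eq_false, false_and] at h <;>
    (obtain ⟨h1, h⟩ := encodeNum_append h; exact ⟨by rw [Fin.ext h1], h⟩)

theorem encodeNum_head (n : ℕ) (r r' : List Symbol) :
    encodeNum n ++ r ≠ Symbol.semicolon :: r' := by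
  unfold encodeNum
  cases n.bits <;> simp

theorem flatMap_append {X : Type} (e : X → List Symbol)
    (he : ∀ x y r r', e x ++ r = e y ++ r' → x = y ∧ r = r')
    (hs : ∀ x r r', e x ++ r ≠ Symbol.semicolon :: r') :
    ∀ (l l' : List X) (r r' : List Symbol),
      l.flatMap e ++ Symbol.semicolon :: r = l'.flatMap e ++ Symbol.semicolon :: r' →
      l = l' ∧ r = r' := by
  intro l
  induction l with
  | nil =>
    intro l' r r' h
    cases l' with
    | nil => simpa using h
    | cons y l' =>
      rw [List.flatMap_cons, List.append_assoc] at h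
      exact absurd h.symm (hs _ _ _)
  | cons x l ih =>
    intro l' r r' h
    cases l' with
    | nil =>
      rw [List.flatMap_cons, List.append_assoc] at h
      exact absurd h (hs _ _ _)
    | cons y l' =>
      rw [List.flatMap_cons, List.flatMap_cons, List.append_assoc, List.append_assoc] at h
      obtain ⟨h1, h2⟩ := he _ _ _ _ h
      obtain ⟨h3, h4⟩ := ih _ _ _ h2
      exact ⟨by rw [h1, h3], h4⟩

theorem listTransitions_injective {k s : ℕ} :
    Function.Injective (listTransitions (k := k) (s := s)) := by
  intro T T' h
  have key : ∀ (S : Automaton (Fin k) (Fin s) (Fin s)) t, t ∈ listTransitions S ↔ t ∈ S.δ := by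
    intro S t
    obtain ⟨q, a, b, p⟩ := t
    simp [listTransitions]
  cases T with
  | mk δ =>
    cases T' with
    | mk δ' =>
      congr 1
      ext t
      have h1 := key ⟨δ⟩ t
      have h2 := key ⟨δ'⟩ t
      rw [h] at h1
      exact h1.symm.trans h2

theorem encodeInstance_injective : Function.Injective encodeInstance := by
  rintro ⟨k, hk, s, hs, T, hT, l, r⟩ ⟨k', hk', s', hs', T', hT', l', r'⟩ h
  simp only [encodeInstance, List.append_assoc] at h
  obtain ⟨h1, h⟩ := encodeNum_append h
  obtain ⟨h2, h⟩ := encodeNum_append h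
  subst h1 h2
  have hsig : ∀ (q : Fin k ⊕ Fin k) (r r' : List Symbol),
      encodeSigned q ++ r ≠ Symbol.semicolon :: r' := by
    intro q r r'
    cases q <;> simp [encodeSigned]
  have htr : ∀ (t : Fin k × Fin s × Fin s × Fin k) (r r' : List Symbol),
      encodeTransition t ++ r ≠ Symbol.semicolon :: r' := by
    intro t r r'
    simp only [encodeTransition, List.append_assoc]
    exact encodeNum_head _ _ _
  obtain ⟨h3, h⟩ := flatMap_append _ encodeTransition_append htr _ _ _ _ h
  obtain ⟨h4, h⟩ := flatMap_append _ encodeSigned_append hsig _ _ _ _ h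
  obtain ⟨h5, -⟩ := flatMap_append _ encodeSigned_append hsig _ _ _ _ h
  have h6 := listTransitions_injective h3
  subst h6 h4 h5
  rfl

/-- The uniform word problem for automaton groups (without rational constraints): given a
`𝒢`-automaton and two sequences `q₁, …, qₙ` and `p₁, …, pₘ` of states of the automaton and of its
inverse, is `qₙ ⋯ q₁ ∘ u = pₘ ⋯ p₁ ∘ u` for all words `u`? -/
noncomputable def uniformWordProblem : DecisionProblem where
  Inst := WPInstance
  Alphabet := Symbol
  finite_alphabet := finite_symbol
  encode := encodeInstance
  encode_injective := encodeInstance_injective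
  yes := {I | ∀ u, I.T.withInverse.seqMap I.left u = I.T.withInverse.seqMap I.right u}

end AutWP

namespace AutWP

/-! ## A structured programming language with counters -/

/-! Membership in a problem of `NL` is reachability in a graph of polynomial size. Its vertices are
the codes of configurations of a space-bounded machine, together with one extra last vertex that is
entered from every accepting configuration (`exists_graph_of_mem_NL`). The answer is positive iff no
set S of vertices contains the vertex 0, misses the last vertex and is closed under edges. The word
problem quantifies over all words, so a word can play the role of S.

For V vertices put m = V². The letters are 0, …, m + 2. The first V letters of a word describe S,
and a gate of the automaton reads them and then permutes the next letter. The gate of an edge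
applies the rotation of 0, …, m unless S violates that edge. There are exactly m such gates (pairs
that are not edges get a gate that is never violated), so together they act as the c-th power of the
rotation, where c counts the gates that are not violated. Conjugating the transposition (m, m + 1)
by this power gives (m - c, m + 1), see `rot_conj`. The end gate is the transposition (0, m + 2) if
S contains 0 and misses the last vertex, and the identity otherwise. The two permutations fail to
commute exactly if the end gate is active and c = m, that is, if S is one of the forbidden sets
(`commute_perms`, `not_commute_perms`). The instance compares the two orders of composition
(`graphInstance_mem_yes`). Since the alphabet belongs to the input, it may grow with the graph, and
a single commutator expresses the conjunction of all m conditions.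

To see that the instance can be written in logarithmic space, while-programs on counters are
executed by a deterministic machine that keeps the counters in binary (`exists_machine`). The
functions in `IsLogFun` are polynomially bounded and computed by such programs with polynomially
bounded counters. They are closed under recursion with small values (`IsLogFun.primRec`), and this
yields arithmetic, the step relation of a machine on codes (`isLogPred_step`) and the encoding of
the instance (`IsLogOutput.encodeInstance`). -/

/-- Programs acting on counters `0, 1, 2, …`, a head on the input tape and an output tape. -/
inductive Program (α β : Type) : Type
  | bump (up : Bool) (r : ℕ)
  | move (d : Move)
  | write (b : β)
  | seq (p q : Program α β)
  | whileReg (r : ℕ) (p : Program α β)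
  | whileInput (S : Set (InputSymbol α)) (p : Program α β)

/-- The data on which programs act. -/
structure Store (β : Type) : Type where
  reg : ℕ → ℕ
  pos : ℕ
  out : List β

namespace Program

variable {α β : Type}

/-- `Exec w B p s s'`: on input `w`, the program `p` turns `s` into `s'` and terminates, no counter
is ever increased beyond `B`, and no counter is decreased below `0`. -/
inductive Exec (w : List α) (B : ℕ) : Program α β → Store β → Store β → Prop
  | inc {s : Store β} {r : ℕ} (h : s.reg r < B) :
      Exec w B (bump true r) s { s with reg := Function.update s.reg r (s.reg r + 1) }
  | dec {s : Store β} {r : ℕ} (h : s.reg r ≠ 0) :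
      Exec w B (bump false r) s { s with reg := Function.update s.reg r (s.reg r - 1) }
  | move {s : Store β} {d : Move} :
      Exec w B (move d) s { s with pos := Machine.moveInput w.length d s.pos }
  | write {s : Store β} {b : β} : Exec w B (write b) s { s with out := s.out ++ [b] }
  | seq {p q : Program α β} {s s' s'' : Store β} (hp : Exec w B p s s') (hq : Exec w B q s' s'') :
      Exec w B (seq p q) s s''
  | whileReg_zero {r : ℕ} {p : Program α β} {s : Store β} (h : s.reg r = 0) :
      Exec w B (whileReg r p) s s
  | whileReg_succ {r : ℕ} {p : Program α β} {s s' s'' : Store β} (h : s.reg r ≠ 0)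
      (hp : Exec w B p s s') (hq : Exec w B (whileReg r p) s' s'') :
      Exec w B (whileReg r p) s s''
  | whileInput_done {S : Set (InputSymbol α)} {p : Program α β} {s : Store β}
      (h : inputCell w s.pos ∉ S) : Exec w B (whileInput S p) s s
  | whileInput_step {S : Set (InputSymbol α)} {p : Program α β} {s s' s'' : Store β}
      (h : inputCell w s.pos ∈ S) (hp : Exec w B p s s') (hq : Exec w B (whileInput S p) s' s'') :
      Exec w B (whileInput S p) s s''

theorem Exec.mono {w : List α} {B B' : ℕ} (hB : B ≤ B') {p : Program α β} {s s' : Store β}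
    (h : Exec w B p s s') : Exec w B' p s s' := by
  induction h with
  | inc h => exact .inc (h.trans_le hB)
  | dec h => exact .dec h
  | move => exact .move
  | write => exact .write
  | seq _ _ h1 h2 => exact .seq h1 h2
  | whileReg_zero h => exact .whileReg_zero h
  | whileReg_succ h _ _ h1 h2 => exact .whileReg_succ h h1 h2
  | whileInput_done h => exact .whileInput_done h
  | whileInput_step h _ _ h1 h2 => exact .whileInput_step h h1 h2

/-- The largest counter that occurs in a program. -/
def maxReg : Program α β → ℕ
  | bump _ r => r
  | move _ => 0
  | write _ => 0
  | seq p q => max p.maxReg q.maxReg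
  | whileReg r p => max r p.maxReg
  | whileInput _ p => p.maxReg

/-- The lists of programs that are still to be executed at some moment of an execution of `p`, when
`K` is to be executed afterwards. -/
def conts : Program α β → List (Program α β) → Set (List (Program α β))
  | bump b r, K => {bump b r :: K, K}
  | move d, K => {move d :: K, K}
  | write b, K => {write b :: K, K}
  | seq p q, K => {seq p q :: K} ∪ (p.conts (q :: K) ∪ q.conts K)
  | whileReg r p, K => {whileReg r p :: K, K} ∪ p.conts (whileReg r p :: K)
  | whileInput S p, K => {whileInput S p :: K, K} ∪ p.conts (whileInput S p :: K)

/-- The remaining program is a part of the state of the machine, so this makes the control finite.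
-/
theorem conts_finite (p : Program α β) : ∀ K, (p.conts K).Finite := by
  induction p with
  | seq p q hp hq => intro K; exact (Set.finite_singleton _).union ((hp _).union (hq _))
  | whileReg r p hp => intro K; exact (Set.toFinite _).union (hp _)
  | whileInput S p hp => intro K; exact (Set.toFinite _).union (hp _)
  | _ => intro K; exact Set.Finite.insert _ (Set.finite_singleton _)

theorem cons_mem_conts (p : Program α β) (K : List (Program α β)) : p :: K ∈ p.conts K := by
  cases p <;> simp [conts]

theorem mem_conts (p : Program α β) : ∀ K, K ∈ p.conts K := by
  induction p with
  | seq p q hp hq => intro K; exact Or.inr (Or.inr (hq K))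
  | _ => intro K; simp [conts]

/-! ### Binary counters -/

/-- The content of a cell of a work tape: counters are written in binary, least significant bit
first, to the right of a mark on the leftmost cell. -/
inductive Cell : Type
  | blank : Cell
  | mark : Cell
  | bit (b : Bool) : Cell

theorem finite_cell : Finite Cell := by
  let f : Cell → Option (Option Bool) := fun x =>
    match x with
    | Cell.bit b => some (some b)
    | Cell.mark => some none
    | Cell.blank => none
  refine Finite.of_injective f ?_
  intro x y h
  cases x <;> cases y <;> simp_all [f]

/-- The value of a list of bits, which may have zeros at its end. -/
def bitsVal : List Bool → ℕ
  | [] => 0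
  | b :: l => b.toNat + 2 * bitsVal l

/-- Adding or subtracting one. -/
def bumpBits (up : Bool) : List Bool → List Bool
  | [] => [up]
  | b :: l => if b = up then (!up) :: bumpBits up l else up :: l

theorem bitsVal_bumpBits_true (l : List Bool) :
    bitsVal (bumpBits true l) = bitsVal l + 1 := by
  induction l with
  | nil => simp [bumpBits, bitsVal]
  | cons b l ih => cases b <;> simp [bumpBits, bitsVal, ih] <;> omega

theorem bitsVal_bumpBits_false (l : List Bool) (h : bitsVal l ≠ 0) :
    bitsVal (bumpBits false l) = bitsVal l - 1 := by
  induction l with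
  | nil => simp [bitsVal] at h
  | cons b l ih =>
    cases b
    · have h' : bitsVal l ≠ 0 := by simpa [bitsVal] using h
      simp [bumpBits, bitsVal, ih h']; omega
    · simp [bumpBits, bitsVal]

/-- The list grows only if all its bits are one. The new value is then a power of two, whose size is
the new length. The maximum is needed because zeros at the end are allowed. -/
theorem length_bumpBits_true (l : List Bool) :
    (bumpBits true l).length ≤ max l.length (bitsVal l + 1).size := by
  have key : ∀ l, (bumpBits true l).length ≤ l.length ∨
      bitsVal l + 1 = 2 ^ l.length ∧ (bumpBits true l).length = l.length + 1 := by
    intro l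
    induction l with
    | nil => simp [bumpBits, bitsVal]
    | cons b l ih =>
      cases b
      · simp [bumpBits]
      · simp only [bumpBits, bitsVal, if_true, List.length_cons, pow_succ, Bool.toNat_true]
        omega
  rcases key l with h | ⟨h1, h2⟩
  · exact h.trans (le_max_left _ _)
  · rw [h1, h2, Nat.size_pow]; exact le_max_right _ _

theorem length_bumpBits_false (l : List Bool) (h : bitsVal l ≠ 0) :
    (bumpBits false l).length = l.length := by
  induction l with
  | nil => simp [bitsVal] at h
  | cons b l ih =>
    cases b
    · have h' : bitsVal l ≠ 0 := by simpa [bitsVal] using h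
      simp [bumpBits, ih h']
    · simp [bumpBits]

/-- The tape that holds a list of bits. -/
def tapeOf (l : List Bool) : ℕ → Cell
  | 0 => Cell.mark
  | j + 1 => (l[j]?).elim Cell.blank Cell.bit

theorem tapeOf_eq_mark (l : List Bool) (j : ℕ) : tapeOf l j = Cell.mark ↔ j = 0 := by
  cases j with
  | zero => simp [tapeOf]
  | succ j => cases h : l[j]? <;> simp [tapeOf, h]

theorem tapeOf_append_cons (l l' : List Bool) (b : Bool) :
    tapeOf (l ++ b :: l') (l.length + 1) = Cell.bit b := by
  simp [tapeOf]

theorem tapeOf_length (l : List Bool) : tapeOf l (l.length + 1) = Cell.blank := by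
  simp [tapeOf]

theorem update_tapeOf_append_cons (l l' : List Bool) (b c : Bool) :
    Function.update (tapeOf (l ++ b :: l')) (l.length + 1) (Cell.bit c) =
      tapeOf (l ++ c :: l') := by
  funext j
  cases j with
  | zero => simp [tapeOf]
  | succ j =>
    by_cases h : j = l.length
    · subst h; simp [tapeOf]
    · rw [Function.update_of_ne (by omega)]
      simp only [tapeOf, List.getElem?_append, List.getElem?_cons]
      split_ifs <;> first | rfl | omega

theorem update_tapeOf_length (l : List Bool) (c : Bool) :
    Function.update (tapeOf l) (l.length + 1) (Cell.bit c) = tapeOf (l ++ [c]) := by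
  funext j
  cases j with
  | zero => simp [tapeOf]
  | succ j =>
    by_cases h : j = l.length
    · subst h; simp [tapeOf]
    · rw [Function.update_of_ne (by omega)]
      simp only [tapeOf, List.getElem?_append, List.getElem?_cons]
      split_ifs with h1 h2
      · rfl
      · omega
      · rw [List.getElem?_eq_none (by omega)]; simp

/-! ### The machine that executes a program -/

/-- What the machine is doing: preparing the work tapes, reading the program, changing a counter,
comparing a counter with zero, or returning to the leftmost cells. -/
inductive Mode : Type
  | start | run | bump | scan | back

theorem finite_mode : Finite Mode := by
  let f : Mode → Fin 5 := fun x =>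
    match x with
    | Mode.start => 0
    | Mode.run => 1
    | Mode.bump => 2
    | Mode.scan => 3
    | Mode.back => 4
  refine Finite.of_injective f ?_
  intro x y h
  cases x <;> cases y <;> simp_all [f]

variable (p₀ : Program α β)

/-- The remaining program as a part of a state. -/
noncomputable def cont (K : List (Program α β)) : p₀.conts [] :=
  open Classical in if h : K ∈ p₀.conts [] then ⟨K, h⟩ else ⟨[], p₀.mem_conts []⟩

theorem cont_val {K : List (Program α β)} (h : K ∈ p₀.conts []) : (p₀.cont K).1 = K := by
  simp [cont, h]

/-- The work tape of a counter. -/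
def regIdx (r : ℕ) : Fin (p₀.maxReg + 1) := Fin.ofNat _ r

theorem regIdx_val {r : ℕ} (h : r ≤ p₀.maxReg) : (p₀.regIdx r : ℕ) = r :=
  Nat.mod_eq_of_lt (Nat.lt_succ_of_le h)

/-- Only the work head of one counter moves. -/
def moveAt (r : ℕ) (d : Move) : Fin (p₀.maxReg + 1) → Move :=
  Function.update (fun _ => Move.stay) (p₀.regIdx r) d

open Classical in
/-- The transition function. -/
noncomputable def delta (m : Mode) (K : List (Program α β)) (x : InputSymbol α)
    (g : Fin (p₀.maxReg + 1) → Cell) :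
    Option (Action (Mode × p₀.conts []) Cell β (p₀.maxReg + 1)) :=
  match m, K with
  | Mode.start, K => some ⟨(Mode.run, p₀.cont K), fun _ => Cell.mark, Move.stay,
      fun _ => Move.stay, none⟩
  | Mode.run, bump b r :: K => some ⟨(Mode.bump, p₀.cont (bump b r :: K)), g, Move.stay,
      p₀.moveAt r Move.right, none⟩
  | Mode.run, move d :: K => some ⟨(Mode.run, p₀.cont K), g, d, fun _ => Move.stay, none⟩
  | Mode.run, write b :: K => some ⟨(Mode.run, p₀.cont K), g, Move.stay, fun _ => Move.stay, some b⟩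
  | Mode.run, seq p q :: K => some ⟨(Mode.run, p₀.cont (p :: q :: K)), g, Move.stay,
      fun _ => Move.stay, none⟩
  | Mode.run, whileReg r p :: K => some ⟨(Mode.scan, p₀.cont (whileReg r p :: K)), g, Move.stay,
      p₀.moveAt r Move.right, none⟩
  | Mode.run, whileInput S p :: K => some ⟨(Mode.run, p₀.cont
      (if x ∈ S then p :: whileInput S p :: K else K)), g, Move.stay, fun _ => Move.stay, none⟩
  | Mode.bump, bump b r :: K =>
      if g (p₀.regIdx r) = Cell.bit b then
        some ⟨(Mode.bump, p₀.cont (bump b r :: K)),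
          Function.update g (p₀.regIdx r) (Cell.bit !b), Move.stay, p₀.moveAt r Move.right, none⟩
      else
        some ⟨(Mode.back, p₀.cont K),
          Function.update g (p₀.regIdx r) (Cell.bit b), Move.stay, fun _ => Move.stay, none⟩
  | Mode.scan, whileReg r p :: K =>
      if g (p₀.regIdx r) = Cell.bit false then
        some ⟨(Mode.scan, p₀.cont (whileReg r p :: K)), g, Move.stay, p₀.moveAt r Move.right, none⟩
      else
        some ⟨(Mode.back, p₀.cont
          (if g (p₀.regIdx r) = Cell.bit true then p :: whileReg r p :: K else K)), g, Move.stay,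
          fun _ => Move.stay, none⟩
  | Mode.back, K => some ⟨(if ∀ i, g i = Cell.mark then Mode.run else Mode.back, p₀.cont K), g,
      Move.stay, fun _ => Move.left, none⟩
  | _, _ => none

/-- The machine that executes a program. -/
noncomputable def machine : Machine α β where
  State := Mode × p₀.conts []
  finite_state :=
    haveI := finite_mode
    haveI := (p₀.conts_finite []).to_subtype
    inferInstance
  Work := Cell
  finite_work := finite_cell
  blank := Cell.blank
  numTapes := p₀.maxReg + 1
  start := (Mode.start, p₀.cont [p₀])
  accepting := ∅
  trans q x g := {a | p₀.delta q.1 q.2.1 x g = some a}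

theorem machine_deterministic : p₀.machine.Deterministic := by
  intro q x g a ha b hb
  exact Option.some_injective _ (ha.symm.trans hb)

/-- A configuration of the machine in which the counters are given by `L`. -/
noncomputable def cfg (m : Mode) (K : List (Program α β)) (pos : ℕ)
    (h : Fin (p₀.maxReg + 1) → ℕ) (L : Fin (p₀.maxReg + 1) → List Bool) (out : List β) :
    p₀.machine.Cfg where
  state := (m, p₀.cont K)
  inputHead := pos
  head := h
  tape := fun i => tapeOf (L i)
  output := out

/-- A computation which keeps all work heads to the left of position `n + 2`. -/
def Chain (w : List α) (n : ℕ) : p₀.machine.Cfg → p₀.machine.Cfg → Prop :=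
  Relation.ReflTransGen fun c c' => p₀.machine.Step w c c' ∧ ∀ i, c'.head i ≤ n + 1

variable {p₀} {w : List α} {n : ℕ} {K : List (Program α β)} {pos : ℕ}
  {h : Fin (p₀.maxReg + 1) → ℕ} {L : Fin (p₀.maxReg + 1) → List Bool} {out : List β}

theorem chain_step {m : Mode} {c' : p₀.machine.Cfg}
    {a : Action (Mode × p₀.conts []) Cell β (p₀.maxReg + 1)}
    (hK : K ∈ p₀.conts [])
    (ha : p₀.delta m K (inputCell w pos) (fun i => tapeOf (L i) (h i)) = some a)
    (hc : p₀.machine.perform w.length (p₀.cfg m K pos h L out) a = c')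
    (hh : ∀ i, c'.head i ≤ n + 1) :
    p₀.Chain w n (p₀.cfg m K pos h L out) c' := by
  refine Relation.ReflTransGen.single ⟨⟨a, ?_, hc.symm⟩, hh⟩
  show p₀.delta m (p₀.cont K).1 _ _ = some a
  rw [cont_val _ hK]
  exact ha

theorem moveInput_stay (hpos : pos ≤ w.length + 1) :
    Machine.moveInput w.length Move.stay pos = pos := by
  simpa [Machine.moveInput, Machine.moveWork] using hpos

/-- The position of the work heads when only the one of counter `r` has left its leftmost cell. -/
def headAt (p₀ : Program α β) (r j : ℕ) : Fin (p₀.maxReg + 1) → ℕ :=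
  Function.update (fun _ => 0) (p₀.regIdx r) j

theorem headAt_zero (r : ℕ) : headAt p₀ r 0 = fun _ => 0 := by
  simp [headAt]

theorem headAt_le {r j : ℕ} (hj : j ≤ n + 1) (i : Fin (p₀.maxReg + 1)) :
    headAt p₀ r j i ≤ n + 1 := by
  by_cases hi : i = p₀.regIdx r
  · subst hi; simpa [headAt] using hj
  · simp [headAt, hi]

theorem moveAt_headAt (r j : ℕ) :
    (fun i => Machine.moveWork (p₀.moveAt r Move.right i) (headAt p₀ r j i)) =
      headAt p₀ r (j + 1) := by
  funext i
  by_cases hi : i = p₀.regIdx r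
  · subst hi; simp [moveAt, headAt, Machine.moveWork]
  · simp [moveAt, headAt, Machine.moveWork, hi]

theorem chain_unchanged {m m' : Mode} {K' : List (Program α β)} {d : Move} {o : Option β}
    {wm : Fin (p₀.maxReg + 1) → Move} {pos' : ℕ} {h' : Fin (p₀.maxReg + 1) → ℕ} {out' : List β}
    (hK : K ∈ p₀.conts [])
    (ha : p₀.delta m K (inputCell w pos) (fun i => tapeOf (L i) (h i)) =
      some ⟨(m', p₀.cont K'), fun i => tapeOf (L i) (h i), d, wm, o⟩)
    (hpos : Machine.moveInput w.length d pos = pos')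
    (hh : (fun i => Machine.moveWork (wm i) (h i)) = h') (hout : out ++ o.toList = out')
    (hn : ∀ i, h' i ≤ n + 1) :
    p₀.Chain w n (p₀.cfg m K pos h L out) (p₀.cfg m' K' pos' h' L out') := by
  refine chain_step hK ha ?_ hn
  subst hpos hh hout
  unfold Machine.perform cfg
  congr 1
  funext i
  exact Function.update_eq_self _ _

theorem chain_update {m m' : Mode} {K' : List (Program α β)} {r j : ℕ} {b : Bool}
    {l l' : List Bool} {wm : Fin (p₀.maxReg + 1) → Move} {h' : Fin (p₀.maxReg + 1) → ℕ}
    (hK : K ∈ p₀.conts [])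
    (ha : p₀.delta m K (inputCell w pos)
        (fun i => tapeOf (Function.update L (p₀.regIdx r) l i) (headAt p₀ r j i)) =
      some ⟨(m', p₀.cont K'), Function.update
        (fun i => tapeOf (Function.update L (p₀.regIdx r) l i) (headAt p₀ r j i)) (p₀.regIdx r)
        (Cell.bit b), Move.stay, wm, none⟩)
    (hpos : pos ≤ w.length + 1)
    (hl : Function.update (tapeOf l) j (Cell.bit b) = tapeOf l')
    (hh : (fun i => Machine.moveWork (wm i) (headAt p₀ r j i)) = h')
    (hn : ∀ i, h' i ≤ n + 1) :
    p₀.Chain w n (p₀.cfg m K pos (headAt p₀ r j) (Function.update L (p₀.regIdx r) l) out)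
      (p₀.cfg m' K' pos h' (Function.update L (p₀.regIdx r) l') out) := by
  refine chain_step hK ha ?_ hn
  subst hh
  unfold Machine.perform cfg
  congr 1
  · exact moveInput_stay hpos
  · have hT (i : Fin (p₀.maxReg + 1)) :
        Function.update (tapeOf (Function.update L (p₀.regIdx r) l i)) (headAt p₀ r j i)
          (Function.update
            (fun i => tapeOf (Function.update L (p₀.regIdx r) l i) (headAt p₀ r j i))
            (p₀.regIdx r) (Cell.bit b) i) = tapeOf (Function.update L (p₀.regIdx r) l' i) := by
      by_cases hi : i = p₀.regIdx r
      · subst hi; simp [headAt, hl]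
      · simp [hi]
    exact funext hT
  · simp

/-- All heads are told to move left in each step, and those on the leftmost cells stay there. The
step that reads only marks moves nothing and switches to `Mode.run`. -/
theorem chain_back (hpos : pos ≤ w.length + 1) (hK : K ∈ p₀.conts []) (r : ℕ) :
    ∀ j ≤ n + 2, p₀.Chain w n (p₀.cfg Mode.back K pos (headAt p₀ r j) L out)
      (p₀.cfg Mode.run K pos (fun _ => 0) L out) := by
  intro j
  induction j with
  | zero =>
    intro _
    refine chain_unchanged (d := Move.stay) (o := none) (wm := fun _ => Move.left) hK ?_
      (moveInput_stay hpos) ?_ (by simp) (by simp)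
    · simp only [delta, headAt_zero, tapeOf_eq_mark, implies_true, if_true]
    · simp [Machine.moveWork, headAt_zero]
  | succ j ih =>
    intro hj
    refine Relation.ReflTransGen.trans ?_ (ih (by omega))
    refine chain_unchanged (d := Move.stay) (o := none) (wm := fun _ => Move.left) hK ?_
      (moveInput_stay hpos) ?_ (by simp) (fun i => headAt_le (by omega) i)
    · have : ¬ ∀ i, headAt p₀ r (j + 1) i = 0 := fun h0 => by
        have := h0 (p₀.regIdx r); simp [headAt] at this
      simp only [delta, tapeOf_eq_mark, this, if_false]
    · funext i
      by_cases hi : i = p₀.regIdx r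
      · subst hi; simp [headAt, Machine.moveWork]
      · simp [headAt, hi, Machine.moveWork]

/-- Induction on the bits `l` still ahead of the head; `l'` are the bits already passed by the carry
or borrow. As underflow is excluded, the blank behind the last bit is reached only when counting up,
and there the new leading one is written. -/
theorem chain_bump {b : Bool} {r : ℕ} (hpos : pos ≤ w.length + 1)
    (hK : bump b r :: K ∈ p₀.conts []) (hK' : K ∈ p₀.conts []) (l : List Bool) :
    ∀ l' : List Bool, l'.length + l.length ≤ n → (l' ++ bumpBits b l).length ≤ n →
      (b = true ∨ bitsVal l ≠ 0) →
      p₀.Chain w n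
        (p₀.cfg Mode.bump (bump b r :: K) pos (headAt p₀ r (l'.length + 1))
          (Function.update L (p₀.regIdx r) (l' ++ l)) out)
        (p₀.cfg Mode.run K pos (fun _ => 0)
          (Function.update L (p₀.regIdx r) (l' ++ bumpBits b l)) out) := by
  induction l with
  | nil =>
    intro l' _ hl hb
    have hb : b = true := by simpa [bitsVal] using hb
    subst hb
    simp only [bumpBits, List.length_append, List.length_cons, List.length_nil] at hl
    refine Relation.ReflTransGen.trans ?_ (chain_back hpos hK' r (l'.length + 1) (by omega))
    refine chain_update (b := true) (wm := fun _ => Move.stay) hK ?_ hpos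
      (by simp [update_tapeOf_length, bumpBits]) rfl (fun i => headAt_le (by omega) i)
    simp [delta, headAt, tapeOf_length]
  | cons c l ih =>
    intro l' h1 hl hb
    simp only [List.length_cons] at h1
    by_cases hc : c = b
    · subst hc
      have e1 : l' ++ bumpBits c (c :: l) = (l' ++ [!c]) ++ bumpBits c l := by simp [bumpBits]
      have e2 : l' ++ (!c) :: l = (l' ++ [!c]) ++ l := by simp
      have e3 : (l' ++ [!c]).length = l'.length + 1 := by simp
      rw [e1] at hl ⊢
      have key := ih (l' ++ [!c]) (by omega) hl (by
        cases c
        · simpa [bitsVal] using hb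
        · simp)
      rw [← e2, e3] at key
      refine Relation.ReflTransGen.trans ?_ key
      refine chain_update (b := !c) hK ?_ hpos
        (by simp [update_tapeOf_append_cons]) (moveAt_headAt r _)
        (fun i => headAt_le (by omega) i)
      simp [delta, headAt, tapeOf_append_cons]
    · have e1 : bumpBits b (c :: l) = b :: l := by simp [bumpBits, hc]
      rw [e1] at hl ⊢
      refine Relation.ReflTransGen.trans ?_ (chain_back hpos hK' r (l'.length + 1) (by omega))
      refine chain_update (b := b) (wm := fun _ => Move.stay) hK ?_ hpos
        (by simp [update_tapeOf_append_cons]) rfl (fun i => headAt_le (by omega) i)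
      simp [delta, headAt, tapeOf_append_cons, hc]

/-- Zeros are skipped, and the first one or the blank decides. Hence superfluous zeros at the end of
the list do no harm. -/
theorem chain_scan {q : Program α β} {r : ℕ} (hpos : pos ≤ w.length + 1)
    (hK : whileReg r q :: K ∈ p₀.conts []) (hK' : K ∈ p₀.conts [])
    (hq : q :: whileReg r q :: K ∈ p₀.conts []) (l : List Bool) :
    ∀ l' : List Bool, l'.length + l.length ≤ n →
      p₀.Chain w n
        (p₀.cfg Mode.scan (whileReg r q :: K) pos (headAt p₀ r (l'.length + 1))
          (Function.update L (p₀.regIdx r) (l' ++ l)) out)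
        (p₀.cfg Mode.run (if bitsVal l = 0 then K else q :: whileReg r q :: K) pos (fun _ => 0)
          (Function.update L (p₀.regIdx r) (l' ++ l)) out) := by
  induction l with
  | nil =>
    intro l' h1
    simp only [List.length_nil] at h1
    simp only [bitsVal, if_true]
    refine Relation.ReflTransGen.trans ?_ (chain_back hpos hK' r (l'.length + 1) (by omega))
    refine chain_unchanged (d := Move.stay) (o := none) (wm := fun _ => Move.stay) hK ?_
      (moveInput_stay hpos) rfl (by simp) (fun i => headAt_le (by omega) i)
    simp [delta, headAt, tapeOf_length]
  | cons c l ih =>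
    intro l' h1
    simp only [List.length_cons] at h1
    cases c
    · have e : l' ++ false :: l = (l' ++ [false]) ++ l := by simp
      have e3 : (l' ++ [false]).length = l'.length + 1 := by simp
      have key := ih (l' ++ [false]) (by omega)
      rw [← e, e3] at key
      simp only [bitsVal, Bool.toNat_false, zero_add, mul_eq_zero, OfNat.ofNat_ne_zero, false_or]
      refine Relation.ReflTransGen.trans ?_ key
      refine chain_unchanged (d := Move.stay) (o := none) hK ?_
        (moveInput_stay hpos) (moveAt_headAt r _) (by simp) (fun i => headAt_le (by omega) i)
      simp [delta, headAt, tapeOf_append_cons]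
    · have : bitsVal (true :: l) ≠ 0 := by simp [bitsVal]
      rw [if_neg this]
      refine Relation.ReflTransGen.trans ?_ (chain_back hpos hq r (l'.length + 1) (by omega))
      refine chain_unchanged (d := Move.stay) (o := none) (wm := fun _ => Move.stay) hK ?_
        (moveInput_stay hpos) rfl (by simp) (fun i => headAt_le (by omega) i)
      simp [delta, headAt, tapeOf_append_cons]

/-- The configuration represents `s`, and the list `K` is to be executed. -/
def Represents (p₀ : Program α β) (w : List α) (n : ℕ) (K : List (Program α β)) (s : Store β)
    (c : p₀.machine.Cfg) : Prop :=
  s.pos ≤ w.length + 1 ∧ ∃ L : Fin (p₀.maxReg + 1) → List Bool,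
    (∀ i, bitsVal (L i) = s.reg i ∧ (L i).length ≤ n) ∧
    c = p₀.cfg Mode.run K s.pos (fun _ => 0) L s.out

theorem exists_chain_bump {b : Bool} {r : ℕ} {s : Store β} {c : p₀.machine.Cfg} {x : ℕ}
    (hK : bump b r :: K ∈ p₀.conts []) (hK' : K ∈ p₀.conts []) (hr : r ≤ p₀.maxReg)
    (hc : Represents p₀ w n (bump b r :: K) s c) (hb : b = true ∨ s.reg r ≠ 0)
    (hx : ∀ l, bitsVal l = s.reg r → bitsVal (bumpBits b l) = x ∧
      (l.length ≤ n → (bumpBits b l).length ≤ n)) :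
    ∃ c', p₀.Chain w n c c' ∧
      Represents p₀ w n K { s with reg := Function.update s.reg r x } c' := by
  obtain ⟨hpos, L, hL, rfl⟩ := hc
  have hr' := p₀.regIdx_val hr
  obtain ⟨h1, h2⟩ := hL (p₀.regIdx r)
  rw [hr'] at h1
  obtain ⟨h3, h4⟩ := hx _ h1
  have key := chain_bump (L := L) (out := s.out) hpos hK hK' (L (p₀.regIdx r)) []
    (by simpa using h2) (by simpa using h4 h2) (by rwa [h1])
  refine ⟨_, Relation.ReflTransGen.trans ?_ key, hpos, _, ?_, rfl⟩
  · rw [List.nil_append, Function.update_eq_self]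
    refine chain_unchanged (d := Move.stay) (o := none) (wm := p₀.moveAt r Move.right) hK rfl
      (moveInput_stay hpos) ?_ (by simp) (fun i => headAt_le (by simp) i)
    have := moveAt_headAt (p₀ := p₀) r 0; rwa [headAt_zero] at this
  · intro i
    by_cases hi : i = p₀.regIdx r
    · subst hi; simp [h3, h4 h2, hr']
    · have : (i : ℕ) ≠ r := fun h => hi (Fin.ext (h.trans hr'.symm))
      simp [hi, this, hL]

theorem exists_chain_whileReg {q : Program α β} {r : ℕ} {s : Store β} {c : p₀.machine.Cfg}
    (hK : whileReg r q :: K ∈ p₀.conts []) (hK' : K ∈ p₀.conts [])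
    (hq : q :: whileReg r q :: K ∈ p₀.conts []) (hr : r ≤ p₀.maxReg)
    (hc : Represents p₀ w n (whileReg r q :: K) s c) :
    ∃ c', p₀.Chain w n c c' ∧
      Represents p₀ w n (if s.reg r = 0 then K else q :: whileReg r q :: K) s c' := by
  obtain ⟨hpos, L, hL, rfl⟩ := hc
  have hr' := p₀.regIdx_val hr
  obtain ⟨h1, h2⟩ := hL (p₀.regIdx r)
  rw [hr'] at h1
  have key := chain_scan (L := L) (out := s.out) hpos hK hK' hq (L (p₀.regIdx r)) []
    (by simpa using h2)
  rw [h1, List.nil_append, Function.update_eq_self] at key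
  refine ⟨_, Relation.ReflTransGen.trans ?_ key, hpos, _, hL, rfl⟩
  refine chain_unchanged (d := Move.stay) (o := none) (wm := p₀.moveAt r Move.right) hK rfl
    (moveInput_stay hpos) ?_ (by simp) (fun i => headAt_le (by simp) i)
  have := moveAt_headAt (p₀ := p₀) r 0; rwa [headAt_zero] at this

theorem exists_chain_simple {m : Program α β} {K' : List (Program α β)} {s : Store β} {d : Move}
    {o : Option β} {c : p₀.machine.Cfg} (hK : m :: K ∈ p₀.conts [])
    (hδ : ∀ g, p₀.delta Mode.run (m :: K) (inputCell w s.pos) g =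
      some ⟨(Mode.run, p₀.cont K'), g, d, fun _ => Move.stay, o⟩)
    (hc : Represents p₀ w n (m :: K) s c) :
    ∃ c', p₀.Chain w n c c' ∧ Represents p₀ w n K'
      { s with pos := Machine.moveInput w.length d s.pos, out := s.out ++ o.toList } c' := by
  obtain ⟨hpos, L, hL, rfl⟩ := hc
  exact ⟨_, chain_unchanged hK (hδ _) rfl rfl rfl (by simp [Machine.moveWork]),
    min_le_right _ _, L, hL, rfl⟩

theorem exists_chain_stay {m : Program α β} {K' : List (Program α β)} {s : Store β}
    {c : p₀.machine.Cfg} (hK : m :: K ∈ p₀.conts [])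
    (hδ : ∀ g, p₀.delta Mode.run (m :: K) (inputCell w s.pos) g =
      some ⟨(Mode.run, p₀.cont K'), g, Move.stay, fun _ => Move.stay, none⟩)
    (hc : Represents p₀ w n (m :: K) s c) :
    ∃ c', p₀.Chain w n c c' ∧ Represents p₀ w n K' s c' := by
  have := exists_chain_simple hK hδ hc
  simpa [moveInput_stay hc.1] using this

/-- Induction on the execution. Values up to `B` have at most `B.size` bits, so no increment pushes
a list of bits beyond length `n`. -/
theorem exists_chain_of_exec {B : ℕ} {p : Program α β} {s s' : Store β} (h : Exec w B p s s')
    (hB : B.size ≤ n) :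
    ∀ K, p.conts K ⊆ p₀.conts [] → p.maxReg ≤ p₀.maxReg → ∀ c, Represents p₀ w n (p :: K) s c →
      ∃ c', p₀.Chain w n c c' ∧ Represents p₀ w n K s' c' := by
  induction h with
  | @inc s r h =>
    intro K hK hr c hc
    refine exists_chain_bump (hK (cons_mem_conts _ _)) (hK (mem_conts _ _)) hr hc (Or.inl rfl) ?_
    intro l hl
    refine ⟨by rw [bitsVal_bumpBits_true, hl], fun hn => (length_bumpBits_true l).trans
      (max_le hn (le_trans (Nat.size_le_size ?_) hB))⟩
    omega
  | @dec s r h =>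
    intro K hK hr c hc
    refine exists_chain_bump (hK (cons_mem_conts _ _)) (hK (mem_conts _ _)) hr hc (Or.inr h) ?_
    intro l hl
    rw [← hl] at h
    exact ⟨by rw [bitsVal_bumpBits_false _ h, hl], fun hn => (length_bumpBits_false l h).trans_le hn⟩
  | move =>
    intro K hK _ c hc
    simpa using exists_chain_simple (hK (cons_mem_conts _ _)) (fun g => rfl) hc
  | write =>
    intro K hK _ c hc
    simpa [moveInput_stay hc.1] using
      exists_chain_simple (hK (cons_mem_conts _ _)) (fun g => rfl) hc
  | @seq p q s s' s'' _ _ ihp ihq =>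
    intro K hK hr c hc
    obtain ⟨c1, h1, hc1⟩ := exists_chain_stay (K' := p :: q :: K) (hK (cons_mem_conts _ _))
      (fun g => rfl) hc
    obtain ⟨c2, h2, hc2⟩ := ihp (q :: K) (fun x hx => hK (Or.inr (Or.inl hx)))
      (le_trans (le_max_left _ _) hr) c1 hc1
    obtain ⟨c3, h3, hc3⟩ := ihq K (fun x hx => hK (Or.inr (Or.inr hx)))
      (le_trans (le_max_right _ _) hr) c2 hc2
    exact ⟨c3, (h1.trans h2).trans h3, hc3⟩
  | @whileReg_zero r p s h =>
    intro K hK hr c hc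
    have := exists_chain_whileReg (hK (cons_mem_conts _ _)) (hK (mem_conts _ _))
      (hK (Or.inr (cons_mem_conts _ _))) ((le_max_left _ _).trans hr) hc
    simpa [h] using this
  | @whileReg_succ r p s s' s'' h _ _ ih1 ih2 =>
    intro K hK hr c hc
    obtain ⟨c1, h1, hc1⟩ := exists_chain_whileReg (hK (cons_mem_conts _ _)) (hK (mem_conts _ _))
      (hK (Or.inr (cons_mem_conts _ _))) ((le_max_left _ _).trans hr) hc
    rw [if_neg h] at hc1
    obtain ⟨c2, h2, hc2⟩ := ih1 _ (fun x hx => hK (Or.inr hx))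
      (le_trans (le_max_right _ _) hr) c1 hc1
    obtain ⟨c3, h3, hc3⟩ := ih2 K hK hr c2 hc2
    exact ⟨c3, (h1.trans h2).trans h3, hc3⟩
  | @whileInput_done S p s h =>
    intro K hK _ c hc
    exact exists_chain_stay (hK (cons_mem_conts _ _)) (fun g => by simp [delta, h]) hc
  | @whileInput_step S p s s' s'' h _ _ ih1 ih2 =>
    intro K hK hr c hc
    obtain ⟨c1, h1, hc1⟩ := exists_chain_stay (K' := p :: whileInput S p :: K)
      (hK (cons_mem_conts _ _)) (fun g => by simp [delta, h]) hc
    obtain ⟨c2, h2, hc2⟩ := ih1 _ (fun x hx => hK (Or.inr hx)) hr c1 hc1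
    obtain ⟨c3, h3, hc3⟩ := ih2 K hK hr c2 hc2
    exact ⟨c3, (h1.trans h2).trans h3, hc3⟩

theorem _root_.AutWP.Machine.Deterministic.step_unique {M : Machine α β} (hM : M.Deterministic)
    {w : List α} {c c₁ c₂ : M.Cfg} (h₁ : M.Step w c c₁) (h₂ : M.Step w c c₂) : c₁ = c₂ := by
  obtain ⟨a, ha, rfl⟩ := h₁
  obtain ⟨b, hb, rfl⟩ := h₂
  rw [hM _ _ _ ha hb]

/-- Execution of a program by a deterministic machine in logarithmic space. -/
theorem exists_machine (p : Program α β) :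
    ∃ M : Machine α β, M.Deterministic ∧ ∀ (w : List α) (B : ℕ) (s : Store β),
      Exec w B p ⟨fun _ => 0, 0, []⟩ s →
        M.HaltsWith w s.out ∧ ∀ c, M.Reachable w c → ∀ i, c.head i + 1 ≤ B.size + 2 := by
  refine ⟨p.machine, p.machine_deterministic, fun w B s hs => ?_⟩
  have h0 : p.Chain w B.size p.machine.init
      (p.cfg Mode.run [p] 0 (fun _ => 0) (fun _ => []) []) := by
    refine Relation.ReflTransGen.single
      ⟨⟨⟨(Mode.run, p.cont [p]), fun _ => Cell.mark, Move.stay, fun _ => Move.stay, none⟩, ?_, ?_⟩,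
        by simp [cfg]⟩
    · show p.delta Mode.start (p.cont [p]).1 _ _ = _
      rw [cont_val _ (cons_mem_conts p [])]
      rfl
    · unfold Machine.perform cfg Machine.init
      congr 1
      funext i j
      cases j with
      | zero => exact (Function.update_self 0 Cell.mark (fun _ : ℕ => Cell.blank)).symm
      | succ j => rw [Function.update_of_ne (Nat.succ_ne_zero j)]; rfl
  obtain ⟨c, h1, -, L, -, rfl⟩ := exists_chain_of_exec (p₀ := p) (n := B.size) hs le_rfl []
    subset_rfl le_rfl _ ⟨Nat.zero_le _, fun _ => [], fun i => ⟨rfl, Nat.zero_le _⟩, rfl⟩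
  have h2 := h0.trans h1
  have hterm : ∀ c', ¬ p.machine.Step w (p.cfg Mode.run [] s.pos (fun _ => 0) L s.out) c' := by
    rintro c' ⟨a, ha, -⟩
    change p.delta Mode.run (p.cont []).1 _ _ = some a at ha
    rw [cont_val _ (mem_conts p [])] at ha
    simp [delta] at ha
  refine ⟨⟨_, Relation.ReflTransGen.mono (fun _ _ h => h.1) _ _ h2, hterm, rfl⟩, ?_⟩
  -- By determinism the halting chain is the only computation, so the bound on its heads holds for
  -- every reachable configuration.
  suffices key : ∀ a b, p.Chain w B.size a b → (∀ c', ¬ p.machine.Step w b c') →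
      (∀ i, a.head i ≤ B.size + 1) → ∀ c, Relation.ReflTransGen (p.machine.Step w) a c →
      ∀ i, c.head i ≤ B.size + 1 by
    intro c hc i
    have := key _ _ h2 hterm (fun _ => Nat.zero_le _) c hc i
    omega
  intro a b hab
  induction hab using Relation.ReflTransGen.head_induction_on with
  | refl =>
    intro hb ha c hc
    rcases Relation.ReflTransGen.cases_head hc with rfl | ⟨d, hd, -⟩
    · exact ha
    · exact absurd hd (hb d)
  | head h _ ih =>
    intro hb ha c hc
    rcases Relation.ReflTransGen.cases_head hc with rfl | ⟨d, hd, hdc⟩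
    · exact ha
    · obtain rfl := p.machine_deterministic.step_unique hd h.1
      exact ih hb h.2 c hdc

end Program
end AutWP

namespace AutWP

/-! ## Functions computed in logarithmic space -/

/-- Putting a value in front of an environment. -/
def push (a : ℕ) (v : ℕ → ℕ) : ℕ → ℕ
  | 0 => a
  | i + 1 => v i

@[simp] theorem push_zero (a : ℕ) (v : ℕ → ℕ) : push a v 0 = a := rfl

@[simp] theorem push_one (a : ℕ) (v : ℕ → ℕ) : push a v 1 = v 0 := rfl

theorem comp_push (g : ℕ → ℕ) (k : ℕ) (ρ : ℕ → ℕ) : g ∘ push k ρ = push (g k) (g ∘ ρ) := by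
  funext i
  cases i <;> rfl

theorem push_lt {a A : ℕ} {v : ℕ → ℕ} (ha : a < A) (hv : ∀ i, v i < A) (i : ℕ) :
    push a v i < A := by
  cases i
  · exact ha
  · exact hv _

/-! ### Elementary counter programs: loops, clearing, transferring and copying counters, rewinding
the input -/

namespace Program

variable {α β : Type} {w : List α} {B : ℕ}

/-- The rule for counting loops: the invariant is indexed by the value of the loop counter, so
termination comes with it. -/
theorem exec_countdown {r : ℕ} {p : Program α β} (Inv : ℕ → Store β → Prop)
    (hr : ∀ n s, Inv n s → s.reg r = n)
    (hp : ∀ n s, Inv (n + 1) s → ∃ s', Exec w B p s s' ∧ Inv n s') :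
    ∀ n s, Inv n s → ∃ s', Exec w B (whileReg r p) s s' ∧ Inv 0 s' := by
  intro n
  induction n with
  | zero => exact fun s hs => ⟨s, .whileReg_zero (hr _ _ hs), hs⟩
  | succ n ih =>
    intro s hs
    obtain ⟨s1, h1, h1'⟩ := hp n s hs
    obtain ⟨s2, h2, h2'⟩ := ih s1 h1'
    exact ⟨s2, .whileReg_succ (by rw [hr _ _ hs]; omega) h1 h2, h2'⟩

/-- Setting a counter to zero. -/
def clear (r : ℕ) : Program α β := whileReg r (bump false r)

theorem exec_clear (r : ℕ) (s : Store β) :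
    Exec w B (clear r) s { s with reg := Function.update s.reg r 0 } := by
  obtain ⟨s', h, h0, h1, h2, h3⟩ := exec_countdown (w := w) (B := B) (r := r) (p := bump false r)
    (fun n s' => s'.reg r = n ∧ (∀ j ≠ r, s'.reg j = s.reg j) ∧ s'.pos = s.pos ∧ s'.out = s.out)
    (fun n s h => h.1) (fun n s1 h => ⟨_, .dec (by rw [h.1]; omega), by simp [h.1],
      fun j hj => by simp [hj, h.2.1], h.2.2⟩) (s.reg r) s ⟨rfl, fun _ _ => rfl, rfl, rfl⟩
  have : s' = { s with reg := Function.update s.reg r 0 } := by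
    obtain ⟨reg, pos, out⟩ := s'
    simp only at h0 h1 h2 h3
    rw [h2, h3]
    congr 1
    funext j
    by_cases hj : j = r
    · subst hj; simpa using h0
    · simp [hj, h1 j hj]
  rwa [this] at h

/-- Adding a counter to another one, which sets the former to zero. -/
def transfer (r r' : ℕ) : Program α β := whileReg r (seq (bump false r) (bump true r'))

theorem exec_transfer {r r' : ℕ} (hr : r ≠ r') {s : Store β} (h : s.reg r + s.reg r' ≤ B) :
    Exec w B (transfer r r') s { s with
      reg := Function.update (Function.update s.reg r 0) r' (s.reg r + s.reg r') } := by
  obtain ⟨s', h, h0, h0', h1, h2, h3⟩ := exec_countdown (w := w) (B := B) (r := r)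
    (p := seq (bump false r) (bump true r'))
    (fun n s' => s'.reg r = n ∧ s'.reg r' + n = s.reg r + s.reg r' ∧
      (∀ j, j ≠ r → j ≠ r' → s'.reg j = s.reg j) ∧ s'.pos = s.pos ∧ s'.out = s.out)
    (fun n s h => h.1) (by
      rintro n s1 ⟨h1, h2, h3, h4⟩
      refine ⟨_, .seq (.dec (by omega)) (.inc ?_), ?_, ?_, ?_, h4⟩
      · simp [hr.symm]; omega
      · simp [hr, h1]
      · simp [hr.symm]; omega
      · intro j hj hj'; simp [hj, hj', h3]) (s.reg r) s ⟨rfl, by omega, fun _ _ _ => rfl, rfl, rfl⟩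
  have : s' = { s with
      reg := Function.update (Function.update s.reg r 0) r' (s.reg r + s.reg r') } := by
    obtain ⟨reg, pos, out⟩ := s'
    simp only at h0 h0' h1 h2 h3
    rw [h2, h3]
    congr 1
    funext j
    by_cases hj : j = r'
    · subst hj; simpa using h0'
    by_cases hj' : j = r
    · subst hj'; simpa [hj] using h0
    · simp [hj, hj', h1 j hj' hj]
  rwa [this] at h

/-- Moving the input head to the left end. -/
def rewind : Program α β := whileInput {InputSymbol.leftEnd}ᶜ (move Move.left)

theorem inputCell_eq_leftEnd (w : List α) (i : ℕ) :
    inputCell w i = InputSymbol.leftEnd ↔ i = 0 := by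
  unfold inputCell
  split_ifs with h
  · simp [h]
  · cases w[i - 1]? <;> simp [h]

/-- All cells behind the word show the right end marker, so stopping the input head at `w.length +
1` does not affect what is read. -/
theorem inputCell_min (w : List α) (i : ℕ) :
    inputCell w (min i (w.length + 1)) = inputCell w i := by
  rcases le_total i (w.length + 1) with h | h
  · rw [min_eq_left h]
  · rw [min_eq_right h]
    unfold inputCell
    rw [if_neg (by omega), if_neg (by omega), List.getElem?_eq_none (by omega),
      List.getElem?_eq_none (by omega)]

theorem exec_rewind (s : Store β) : Exec w B rewind s { s with pos := 0 } := by
  obtain ⟨reg, pos, out⟩ := s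
  induction pos using Nat.strong_induction_on with
  | _ pos ih =>
    by_cases h : pos = 0
    · subst h
      exact .whileInput_done (by simp [inputCell])
    · refine .whileInput_step (by simpa [inputCell_eq_leftEnd] using h) .move (ih _ ?_)
      simp only [Machine.moveInput, Machine.moveWork]
      omega

/-- On input `w`, with data `s`, the program `p` computes `x` in counter `k` without changing
smaller counters. -/
def Computes (w : List α) (B k : ℕ) (p : Program α β) (s : Store β) (x : ℕ) : Prop :=
  ∃ s', Exec w B p s s' ∧ s'.reg k = x ∧ (∀ j < k, s'.reg j = s.reg j) ∧ s'.out = s.out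

/-- On input `w`, with data `s`, the program `p` writes `l` without changing counters smaller
than `k`. -/
def Prints (w : List α) (B k : ℕ) (p : Program α β) (s : Store β) (l : List β) : Prop :=
  ∃ s', Exec w B p s s' ∧ (∀ j < k, s'.reg j = s.reg j) ∧ s'.out = s.out ++ l

/-- Copying a counter; the next counter is used as well. -/
def copy (r k : ℕ) : Program α β :=
  seq (clear k) (seq (clear (k + 1)) (seq
    (whileReg r (seq (bump false r) (seq (bump true k) (bump true (k + 1)))))
    (transfer (k + 1) r)))

/-- A counter can only be read by counting it down. So its value is moved to two counters at once,
and one of them is moved back. -/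
theorem computes_copy {r k : ℕ} (hr : r < k) {s : Store β} (h : s.reg r ≤ B) :
    Computes w B k (copy r k) s (s.reg r) := by
  obtain ⟨s', h', h0, h1, h2, h3, h4⟩ := exec_countdown (w := w) (B := B) (r := r)
    (p := seq (bump false r) (seq (bump true k) (bump true (k + 1))))
    (fun n s' => s'.reg r = n ∧ s'.reg k + n = s.reg r ∧ s'.reg (k + 1) + n = s.reg r ∧
      (∀ j < k, j ≠ r → s'.reg j = s.reg j) ∧ s'.out = s.out)
    (fun n s h => h.1) (by
      rintro n s1 ⟨h1, h2, h3, h4, h5⟩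
      have e1 : k ≠ r := by omega
      have e2 : k + 1 ≠ r := by omega
      refine ⟨_, .seq (.dec (by omega)) (.seq (.inc ?_) (.inc ?_)), ?_, ?_, ?_, ?_, h5⟩
      · simp [e1]; omega
      · simp [e2]; omega
      · simp [e1.symm, e2.symm]; omega
      · simp [e1]; omega
      · simp [e2]; omega
      · intro j hj hj'
        simp [hj.ne, hj', (hj.trans (Nat.lt_succ_self k)).ne, h4 j hj hj']) (s.reg r)
    { s with reg := Function.update (Function.update s.reg k 0) (k + 1) 0 } (by
      simp [hr.ne, (hr.trans (Nat.lt_succ_self k)).ne]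
      intro j hj _
      simp [hj.ne, (hj.trans (Nat.lt_succ_self k)).ne])
  refine ⟨_, .seq (exec_clear _ _) (.seq (exec_clear _ _) (.seq h'
    (exec_transfer (by omega) (by omega)))), ?_, ?_, h4⟩
  · simp [hr.ne']; omega
  · intro j hj
    by_cases hjr : j = r
    · subst hjr; simp; omega
    · simp [hjr, (hj.trans (Nat.lt_succ_self k)).ne, h3 j hj hjr]

end Program

open Program

variable {α β : Type}

/-- `f w v` is bounded by a polynomial in the length of the word and the values of the variables,
and it can be computed with counters that are bounded by such a polynomial. -/
def IsLogFun (f : List α → (ℕ → ℕ) → ℕ) : Prop :=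
  ∃ e, (∀ w v A, w.length + 2 ≤ A → (∀ i, v i ≤ A) → f w v ≤ A ^ e) ∧
    ∀ (β : Type) (ρ : ℕ → ℕ) (k : ℕ), (∀ i, ρ i < k) → ∃ p : Program α β, ∀ w A (s : Store β),
      w.length + 2 ≤ A → (∀ j < k, s.reg j ≤ A) → Computes w (A ^ e) k p s (f w (s.reg ∘ ρ))

/-- The word `f w v` can be written with counters that are bounded by a polynomial in the length of
the word and the values of the variables. -/
def IsLogOutput (f : List α → (ℕ → ℕ) → List β) : Prop :=
  ∃ e, ∀ (ρ : ℕ → ℕ) (k : ℕ), (∀ i, ρ i < k) → ∃ p : Program α β, ∀ w A (s : Store β),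
      w.length + 2 ≤ A → (∀ j < k, s.reg j ≤ A) → Prints w (A ^ e) k p s (f w (s.reg ∘ ρ))

/-! ### Basic functions in logarithmic space and bounded primitive recursion -/

namespace IsLogFun

theorem of_eq {f g : List α → (ℕ → ℕ) → ℕ} (hf : IsLogFun f) (h : ∀ w v, f w v = g w v) :
    IsLogFun g := by
  have : f = g := by funext w v; exact h w v
  rwa [← this]

theorem var (i : ℕ) : IsLogFun (α := α) fun _ v => v i :=
  ⟨1, fun w v A _ hv => by simpa using hv i, fun β ρ k hρ => ⟨copy (ρ i) k, fun w A s _ hs =>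
    computes_copy (hρ i) (by simpa using hs _ (hρ i))⟩⟩

theorem zero : IsLogFun (α := α) fun _ _ => 0 :=
  ⟨0, fun w v A _ _ => by simp, fun β ρ k _ => ⟨clear k, fun w A s _ _ =>
    ⟨_, exec_clear _ _, by simp, fun j hj => by simp [hj.ne], rfl⟩⟩⟩

theorem succ {f : List α → (ℕ → ℕ) → ℕ} (hf : IsLogFun f) : IsLogFun fun w v => f w v + 1 := by
  obtain ⟨e, h1, h2⟩ := hf
  have key : ∀ A, 2 ≤ A → A ^ e + 1 ≤ A ^ (e + 1) := fun A hA => by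
    have : 1 ≤ A ^ e := Nat.one_le_pow _ _ (by omega)
    rw [pow_succ]; nlinarith
  refine ⟨e + 1, fun w v A hA hv => (Nat.succ_le_succ (h1 w v A hA hv)).trans (key A (by omega)),
    fun β ρ k hρ => ?_⟩
  obtain ⟨p, hp⟩ := h2 β ρ k hρ
  refine ⟨seq p (bump true k), fun w A s hA hs => ?_⟩
  obtain ⟨s', h3, h4, h5, h6⟩ := hp w A s hA hs
  have hb := h1 w (s.reg ∘ ρ) A hA (fun i => hs _ (hρ i))
  have hk := key A (by omega)
  exact ⟨_, .seq (h3.mono (by omega)) (.inc (by omega)), by simp [h4],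
    fun j hj => by simp [hj.ne, h5 j hj], h6⟩

theorem length : IsLogFun (α := α) fun w _ => w.length := by
  refine ⟨1, fun w v A hA _ => by simp; omega, fun β ρ k _ => ?_⟩
  refine ⟨seq rewind (seq (clear k) (seq (move Move.right)
    (whileInput {InputSymbol.rightEnd}ᶜ (seq (bump true k) (move Move.right))))),
    fun w A s hA _ => ?_⟩
  -- The head is one cell ahead of the counter because cell 0 holds the left end marker.
  have key : ∀ m (s' : Store β), s'.pos = s'.reg k + 1 → s'.reg k + m = w.length →
      ∃ s'', Exec w (A ^ 1)
        (whileInput {InputSymbol.rightEnd}ᶜ (seq (bump true k) (move Move.right))) s' s'' ∧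
        s''.reg k = w.length ∧ (∀ j < k, s''.reg j = s'.reg j) ∧ s''.out = s'.out := by
    intro m
    induction m with
    | zero =>
      intro s' h1 h2
      refine ⟨s', .whileInput_done ?_, by omega, fun _ _ => rfl, rfl⟩
      simp [inputCell, h1, List.getElem?_eq_none (show w.length ≤ s'.reg k by omega)]
    | succ m ih =>
      intro s' h1 h2
      have hlt : s'.reg k < w.length := by omega
      obtain ⟨s'', h3, h4, h5, h6⟩ := ih ⟨Function.update s'.reg k (s'.reg k + 1),
        Machine.moveInput w.length Move.right s'.pos, s'.out⟩
        (by simp [Machine.moveInput, Machine.moveWork]; omega) (by simp; omega)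
      refine ⟨s'', .whileInput_step ?_ (.seq (.inc (by rw [pow_one]; omega)) .move) h3, h4, ?_, h6⟩
      · simp [inputCell, h1, List.getElem?_eq_getElem hlt]
      · intro j hj
        rw [h5 j hj]
        simp [hj.ne]
  obtain ⟨s', h3, h4, h5, h6⟩ := key w.length ⟨Function.update s.reg k 0, 1, s.out⟩
    (by simp) (by simp)
  refine ⟨s', .seq (exec_rewind s) (.seq (exec_clear _ _) (.seq .move ?_)), h4, ?_, h6⟩
  · simpa [Machine.moveInput, Machine.moveWork] using h3
  · intro j hj
    rw [h5 j hj]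
    simp [hj.ne]

-- A while loop on the input symbol serves as a conditional: its body sets the result to one and
-- rewinds the head, and as the left end marker is not in `S`, the body runs at most once.
open Classical in
theorem inputCell_mem {f : List α → (ℕ → ℕ) → ℕ} (hf : IsLogFun f) {S : Set (InputSymbol α)}
    (hS : InputSymbol.leftEnd ∉ S) :
    IsLogFun fun w v => if inputCell w (f w v) ∈ S then 1 else 0 := by
  obtain ⟨e, h1, h2⟩ := hf
  refine ⟨e + 1, fun w v A hA hv => (show _ ≤ 1 by dsimp only; split_ifs <;> omega).trans
    (Nat.one_le_pow _ _ (by omega)), fun β ρ k hρ => ?_⟩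
  obtain ⟨p, hp⟩ := h2 β ρ k hρ
  refine ⟨seq p (seq rewind (seq (whileReg k (seq (bump false k) (move Move.right)))
    (whileInput S (seq (bump true k) rewind)))), fun w A s hA hs => ?_⟩
  have hA1 : 0 < A ^ (e + 1) := Nat.pow_pos (by omega)
  obtain ⟨s1, h3, h4, h5, h6⟩ := hp w A s hA hs
  set x := f w (s.reg ∘ ρ)
  obtain ⟨s2, h7, h8, h9, h10, h11⟩ := exec_countdown (w := w) (B := A ^ (e + 1)) (r := k)
    (p := seq (bump false k) (move Move.right))
    (fun n s' => s'.reg k = n ∧ s'.pos = min (x - n) (w.length + 1) ∧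
      (∀ j < k, s'.reg j = s.reg j) ∧ s'.out = s.out ∧ n ≤ x)
    (fun n s h => h.1) (by
      rintro n s1 ⟨h1, h2, h3, h4, h5⟩
      refine ⟨_, .seq (.dec (by omega)) .move, by simp [h1], ?_, ?_, h4, by omega⟩
      · simp only [Machine.moveInput, Machine.moveWork]
        omega
      · intro j hj
        simp [hj.ne, h3 j hj]) x { s1 with pos := 0 } ⟨h4, by simp, h5, h6, le_rfl⟩
  have hc : inputCell w s2.pos = inputCell w x := by rw [h9, inputCell_min, Nat.sub_zero]
  have h3' := h3.mono (Nat.pow_le_pow_right (show 0 < A by omega) (Nat.le_succ e))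
  by_cases hx : inputCell w x ∈ S
  · refine ⟨⟨Function.update s2.reg k (s2.reg k + 1), 0, s2.out⟩,
      .seq h3' (.seq (exec_rewind _) (.seq h7 (.whileInput_step
      (by rwa [hc]) (.seq (.inc (by omega)) (exec_rewind _)) (.whileInput_done ?_)))), ?_, ?_,
      h11.1⟩
    · simpa [inputCell] using hS
    · simp [h8]; exact hx
    · intro j hj
      simp [hj.ne, h10 j hj]
  · exact ⟨s2, .seq h3' (.seq (exec_rewind _) (.seq h7 (.whileInput_done (by rwa [hc])))),
      by simp [h8]; exact hx, h10, h11.1⟩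

theorem rename {f : List α → (ℕ → ℕ) → ℕ} (hf : IsLogFun f) (τ : ℕ → ℕ) :
    IsLogFun fun w v => f w (v ∘ τ) := by
  obtain ⟨e, h1, h2⟩ := hf
  exact ⟨e, fun w v A hA hv => h1 w _ A hA fun i => hv _, fun β ρ k hρ =>
    h2 β (ρ ∘ τ) k fun i => hρ _⟩

/-- Primitive recursion with small values. -/
theorem primRec {b z g : List α → (ℕ → ℕ) → ℕ} (hb : IsLogFun b) (hz : IsLogFun z)
    (hg : IsLogFun g) (F : List α → (ℕ → ℕ) → ℕ → ℕ) (hF0 : ∀ w v, F w v 0 = z w v)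
    (hF : ∀ w v i, F w v (i + 1) = g w (push (F w v i) (push i v)))
    (hbd : ∃ e, ∀ w v A, w.length + 2 ≤ A → (∀ i, v i ≤ A) → ∀ i ≤ b w v, F w v i ≤ A ^ e) :
    IsLogFun fun w v => F w v (b w v) := by
  obtain ⟨eb, hb1, hb2⟩ := hb
  obtain ⟨ez, hz1, hz2⟩ := hz
  obtain ⟨eg, hg1, hg2⟩ := hg
  obtain ⟨ea, ha⟩ := hbd
  have hpow : ∀ {A a c : ℕ}, 2 ≤ A → a ≤ c → A ^ a ≤ A ^ c := fun h h' =>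
    Nat.pow_le_pow_right (by omega) h'
  have hle : ∀ {A : ℕ}, 2 ≤ A → A ≤ A ^ (eb + ea + 1) := fun h => Nat.le_self_pow (by omega) _
  -- The programs for `z` and `g` start with counters as large as `A ^ (eb + ea + 1)`. This power
  -- takes the place of `A` in their bounds, so the exponents multiply.
  obtain ⟨E, hE1, hE2, hE3, hE4⟩ : ∃ E, eb ≤ E ∧ ea ≤ E ∧ (eb + ea + 1) * ez ≤ E ∧
      (eb + ea + 1) * eg ≤ E := ⟨eb + ea + (eb + ea + 1) * ez + (eb + ea + 1) * eg, by omega,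
        by omega, by omega, by omega⟩
  refine ⟨E, fun w v A hA hv => (ha w v A hA hv _ le_rfl).trans (hpow (by omega) (by omega)),
    fun β ρ k hρ => ?_⟩
  obtain ⟨pb, hpb⟩ := hb2 β ρ k hρ
  obtain ⟨pz, hpz⟩ := hz2 β ρ (k + 2) fun i => (hρ i).trans (by omega)
  obtain ⟨pg, hpg⟩ := hg2 β (push (k + 2) (push (k + 1) ρ)) (k + 3)
    (push_lt (by omega) (push_lt (by omega) fun i => (hρ i).trans (by omega)))
  -- Counter `k` holds the number of rounds left, `k + 1` the index, `k + 2` the current value of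
  -- `F`, and `k + 3` receives the next value.
  refine ⟨seq pb (seq (clear (k + 1)) (seq pz (seq
    (whileReg k (seq (bump false k) (seq pg (seq (clear (k + 2)) (seq (transfer (k + 3) (k + 2))
      (bump true (k + 1)))))))
    (transfer (k + 2) k)))), fun w A s hA hs => ?_⟩
  have hA2 : 2 ≤ A := by omega
  set v := s.reg ∘ ρ with hv_def
  have hv : ∀ i, v i ≤ A := fun i => hs _ (hρ i)
  have hbv : b w v ≤ A ^ (eb + ea + 1) := (hb1 w v A hA hv).trans (hpow hA2 (by omega))
  have hbE : b w v ≤ A ^ E := (hb1 w v A hA hv).trans (hpow hA2 hE1)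
  have haE : ∀ i ≤ b w v, F w v i ≤ A ^ E := fun i hi =>
    (ha w v A hA hv i hi).trans (hpow hA2 hE2)
  obtain ⟨s1, h3, h4, h5, h6⟩ := hpb w A s hA hs
  obtain ⟨s2, h7, h8, h9, h10⟩ := hpz w (A ^ (eb + ea + 1))
    { s1 with reg := Function.update s1.reg (k + 1) 0 } (hA.trans (hle hA2)) (fun j hj => by
      rcases Nat.lt_succ_iff_lt_or_eq.1 hj with hj | rfl
      · rcases Nat.lt_succ_iff_lt_or_eq.1 hj with hj' | rfl
        · simp [hj.ne, h5 j hj']; exact (hs j hj').trans (hle hA2)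
        · simpa [h4] using hbv
      · simp)
  have hv1 : Function.update s1.reg (k + 1) 0 ∘ ρ = v := by
    funext i
    have := hρ i
    rw [Function.comp_apply, Function.update_of_ne (by omega), h5 _ this]
    rfl
  rw [hv1] at h8
  obtain ⟨s3, h11, h12, h13, h14, h15⟩ := exec_countdown (w := w) (B := A ^ E) (r := k)
    (p := seq (bump false k) (seq pg (seq (clear (k + 2)) (seq (transfer (k + 3) (k + 2))
      (bump true (k + 1))))))
    (fun n s' => s'.reg k = n ∧ s'.reg (k + 1) + n = b w v ∧ s'.reg (k + 2) = F w v (b w v - n) ∧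
      (∀ j < k, s'.reg j = s.reg j) ∧ s'.out = s.out)
    (fun n s h => h.1) (by
      rintro n s' ⟨i1, i2, i3, i4, i5⟩
      obtain ⟨i, hi⟩ : ∃ i, s'.reg (k + 1) = i := ⟨_, rfl⟩
      have hin : b w v - (n + 1) = i := by omega
      have hin' : b w v - n = i + 1 := by omega
      rw [hin] at i3
      obtain ⟨t, j1, j2, j3, j4⟩ := hpg w (A ^ (eb + ea + 1))
        { s' with reg := Function.update s'.reg k (s'.reg k - 1) } (hA.trans (hle hA2)) (by
          intro j hj
          by_cases j0 : j = k
          · subst j0; simp [i1]; omega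
          by_cases j1 : j = k + 1
          · subst j1; simp; omega
          by_cases j2 : j = k + 2
          · subst j2; simp [i3]
            exact (ha w v A hA hv _ (by omega)).trans (hpow hA2 (by omega))
          · have hjk : j < k := by omega
            simp [j0, i4 j hjk]; exact (hs j hjk).trans (hle hA2))
      have hv2 : Function.update s'.reg k (s'.reg k - 1) ∘ push (k + 2) (push (k + 1) ρ) =
          push (F w v i) (push i v) := by
        rw [comp_push, comp_push]
        simp only [Function.update_of_ne (show k + 2 ≠ k by omega),
          Function.update_of_ne (show k + 1 ≠ k by omega), i3, hi]
        congr 2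
        funext i
        have := hρ i
        rw [Function.comp_apply, Function.update_of_ne this.ne, i4 _ this]
        rfl
      simp only [hv2, ← hF] at j2
      have t1 := j3 (k + 1) (by omega)
      have t0 := j3 k (by omega)
      simp [hi] at t1
      simp [i1] at t0
      refine ⟨_, .seq (.dec (by omega)) (.seq (j1.mono ?_) (.seq (exec_clear _ _)
        (.seq (exec_transfer (by omega) ?_) (.inc ?_)))), ?_, ?_, ?_, ?_, ?_⟩
      · rw [← pow_mul]; exact hpow hA2 hE4
      · simp [j2]; exact haE _ (by omega)
      · simp [t1]; omega
      · simp [t0]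
      · simp [t1]; omega
      · simp [j2, hin']
      · intro j hj
        have e1 : j ≠ k + 1 := by omega
        have e2 : j ≠ k + 2 := by omega
        have e3 : j ≠ k + 3 := by omega
        simp [e1, e2, e3, j3 j (by omega), hj.ne, i4 j hj]
      · exact j4.trans i5)
    (b w v) s2 (by
      refine ⟨?_, ?_, ?_, ?_, ?_⟩
      · rw [h9 k (by omega)]; simpa using h4
      · rw [h9 (k + 1) (by omega)]; simp
      · rw [h8, Nat.sub_self, hF0]
      · intro j hj
        rw [h9 j (by omega)]
        simp [(hj.trans (Nat.lt_succ_self k)).ne, h5 j hj]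
      · exact h10.trans h6)
  refine ⟨_, .seq (h3.mono (hpow hA2 hE1)) (.seq (exec_clear _ _) (.seq (h7.mono ?_) (.seq h11
    (exec_transfer (by omega) ?_)))), ?_, ?_, h15.2⟩
  · rw [← pow_mul]; exact hpow hA2 hE3
  · simp only [h12, h14]; simpa using haE _ le_rfl
  · simp [h12, h14]
  · intro j hj
    have e2 : j ≠ k + 2 := by omega
    simp [e2, hj.ne, h15.1 j hj]

end IsLogFun
end AutWP

namespace AutWP

variable {α β : Type}

/-! ### Arithmetic, predicates and quantifiers obtained from bounded recursion -/

namespace IsLogFun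

variable {f g h : List α → (ℕ → ℕ) → ℕ}

theorem const (c : ℕ) : IsLogFun (α := α) fun _ _ => c := by
  induction c with
  | zero => exact zero
  | succ c ih => exact ih.succ

/-- Skips the two variables, current value and index, that `primRec` puts in front. -/
theorem weaken (hf : IsLogFun f) : IsLogFun fun w v => f w (v ∘ fun i => i + 2) :=
  hf.rename _

theorem add (hf : IsLogFun f) (hg : IsLogFun g) : IsLogFun fun w v => f w v + g w v := by
  refine primRec hg hf (var 0).succ (fun w v i => f w v + i) (fun _ _ => rfl) (fun _ _ _ => rfl) ?_
  obtain ⟨e, he, -⟩ := hf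
  obtain ⟨e', he', -⟩ := hg
  refine ⟨e + e' + 1, fun w v A hA hv i hi => ?_⟩
  have h1 := he w v A hA hv
  have h2 := he' w v A hA hv
  have h3 : A ^ e ≤ A ^ (e + e') := Nat.pow_le_pow_right (by omega) (by omega)
  have h4 : A ^ e' ≤ A ^ (e + e') := Nat.pow_le_pow_right (by omega) (by omega)
  rw [pow_succ]
  nlinarith

/-- The recursion discards the current value and returns the index, which is one behind. -/
theorem pred (hf : IsLogFun f) : IsLogFun fun w v => f w v - 1 := by
  refine primRec hf zero (var 1) (fun w v i => i - 1) (fun _ _ => rfl) (fun _ _ _ => rfl) ?_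
  obtain ⟨e, he, -⟩ := hf
  exact ⟨e, fun w v A hA hv i hi => by have := he w v A hA hv; omega⟩

theorem sub (hf : IsLogFun f) (hg : IsLogFun g) : IsLogFun fun w v => f w v - g w v := by
  refine primRec hg hf (var 0).pred (fun w v i => f w v - i) (fun _ _ => rfl)
    (fun _ _ _ => by simp only [push_zero]; omega) ?_
  obtain ⟨e, he, -⟩ := hf
  exact ⟨e, fun w v A hA hv i hi => by have := he w v A hA hv; omega⟩

theorem mul (hf : IsLogFun f) (hg : IsLogFun g) : IsLogFun fun w v => f w v * g w v := by
  refine primRec hg zero ((var 0).add hf.weaken) (fun w v i => f w v * i) (fun _ _ => rfl)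
    (fun _ _ _ => by rw [mul_add, mul_one]; rfl) ?_
  obtain ⟨e, he, -⟩ := hf
  obtain ⟨e', he', -⟩ := hg
  exact ⟨e + e', fun w v A hA hv i hi => by
    rw [pow_add]; exact Nat.mul_le_mul (he w v A hA hv) (hi.trans (he' w v A hA hv))⟩

theorem pow_const (hf : IsLogFun f) (c : ℕ) : IsLogFun fun w v => f w v ^ c := by
  induction c with
  | zero => exact const 1
  | succ c ih => exact (ih.mul hf).of_eq fun _ _ => (pow_succ _ _).symm

end IsLogFun

open Classical in
/-- A predicate is decided in logarithmic space. -/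
def IsLogPred (p : List α → (ℕ → ℕ) → Prop) : Prop :=
  IsLogFun fun w v => if p w v then 1 else 0

namespace IsLogPred

variable {p q : List α → (ℕ → ℕ) → Prop} {f g : List α → (ℕ → ℕ) → ℕ}

theorem of_iff (hp : IsLogPred p) (h : ∀ w v, p w v ↔ q w v) : IsLogPred q := by
  have : p = q := by funext w v; exact propext (h w v)
  rwa [← this]

theorem const (c : Prop) : IsLogPred (α := α) fun _ _ => c := by
  by_cases h : c
  · exact (IsLogFun.const 1).of_eq fun _ _ => (if_pos h).symm
  · exact (IsLogFun.const 0).of_eq fun _ _ => (if_neg h).symm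

theorem and (hp : IsLogPred p) (hq : IsLogPred q) : IsLogPred fun w v => p w v ∧ q w v :=
  (IsLogFun.mul hp hq).of_eq fun w v => by
    by_cases h : p w v <;> by_cases h' : q w v <;> simp [h, h']

theorem not (hp : IsLogPred p) : IsLogPred fun w v => ¬ p w v :=
  ((IsLogFun.const 1).sub hp).of_eq fun w v => by by_cases h : p w v <;> simp [h]

theorem or (hp : IsLogPred p) (hq : IsLogPred q) : IsLogPred fun w v => p w v ∨ q w v :=
  (hp.not.and hq.not).not.of_iff fun w v => by tauto

theorem le (hf : IsLogFun f) (hg : IsLogFun g) : IsLogPred fun w v => f w v ≤ g w v :=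
  ((IsLogFun.const 1).sub (hf.sub hg)).of_eq fun w v => by split_ifs <;> omega

theorem lt (hf : IsLogFun f) (hg : IsLogFun g) : IsLogPred fun w v => f w v < g w v :=
  le hf.succ hg

theorem eq (hf : IsLogFun f) (hg : IsLogFun g) : IsLogPred fun w v => f w v = g w v :=
  ((le hf hg).and (le hg hf)).of_iff fun _ _ => le_antisymm_iff.symm

/-- The truth value for the indices treated so far is accumulated as a product of zeros and ones.
The renaming removes the accumulator, so that variable 0 is the index. -/
theorem forall_lt (hp : IsLogPred p) (hf : IsLogFun f) :
    IsLogPred fun w v => ∀ i < f w v, p w (push i v) := by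
  classical
  refine IsLogFun.primRec hf (.const 1) ((IsLogFun.var 0).mul (hp.rename fun i => i + 1))
    (fun w v i => @ite _ (∀ j < i, p w (push j v)) (Classical.propDecidable _) 1 0) (fun _ _ => by simp) ?_
    ⟨0, fun w v A _ _ i _ => by split_ifs <;> simp⟩
  intro w v i
  have h0 : ∀ a : ℕ, (push a (push i v) ∘ fun i => i + 1) = push i v := fun _ => rfl
  simp only [h0, push_zero, Nat.lt_succ_iff_lt_or_eq, or_imp, forall_and, forall_eq]
  by_cases h : ∀ j < i, p w (push j v)
  · by_cases h' : p w (push i v)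
    · rw [if_pos ⟨h, h'⟩, if_pos h, if_pos h']
    · rw [if_neg fun h'' => h' h''.2, if_neg h', mul_zero]
  · rw [if_neg fun h'' => h h''.1, if_neg h, zero_mul]

/-- The index type does not depend on the input, so this is a disjunction of fixed length. -/
theorem exists_finite {ι : Type*} [Finite ι] {p : ι → List α → (ℕ → ℕ) → Prop}
    (hp : ∀ i, IsLogPred (p i)) : IsLogPred fun w v => ∃ i, p i w v := by
  have key : ∀ l : List ι, IsLogPred fun w v => ∃ i ∈ l, p i w v := by
    intro l
    induction l with
    | nil => simpa using IsLogPred.const (α := α) False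
    | cons i l ih => exact ((hp i).or ih).of_iff fun w v => by simp
  have := Fintype.ofFinite ι
  exact (key Finset.univ.toList).of_iff fun w v => by simp

theorem forall_finite {ι : Type*} [Finite ι] {p : ι → List α → (ℕ → ℕ) → Prop}
    (hp : ∀ i, IsLogPred (p i)) : IsLogPred fun w v => ∀ i, p i w v :=
  (exists_finite fun i => (hp i).not).not.of_iff fun w v => by simp

/-- The letter in some cell of the input tape. -/
theorem inputCell_eq (hf : IsLogFun f) (x : InputSymbol α) :
    IsLogPred fun w v => inputCell w (f w v) = x := by
  by_cases hx : x = InputSymbol.leftEnd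
  · subst hx
    exact (eq hf (.const 0)).of_iff fun w v => (Program.inputCell_eq_leftEnd w _).symm
  · exact (hf.inputCell_mem (S := {x}) (by simpa using Ne.symm hx)).of_eq fun w v => rfl

end IsLogPred

namespace IsLogFun

variable {f g : List α → (ℕ → ℕ) → ℕ}

open Classical in
theorem ite {p : List α → (ℕ → ℕ) → Prop} (hp : IsLogPred p) (hf : IsLogFun f) (hg : IsLogFun g) :
    IsLogFun fun w v => if p w v then f w v else g w v :=
  ((mul hp hf).add (mul hp.not hg)).of_eq fun w v => by by_cases h : p w v <;> simp [h]

theorem min (hf : IsLogFun f) (hg : IsLogFun g) : IsLogFun fun w v => Min.min (f w v) (g w v) :=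
  (hf.sub (hf.sub hg)).of_eq fun w v => by omega

theorem div (hf : IsLogFun f) (hg : IsLogFun g) : IsLogFun fun w v => f w v / g w v := by
  classical
  -- Truncated at the index, the quotient grows by one in each round as long as one more multiple of
  -- the divisor fits, and `f w v` rounds suffice. The test for a positive divisor makes division by
  -- zero give zero.
  have h1 : IsLogFun fun w v => Min.min (f w v) (f w v / g w v) := by
    refine primRec hf zero ((var 0).add (IsLogPred.and
      (.le ((var 1).succ.mul hg.weaken) hf.weaken) (.lt zero hg.weaken)))
      (fun w v i => Min.min i (f w v / g w v)) (fun _ _ => by simp) ?_ ?_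
    · intro w v i
      have : ∀ a : ℕ, (push a (push i v) ∘ fun i => i + 2) = v := fun _ => rfl
      simp only [this, push_zero, push_one]
      rcases Nat.eq_zero_or_pos (g w v) with h | h
      · simp [h]
      · have := Nat.le_div_iff_mul_le (x := i + 1) (y := f w v) h
        simp only [← this, h, and_true]
        split_ifs <;> omega
    · obtain ⟨e, he, -⟩ := hf
      exact ⟨e, fun w v A hA hv i hi => (min_le_left _ _).trans (hi.trans (he w v A hA hv))⟩
  exact h1.of_eq fun w v => min_eq_right (Nat.div_le_self _ _)

theorem mod (hf : IsLogFun f) (hg : IsLogFun g) : IsLogFun fun w v => f w v % g w v :=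
  (hf.sub (hg.mul (hf.div hg))).of_eq fun w v => by
    have := Nat.div_add_mod (f w v) (g w v); omega

/-- Repeated division by `c`. The power itself must not be computed, as it may exceed all polynomial
bounds. -/
theorem div_pow (hf : IsLogFun f) (c : ℕ) (hg : IsLogFun g) :
    IsLogFun fun w v => f w v / c ^ g w v := by
  refine primRec hg hf ((var 0).div (const c)) (fun w v i => f w v / c ^ i) (fun _ _ => by simp)
    (fun w v i => by simp [pow_succ, Nat.div_div_eq_div_mul]) ?_
  obtain ⟨e, he, -⟩ := hf
  exact ⟨e, fun w v A hA hv i _ => (Nat.div_le_self _ _).trans (he w v A hA hv)⟩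

theorem size (hf : IsLogFun f) : IsLogFun fun w v => (f w v).size := by
  classical
  -- The recursion counts the exponents `i` for which the quotient by `2 ^ i` is still positive.
  have h1 : IsLogFun fun w v => Min.min (f w v) (f w v).size := by
    refine primRec hf zero ((var 0).add (IsLogPred.lt zero (hf.weaken.div_pow 2 (var 1))))
      (fun w v i => Min.min i (f w v).size) (fun _ _ => by simp) ?_ ?_
    · intro w v i
      have : ∀ a : ℕ, (push a (push i v) ∘ fun i => i + 2) = v := fun _ => rfl
      have h2 : 0 < f w v / 2 ^ i ↔ i < (f w v).size := by
        rw [Nat.lt_size, Nat.div_pos_iff]; simp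
      simp only [this, push_zero, push_one, h2]
      split_ifs <;> omega
    · obtain ⟨e, he, -⟩ := hf
      exact ⟨e, fun w v A hA hv i hi => (min_le_left _ _).trans (hi.trans (he w v A hA hv))⟩
  exact h1.of_eq fun w v => min_eq_right (Nat.size_le.2 Nat.lt_two_pow_self)

end IsLogFun

/-! ## Outputs written in logarithmic space -/

namespace IsLogOutput

open Program

variable {F G : List α → (ℕ → ℕ) → List β} {f : List α → (ℕ → ℕ) → ℕ}

theorem of_eq (hF : IsLogOutput F) (h : ∀ w v, F w v = G w v) : IsLogOutput G := by
  have : F = G := by funext w v; exact h w v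
  rwa [← this]

theorem singleton (b : β) : IsLogOutput (α := α) fun _ _ => [b] :=
  ⟨0, fun _ _ _ => ⟨.write b, fun _ _ _ _ _ => ⟨_, .write, fun _ _ => rfl, rfl⟩⟩⟩

theorem append (hF : IsLogOutput F) (hG : IsLogOutput G) :
    IsLogOutput fun w v => F w v ++ G w v := by
  obtain ⟨e, h1⟩ := hF
  obtain ⟨e', h2⟩ := hG
  refine ⟨e + e', fun ρ k hρ => ?_⟩
  obtain ⟨p, hp⟩ := h1 ρ k hρ
  obtain ⟨q, hq⟩ := h2 ρ k hρ
  refine ⟨seq p q, fun w A s hA hs => ?_⟩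
  obtain ⟨s1, h3, h4, h5⟩ := hp w A s hA hs
  obtain ⟨s2, h6, h7, h8⟩ := hq w A s1 hA (fun j hj => by rw [h4 j hj]; exact hs j hj)
  have : s1.reg ∘ ρ = s.reg ∘ ρ := by funext i; exact h4 _ (hρ i)
  exact ⟨s2, .seq (h3.mono (Nat.pow_le_pow_right (by omega) (by omega)))
    (h6.mono (Nat.pow_le_pow_right (by omega) (by omega))),
    fun j hj => by rw [h7 j hj, h4 j hj], by rw [h8, h5, this, List.append_assoc]⟩

theorem flatMap_range (hf : IsLogFun f) (hF : IsLogOutput F) :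
    IsLogOutput fun w v => (List.range (f w v)).flatMap fun i => F w (push i v) := by
  obtain ⟨e, h1, h2⟩ := hf
  obtain ⟨e', h3⟩ := hF
  have hpow : ∀ {A a c : ℕ}, 2 ≤ A → a ≤ c → A ^ a ≤ A ^ c := fun h h' =>
    Nat.pow_le_pow_right (by omega) h'
  have hle : ∀ {A : ℕ}, 2 ≤ A → A ≤ A ^ (e + 1) := fun h => Nat.le_self_pow (by omega) _
  refine ⟨e + (e + 1) * e', fun ρ k hρ => ?_⟩
  obtain ⟨p, hp⟩ := h2 β ρ k hρ
  obtain ⟨q, hq⟩ := h3 (push (k + 1) ρ) (k + 2)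
    (push_lt (by omega) fun i => (hρ i).trans (by omega))
  refine ⟨seq p (seq (clear (k + 1)) (whileReg k (seq (bump false k) (seq q (bump true (k + 1)))))),
    fun w A s hA hs => ?_⟩
  have hA2 : 2 ≤ A := by omega
  set v := s.reg ∘ ρ with hv_def
  have hfv : f w v ≤ A ^ e := h1 w v A hA fun i => hs _ (hρ i)
  have hfv1 : f w v ≤ A ^ (e + 1) := hfv.trans (hpow hA2 (Nat.le_succ e))
  have hfv2 : f w v ≤ A ^ (e + (e + 1) * e') := hfv.trans (hpow hA2 (by omega))
  obtain ⟨s1, h4, h5, h6, h7⟩ := hp w A s hA hs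
  obtain ⟨s2, h8, h9, h10, h11, h12⟩ := exec_countdown (w := w) (B := A ^ (e + (e + 1) * e'))
    (r := k) (p := seq (bump false k) (seq q (bump true (k + 1))))
    (fun n s' => s'.reg k = n ∧ s'.reg (k + 1) + n = f w v ∧ (∀ j < k, s'.reg j = s.reg j) ∧
      s'.out = s.out ++ (List.range (f w v - n)).flatMap fun i => F w (push i v))
    (fun n s h => h.1) (by
      rintro n s' ⟨i1, i2, i3, i4⟩
      obtain ⟨i, hi⟩ : ∃ i, s'.reg (k + 1) = i := ⟨_, rfl⟩
      have hin : f w v - (n + 1) = i := by omega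
      have hin' : f w v - n = i + 1 := by omega
      obtain ⟨t, j1, j2, j3⟩ := hq w (A ^ (e + 1))
        { s' with reg := Function.update s'.reg k (s'.reg k - 1) } (hA.trans (hle hA2)) (by
          intro j hj
          by_cases j0 : j = k
          · subst j0; simp [i1]; omega
          by_cases j1 : j = k + 1
          · subst j1; simp; omega
          · have hjk : j < k := by omega
            simp [j0, i3 j hjk]; exact (hs j hjk).trans (hle hA2))
      have hv2 : Function.update s'.reg k (s'.reg k - 1) ∘ push (k + 1) ρ = push i v := by
        rw [comp_push]
        simp only [Function.update_of_ne (show k + 1 ≠ k by omega), hi]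
        congr 1
        funext i
        have := hρ i
        rw [Function.comp_apply, Function.update_of_ne this.ne, i3 _ this]
        rfl
      simp only [hv2] at j3
      have t1 := j2 (k + 1) (by omega)
      have t0 := j2 k (by omega)
      simp [hi] at t1
      simp [i1] at t0
      refine ⟨_, .seq (.dec (by omega)) (.seq (j1.mono ?_) (.inc ?_)), ?_, ?_, ?_, ?_⟩
      · rw [← pow_mul]; exact hpow hA2 (by omega)
      · omega
      · simp [t0]
      · simp [t1]; omega
      · intro j hj
        have e1 : j ≠ k + 1 := by omega
        simp [e1, j2 j (by omega), hj.ne, i3 j hj]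
      · rw [hin', List.range_succ]
        simp [j3, i4, hin])
    (f w v) { s1 with reg := Function.update s1.reg (k + 1) 0 } (by
      refine ⟨by simpa using h5, by simp, ?_, by simpa using h7⟩
      intro j hj
      simp [(hj.trans (Nat.lt_succ_self k)).ne, h6 j hj])
  exact ⟨s2, .seq (h4.mono (hpow hA2 (by omega))) (.seq (exec_clear _ _) h8), h11, by simpa using h12⟩

-- Each branch is a loop whose number of rounds is the truth value of the condition or of its
-- negation.
open Classical in
theorem ite {p : List α → (ℕ → ℕ) → Prop} (hp : IsLogPred p) (hF : IsLogOutput F)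
    (hG : IsLogOutput G) : IsLogOutput fun w v => if p w v then F w v else G w v := by
  have hw : ∀ {H : List α → (ℕ → ℕ) → List β}, IsLogOutput H →
      IsLogOutput fun w v => H w (v ∘ fun i => i + 1) := fun ⟨e, h⟩ =>
    ⟨e, fun ρ k hρ => h (ρ ∘ _) k fun i => hρ _⟩
  refine ((flatMap_range hp (hw hF)).append (flatMap_range hp.not (hw hG))).of_eq fun w v => ?_
  have : ∀ i, (push i v ∘ fun i => i + 1) = v := fun _ => rfl
  by_cases h : p w v <;> simp [h, this]

end IsLogOutput

/-- Each bit is accessible by its index, so a numeral can be printed in a loop that obtains the bits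
from quotients by powers of two. -/
theorem bits_eq_map_range (n : ℕ) : n.bits = (List.range n.size).map n.testBit := by
  induction n using Nat.binaryRec' with
  | zero => simp
  | bit b n h ih =>
    rw [Nat.bits_append_bit n b h, Nat.size_bit (by simpa [Nat.bit_eq_zero_iff] using h), ih,
      List.range_succ_eq_map]
    simp [Function.comp_def, Nat.testBit_bit_succ]

theorem IsLogOutput.encodeNum {f : List α → (ℕ → ℕ) → ℕ} (hf : IsLogFun f) :
    IsLogOutput fun w v => encodeNum (f w v) := by
  classical
  refine ((flatMap_range hf.size (ite (.eq ((IsLogFun.div_pow (hf.rename fun i => i + 1) 2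
    (.var 0)).mod (.const 2)) (.const 1)) (singleton (Symbol.bit true))
    (singleton (Symbol.bit false)))).append (singleton Symbol.comma)).of_eq fun w v => ?_
  have : ∀ i, (push i v ∘ fun i => i + 1) = v := fun _ => rfl
  simp only [AutWP.encodeNum, bits_eq_map_range, this, List.map_map, List.append_left_inj,
    push_zero]
  rw [List.map_eq_flatMap]
  congr 1
  funext i
  simp only [Function.comp_apply, Nat.testBit_eq_decide_div_mod_eq]
  split_ifs with h <;> simp [h]

end AutWP

namespace AutWP

/-! ## Codes of configurations -/

/-- The number 0 is reserved for `x₀`, which will be the start state or the blank. So 0 codes the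
initial configuration, and the zero digits beyond the used part of a tape are read as blanks. -/
theorem exists_code (X : Type) [Finite X] (x₀ : X) :
    ∃ g, ∃ d : ℕ → X, d 0 = x₀ ∧ ∀ x, ∃ i < g, d i = x := by
  obtain ⟨n, ⟨e⟩⟩ := Finite.exists_equiv_fin X
  refine ⟨n + 1, fun i => if h : i - 1 < n ∧ i ≠ 0 then e.symm ⟨i - 1, h.1⟩ else x₀, by simp,
    fun x => ⟨e x + 1, by omega, by simp⟩⟩

theorem exists_digits (g n : ℕ) : ∀ d : ℕ → ℕ, (∀ p < n, d p < g) →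
    ∃ T < g ^ n, ∀ p, T / g ^ p % g = if p < n then d p else 0 := by
  induction n with
  | zero => exact fun d _ => ⟨0, by simp, fun p => by simp⟩
  | succ n ih =>
    intro d hd
    obtain ⟨T, hT, h⟩ := ih (fun p => d (p + 1)) (fun p hp => hd _ (by omega))
    have h0 := hd 0 (by omega)
    refine ⟨d 0 + g * T, ?_, fun p => ?_⟩
    · rw [pow_succ]; nlinarith
    · cases p with
      | zero => simp [Nat.mod_eq_of_lt h0]
      | succ p =>
        rw [pow_succ', ← Nat.div_div_eq_div_mul, Nat.add_mul_div_left _ _ (by omega),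
          Nat.div_eq_of_lt h0, zero_add, h]
        simp

/-- The digit number `j` of `x` in base `B`. -/
def digit (B x j : ℕ) : ℕ := x / B ^ j % B

namespace Machine

variable {α β : Type} {M : Machine α β}

theorem finite_inputSymbol [Finite α] : Finite (InputSymbol α) := by
  let f : InputSymbol α → Option (Option α) := fun x =>
    match x with
    | InputSymbol.letter a => some (some a)
    | InputSymbol.leftEnd => some none
    | InputSymbol.rightEnd => none
  refine Finite.of_injective f ?_
  intro x y h
  cases x <;> cases y <;> simp_all [f]

theorem finite_move : Finite Move := by
  let f : Move → Fin 3 := fun x =>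
    match x with
    | Move.left => 0
    | Move.stay => 1
    | Move.right => 2
  refine Finite.of_injective f ?_
  intro x y h
  cases x <;> cases y <;> simp_all [f]

theorem finite_action {State Work : Type} {k : ℕ} [Finite State] [Finite Work] [Finite β] :
    Finite (Action State Work β k) := by
  have := finite_move
  let f : Action State Work β k →
      State × (Fin k → Work) × Move × (Fin k → Move) × Option β := fun a =>
    (a.state, a.write, a.inputMove, a.workMove, a.output)
  refine Finite.of_injective f ?_
  rintro ⟨⟩ ⟨⟩ h
  simpa [f] using h

theorem Reachable.inputHead_le {w : List α} {c : M.Cfg} (h : M.Reachable w c) :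
    c.inputHead ≤ w.length + 1 := by
  induction h with
  | refl => exact Nat.zero_le _
  | tail _ h _ =>
    obtain ⟨a, -, rfl⟩ := h
    exact min_le_right _ _

theorem Reachable.tape_eq_blank {w : List α} {s : ℕ}
    (hs : ∀ c, M.Reachable w c → ∀ i, c.head i + 1 ≤ s) {c : M.Cfg} (h : M.Reachable w c) :
    ∀ i, ∀ p ≥ s, c.tape i p = M.blank := by
  induction h with
  | refl => exact fun _ _ _ => rfl
  | @tail c c' hc h ih =>
    obtain ⟨a, -, rfl⟩ := h
    intro i p hp
    have := hs c hc i
    exact (Function.update_of_ne (by omega) _ _).trans (ih i p hp)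

/-- The configuration with a given code: its components are the digits in base `B`, and the digits
of the latter components in base `g` give the contents of the cells of the work tapes. -/
def decode (M : Machine α β) (dS : ℕ → M.State) (dW : ℕ → M.Work) (g B x : ℕ) : M.Cfg where
  state := dS (digit B x 0 % g)
  inputHead := digit B x 1
  head i := digit B x (2 * i + 2)
  tape i p := dW (digit g (digit B x (2 * i + 3)) p)
  output := []

variable {dS : ℕ → M.State} {dW : ℕ → M.Work} {g B : ℕ}

theorem decode_zero (hS : dS 0 = M.start) (hW : dW 0 = M.blank) :
    M.decode dS dW g B 0 = M.init := by
  simp [decode, init, digit, hS, hW]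

/-- A tape on which only the first `s` cells are used is a number below `g ^ s`, hence a single
digit in base `B`. A configuration thus needs one digit each for the state and the input head, and
two for each work tape. -/
theorem exists_decode {s : ℕ} (hS : ∀ q, ∃ i < g, dS i = q) (hW : ∀ q, ∃ i < g, dW i = q)
    (hW0 : dW 0 = M.blank) (hg : g ≤ B) (hB : g ^ s ≤ B) {c : M.Cfg} (h1 : c.inputHead < B)
    (h2 : ∀ i, c.head i < B) (h3 : ∀ i, ∀ p ≥ s, c.tape i p = M.blank) (h4 : c.output = []) :
    ∃ x < B ^ (2 * M.numTapes + 2), M.decode dS dW g B x = c := by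
  obtain ⟨q, hq, hq'⟩ := hS c.state
  have hT : ∀ i, ∃ T < B, ∀ p, dW (digit g T p) = c.tape i p := by
    intro i
    choose f hf hf' using fun p => hW (c.tape i p)
    obtain ⟨T, hT, hT'⟩ := exists_digits g s f (fun p _ => hf p)
    refine ⟨T, hT.trans_le hB, fun p => ?_⟩
    rw [digit, hT']
    split_ifs with hp
    · exact hf' p
    · rw [hW0, h3 i p (by omega)]
  choose T hT hT' using hT
  obtain ⟨x, hx, hx'⟩ := exists_digits B (2 * M.numTapes + 2) (fun j =>
    if j = 0 then q else if j = 1 then c.inputHead else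
      if h : (j - 2) / 2 < M.numTapes then
        if j % 2 = 0 then c.head ⟨_, h⟩ else T ⟨_, h⟩ else 0) (by
      intro p hp
      split_ifs
      · omega
      · exact h1
      · exact h2 _
      · exact hT _
      · omega)
  refine ⟨x, hx, ?_⟩
  have e2 : ∀ i : Fin M.numTapes, digit B x (2 * i + 2) = c.head i := by
    intro i
    have : (2 * (i : ℕ) + 2 - 2) / 2 = i := by omega
    rw [digit, hx', if_pos (by omega), if_neg (by omega), if_neg (by omega), dif_pos (by omega),
      if_pos (by omega)]
    congr
  have e3 : ∀ i : Fin M.numTapes, digit B x (2 * i + 3) = T i := by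
    intro i
    have : (2 * (i : ℕ) + 3 - 2) / 2 = i := by omega
    rw [digit, hx', if_pos (by omega), if_neg (by omega), if_neg (by omega), dif_pos (by omega),
      if_neg (by omega)]
    congr
  have e0 : digit B x 0 = q := by rw [digit, hx']; simp
  have e1 : digit B x 1 = c.inputHead := by rw [digit, hx']; simp
  obtain ⟨_, _, _, _, _⟩ := c
  simp only [decode, e0, e1, e2, e3, Nat.mod_eq_of_lt hq, Cfg.mk.injEq]
  exact ⟨hq', trivial, trivial, by funext i p; exact hT' i p, h4.symm⟩

end Machine

/-! ## The configuration graph -/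

theorem IsLogFun.digit_const {α : Type} {f g : List α → (ℕ → ℕ) → ℕ} (hf : IsLogFun f)
    (hg : IsLogFun g) (j : ℕ) : IsLogFun fun w v => AutWP.digit (f w v) (g w v) j :=
  (hg.div (hf.pow_const j)).mod hf

theorem IsLogFun.moveWork {α : Type} {f : List α → (ℕ → ℕ) → ℕ} (hf : IsLogFun f) (d : Move) :
    IsLogFun fun w v => Machine.moveWork d (f w v) := by
  cases d
  · exact hf.pred
  · exact hf
  · exact hf.succ

/-- The function `d` need not be computable: only its values below the constant `g` matter, and
these form a finite table. -/
theorem IsLogPred.apply_mod_eq {α X : Type} {f : List α → (ℕ → ℕ) → ℕ} (hf : IsLogFun f)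
    (d : ℕ → X) {g : ℕ} (hg : 0 < g) (x : X) : IsLogPred fun w v => d (f w v % g) = x := by
  refine (exists_finite (ι := Fin g) (p := fun i w v => d i = x ∧ f w v % g = i) fun i =>
    (const _).and (eq (hf.mod (.const g)) (.const i))).of_iff fun w v => ?_
  constructor
  · rintro ⟨i, hi, h⟩
    rwa [h]
  · intro h
    exact ⟨⟨f w v % g, Nat.mod_lt _ hg⟩, h, rfl⟩

theorem digit_eq_zero {g B T p : ℕ} (hg : 2 ≤ g) (hT : T < B) (hp : B ≤ p) : digit g T p = 0 := by
  have : T < g ^ p := hT.trans_le (hp.trans (Nat.lt_pow_self hg).le)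
  rw [digit, Nat.div_eq_of_lt this, Nat.zero_mod]

namespace Machine

variable {α : Type} {M : Machine α Empty} {dS : ℕ → M.State} {dW : ℕ → M.Work} {g : ℕ}

/-- The right side is a disjunction over finitely many `t` (state, input symbol, symbols read,
action) of conditions on digits that can be tested in logarithmic space. Cells from `B` on need no
test, since their digits vanish. The symbol `r` of an unchanged cell is named so that each equation
compares a decoded digit with a constant. -/
theorem step_decode_iff {B : ℕ} (hB : 0 < B) (hg : 2 ≤ g) (w : List α) (x y : ℕ) :
    M.Step w (M.decode dS dW g B x) (M.decode dS dW g B y) ↔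
      ∃ t : M.State × InputSymbol α × (Fin M.numTapes → M.Work) ×
          Action M.State M.Work Empty M.numTapes,
        t.2.2.2 ∈ M.trans t.1 t.2.1 t.2.2.1 ∧ dS (digit B x 0 % g) = t.1 ∧
        inputCell w (digit B x 1) = t.2.1 ∧
        (∀ i : Fin M.numTapes, dW (digit g (digit B x (2 * i + 3)) (digit B x (2 * i + 2))) =
          t.2.2.1 i) ∧
        dS (digit B y 0 % g) = t.2.2.2.state ∧
        digit B y 1 = min (moveWork t.2.2.2.inputMove (digit B x 1)) (w.length + 1) ∧
        (∀ i : Fin M.numTapes, digit B y (2 * i + 2) =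
          moveWork (t.2.2.2.workMove i) (digit B x (2 * i + 2))) ∧
        ∀ i : Fin M.numTapes, ∀ p < B, p = digit B x (2 * i + 2) ∧
            dW (digit g (digit B y (2 * i + 3)) p) = t.2.2.2.write i ∨
          p ≠ digit B x (2 * i + 2) ∧ ∃ r, dW (digit g (digit B y (2 * i + 3)) p) = r ∧
            dW (digit g (digit B x (2 * i + 3)) p) = r := by
  have hlt : ∀ x j, digit B x j < B := fun x j => Nat.mod_lt _ hB
  constructor
  · rintro ⟨a, ha, h⟩
    simp only [decode, perform, Cfg.mk.injEq] at h
    obtain ⟨h1, h2, h3, h4, -⟩ := h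
    refine ⟨(_, _, _, a), ha, rfl, rfl, fun _ => rfl, h1, h2, fun i => congrFun h3 i,
      fun i p _ => ?_⟩
    have := congrFun (congrFun h4 i) p
    by_cases hp : p = digit B x (2 * i + 2)
    · left
      rw [← hp, Function.update_self] at this
      exact ⟨hp, this⟩
    · right
      rw [Function.update_of_ne hp] at this
      exact ⟨hp, _, this, rfl⟩
  · rintro ⟨⟨q, z, r, a⟩, ha, rfl, rfl, h1, h2, h3, h4, h5⟩
    obtain rfl : _ = r := funext h1
    refine ⟨a, ha, ?_⟩
    simp only [decode, perform, Cfg.mk.injEq]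
    refine ⟨h2, h3, funext h4, ?_, ?_⟩
    · funext i p
      by_cases hpB : p < B
      · rcases h5 i p hpB with ⟨h, h'⟩ | ⟨h, r, h', h''⟩
        · rw [h', ← h, Function.update_self]
        · rw [h', Function.update_of_ne h, h'']
      · have := hlt x (2 * i + 2)
        rw [Function.update_of_ne (by omega), digit_eq_zero hg (hlt _ _) (not_lt.1 hpB),
          digit_eq_zero hg (hlt _ _) (not_lt.1 hpB)]
    · obtain ⟨_, _, _, _, o⟩ := a
      cases o with
      | none => rfl
      | some e => exact e.elim

theorem isLogPred_step [Finite α] {B X Y : List α → (ℕ → ℕ) → ℕ} (hB : IsLogFun B)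
    (hX : IsLogFun X) (hY : IsLogFun Y) (hB0 : ∀ w v, 0 < B w v) (hg : 2 ≤ g) :
    IsLogPred fun w v =>
      M.Step w (M.decode dS dW g (B w v) (X w v)) (M.decode dS dW g (B w v) (Y w v)) := by
  have := M.finite_state
  have := M.finite_work
  have := finite_inputSymbol (α := α)
  have := finite_action (State := M.State) (Work := M.Work) (β := Empty) (k := M.numTapes)
  have hg0 : 0 < g := by omega
  refine (IsLogPred.exists_finite fun t => ?_).of_iff fun w v =>
    (step_decode_iff (hB0 w v) hg w _ _).symm
  have hx := fun j => hB.digit_const hX j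
  have hy := fun j => hB.digit_const hY j
  have hw : ∀ {f : List α → (ℕ → ℕ) → ℕ}, IsLogFun f →
      IsLogFun fun w v => f w (v ∘ fun i => i + 1) := fun h => h.rename _
  refine (IsLogPred.const _).and <| (IsLogPred.apply_mod_eq (hx 0) dS hg0 _).and <|
    (IsLogPred.inputCell_eq (hx 1) _).and <| (IsLogPred.forall_finite fun i =>
      IsLogPred.apply_mod_eq ((hx _).div_pow g (hx _)) dW hg0 _).and <|
    (IsLogPred.apply_mod_eq (hy 0) dS hg0 _).and <|
    (IsLogPred.eq (hy 1) (((hx 1).moveWork _).min IsLogFun.length.succ)).and <|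
    (IsLogPred.forall_finite fun i => IsLogPred.eq (hy _) ((hx _).moveWork _)).and <|
    IsLogPred.forall_finite fun i => ?_
  have h0 := IsLogFun.var (α := α) 0
  refine (IsLogPred.forall_lt (((IsLogPred.eq h0 (hw (hx (2 * i + 2)))).and
    (IsLogPred.apply_mod_eq ((hw (hy (2 * i + 3))).div_pow g h0) dW hg0 (t.2.2.2.write i))).or
    ((IsLogPred.eq h0 (hw (hx (2 * i + 2)))).not.and (IsLogPred.exists_finite fun r =>
      (IsLogPred.apply_mod_eq ((hw (hy (2 * i + 3))).div_pow g h0) dW hg0 r).and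
      (IsLogPred.apply_mod_eq ((hw (hx (2 * i + 3))).div_pow g h0) dW hg0 r)))) hB).of_iff
    fun w v => Iff.rfl

end Machine

/-- An exponential of a logarithm is polynomial, so the tapes have only polynomially many contents.
The base `n + 2` makes the bound meaningful for `n = 0` and `n = 1` as well. -/
theorem InBigO.exists_pow_le {s : ℕ → ℕ} (hs : InBigO s fun n => Real.log n) (g : ℕ) :
    ∃ c, ∀ n, g ^ s n ≤ (n + 2) ^ c := by
  obtain ⟨C, hC⟩ := hs.bound
  obtain ⟨n₀, hn₀⟩ := Filter.eventually_atTop.1 hC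
  obtain ⟨D, hD⟩ := exists_nat_ge (g * |C|)
  obtain ⟨m, hm⟩ : ∃ m, ∀ n < n₀, g ^ s n ≤ m :=
    ⟨∑ n ∈ Finset.range n₀, g ^ s n, fun n hn =>
      Finset.single_le_sum (f := fun n => g ^ s n) (fun _ _ => Nat.zero_le _) (by simpa using hn)⟩
  -- The exponent `D` serves the large `n`, and `m` the finitely many `n` below `n₀`.
  refine ⟨D + m, fun n => ?_⟩
  by_cases hn : n < n₀
  · calc g ^ s n ≤ m := hm n hn
      _ ≤ 2 ^ m := Nat.lt_two_pow_self.le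
      _ ≤ (n + 2) ^ m := Nat.pow_le_pow_left (by omega) _
      _ ≤ (n + 2) ^ (D + m) := Nat.pow_le_pow_right (by omega) (by omega)
  · have h1 := hn₀ n (not_lt.1 hn)
    have hlog : |Real.log n| ≤ Real.log ((n : ℝ) + 2) := by
      rcases Nat.eq_zero_or_pos n with rfl | hn
      · simp; exact Real.log_nonneg (by norm_num)
      · have : (1 : ℝ) ≤ n := by exact_mod_cast hn
        rw [abs_of_nonneg (Real.log_nonneg this)]
        exact Real.log_le_log (by linarith) (by linarith)
    have hlog0 : 0 ≤ Real.log ((n : ℝ) + 2) := (abs_nonneg _).trans hlog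
    simp only [Real.norm_eq_abs, Nat.abs_cast] at h1
    have h2 : (g : ℝ) * s n ≤ D * Real.log ((n : ℝ) + 2) := by
      calc (g : ℝ) * s n ≤ g * (|C| * Real.log ((n : ℝ) + 2)) := by
            refine mul_le_mul_of_nonneg_left (h1.trans ?_) (Nat.cast_nonneg _)
            exact mul_le_mul (le_abs_self C) hlog (abs_nonneg _) (abs_nonneg _)
        _ = g * |C| * Real.log ((n : ℝ) + 2) := by ring
        _ ≤ D * Real.log ((n : ℝ) + 2) := mul_le_mul_of_nonneg_right hD hlog0
    have h3 : (g : ℝ) ^ s n ≤ ((n : ℝ) + 2) ^ D := by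
      calc (g : ℝ) ^ s n ≤ Real.exp g ^ s n := pow_le_pow_left₀ (Nat.cast_nonneg _)
            (by linarith [Real.add_one_le_exp (g : ℝ)]) _
        _ = Real.exp (g * s n) := by rw [← Real.exp_nat_mul]; ring_nf
        _ ≤ Real.exp (D * Real.log ((n : ℝ) + 2)) := Real.exp_le_exp.2 h2
        _ = ((n : ℝ) + 2) ^ D := by
          rw [Real.exp_nat_mul, Real.exp_log (by positivity)]
    calc g ^ s n ≤ (n + 2) ^ D := by exact_mod_cast h3
      _ ≤ (n + 2) ^ (D + m) := Nat.pow_le_pow_right (by omega) (by omega)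

/-- Membership in a problem from `NL` means that there is no set of vertices of some graph which is
closed under edges, contains the vertex `0` and does not contain the last vertex. -/
theorem exists_graph_of_mem_NL {P : DecisionProblem} (hP : P ∈ NL) :
    ∃ (N : List P.Alphabet → ℕ) (E : List P.Alphabet → ℕ → ℕ → Prop),
      (∀ w, 0 < N w) ∧ (IsLogFun fun w _ => N w) ∧
      (∀ X Y, IsLogFun X → IsLogFun Y → IsLogPred fun w v => E w (X w v) (Y w v)) ∧
      ∀ x : P.Inst, x ∈ P.yes ↔ ¬ ∃ S : ℕ → Prop, S 0 ∧ ¬ S (N (P.encode x)) ∧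
        ∀ a ≤ N (P.encode x), ∀ b ≤ N (P.encode x), E (P.encode x) a b → S a → S b := by
  obtain ⟨M, s, hs, hspace, hM⟩ := hP
  have := P.finite_alphabet
  have := M.finite_state
  have := M.finite_work
  obtain ⟨gS, dS, hS0, hS⟩ := exists_code M.State M.start
  obtain ⟨gW, dW, hW0, hW⟩ := exists_code M.Work M.blank
  obtain ⟨g, hg, hg1, hg2⟩ : ∃ g, 2 ≤ g ∧ gS ≤ g ∧ gW ≤ g :=
    ⟨gS + gW + 2, by omega, by omega, by omega⟩
  replace hS : ∀ q, ∃ i < g, dS i = q := fun q =>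
    let ⟨i, hi, h⟩ := hS q; ⟨i, hi.trans_le hg1, h⟩
  replace hW : ∀ q, ∃ i < g, dW i = q := fun q =>
    let ⟨i, hi, h⟩ := hW q; ⟨i, hi.trans_le hg2, h⟩
  obtain ⟨c, hc⟩ := hs.exists_pow_le g
  -- The exponent `c` provides room for the tape contents. The summand `g` gives `g ≤ B w`, because
  -- `g ≤ 2 ^ g`, and makes the exponent positive, so that the positions of the input head fit.
  set B : List P.Alphabet → ℕ := fun w => (w.length + 2) ^ (c + g) with hB_def
  have hB0 : ∀ w, 0 < B w := fun w => Nat.pow_pos (by omega)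
  have hBs : ∀ w, g ^ s w.length ≤ B w := fun w =>
    (hc _).trans (Nat.pow_le_pow_right (by omega) (by omega))
  have hBg : ∀ w, g ≤ B w := fun w => Nat.lt_two_pow_self.le.trans
    ((Nat.pow_le_pow_left (by omega) _).trans
      (Nat.pow_le_pow_right (show 0 < w.length + 2 by omega) (Nat.le_add_left g c)))
  have hBl : ∀ w, w.length + 1 < B w := fun w =>
    (show w.length + 1 < w.length + 2 by omega).trans_le (Nat.le_self_pow (by omega) _)
  have hBf : IsLogFun fun (w : List P.Alphabet) _ => B w := IsLogFun.length.succ.succ.pow_const _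
  set N : List P.Alphabet → ℕ := fun w => B w ^ (2 * M.numTapes + 2) with hN_def
  set D : List P.Alphabet → ℕ → M.Cfg := fun w x => M.decode dS dW g (B w) x with hD_def
  have hNf : IsLogFun fun (w : List P.Alphabet) _ => N w := hBf.pow_const _
  -- As a number, `N w` also decodes to some configuration. The condition `y ≠ N w` prevents that
  -- the extra vertex is entered by an ordinary step.
  refine ⟨N, fun w x y => y = N w ∧ (D w x).state ∈ M.accepting ∨ y ≠ N w ∧ M.Step w (D w x) (D w y),
    fun w => Nat.pow_pos (hB0 w), hNf, ?_, ?_⟩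
  · intro X Y hX hY
    refine ((IsLogPred.eq hY hNf).and ?_).or ((IsLogPred.eq hY hNf).not.and
      (Machine.isLogPred_step hBf hX hY (fun w _ => hB0 w) hg))
    refine (IsLogPred.exists_finite (ι := M.accepting) fun q =>
      IsLogPred.apply_mod_eq (hBf.digit_const hX 0) dS (by omega : 0 < g) (q : M.State)).of_iff
      fun w v => ?_
    simp [hD_def, Machine.decode]
  · intro x
    set w := P.encode x
    have hsp := hspace w ⟨x, rfl⟩
    have hcode : ∀ c, M.Reachable w c → ∃ y < N w, D w y = c := by
      intro c hc
      refine Machine.exists_decode hS hW hW0 (hBg w) (hBs w)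
        (hc.inputHead_le.trans_lt (hBl w)) (fun i => ?_)
        (Machine.Reachable.tape_eq_blank hsp hc) ?_
      · have h1 := hsp c hc i
        have h2 := Nat.lt_pow_self (n := s w.length) (show 1 < g by omega)
        have h3 := hBs w
        omega
      · cases h : c.output with
        | nil => rfl
        | cons e _ => exact e.elim
    rw [← hM, iff_not_comm]
    constructor
    · rintro ⟨S, h0, hN, hE⟩ ⟨c, hc, hacc⟩
      -- A configuration may have several codes, so only one of them is claimed to lie in `S`. Edges
      -- join all codes below `N w` of consecutive configurations.
      have key : ∀ c, M.Reachable w c → ∃ y < N w, D w y = c ∧ S y := by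
        intro c hc
        induction hc with
        | refl => exact ⟨0, Nat.pow_pos (hB0 w), Machine.decode_zero hS0 hW0, h0⟩
        | @tail c c' hc h ih =>
          obtain ⟨y, hy, rfl, hSy⟩ := ih
          obtain ⟨y', hy', rfl⟩ := hcode c' (hc.tail h)
          exact ⟨y', hy', rfl, hE y hy.le y' hy'.le (Or.inr ⟨hy'.ne, h⟩) hSy⟩
      obtain ⟨y, hy, rfl, hSy⟩ := key c hc
      exact hN (hE y hy.le _ le_rfl (Or.inl ⟨rfl, hacc⟩) hSy)
    · intro hacc
      -- If nothing is accepted, the codes of reachable configurations form a closed set without the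
      -- extra vertex.
      refine ⟨fun y => y ≠ N w ∧ M.Reachable w (D w y), ⟨(Nat.pow_pos (hB0 w)).ne, ?_⟩,
        fun h => h.1 rfl, ?_⟩
      · rw [show D w 0 = M.init from Machine.decode_zero hS0 hW0]
        exact Relation.ReflTransGen.refl
      · rintro a - b - (⟨rfl, h⟩ | ⟨hb, h⟩) ⟨-, ha⟩
        · exact absurd ⟨_, ha, h⟩ hacc
        · exact ⟨hb, ha.tail h⟩

end AutWP

namespace AutWP

/-! ## Automata given by functions on numbers -/

namespace Automaton

/-- The automaton with the given output and transition functions. -/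
def ofFun (k s : ℕ) (out nxt : ℕ → ℕ → ℕ) : Automaton (Fin k) (Fin s) (Fin s) where
  δ := {t | (t.2.2.1 : ℕ) = out t.1 t.2.1 ∧ (t.2.2.2 : ℕ) = nxt t.1 t.2.1}

variable {k s : ℕ} {out nxt : ℕ → ℕ → ℕ}

theorem isGAutomaton_ofFun (hout : ∀ q < k, ∀ a < s, out q a < s)
    (hnxt : ∀ q < k, ∀ a < s, nxt q a < k)
    (hinj : ∀ q < k, ∀ a < s, ∀ b < s, out q a = out q b → a = b) :
    (ofFun k s out nxt).IsGAutomaton := by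
  refine ⟨fun q a => ?_, fun q a => ?_, fun q a => ?_⟩
  · rw [Set.encard_le_one_iff]
    rintro ⟨q1, a1, b1, p1⟩ ⟨q2, a2, b2, p2⟩ ⟨⟨h1, h2⟩, rfl, rfl⟩ ⟨⟨h3, h4⟩, rfl, rfl⟩
    simp only at h1 h2 h3 h4
    rw [Fin.ext (h1.trans h3.symm), Fin.ext (h2.trans h4.symm)]
  · rw [Set.encard_le_one_iff]
    rintro ⟨q1, a1, b1, p1⟩ ⟨q2, a2, b2, p2⟩ ⟨⟨h1, h2⟩, rfl, rfl⟩ ⟨⟨h3, h4⟩, h5, h6⟩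
    simp only at h1 h2 h3 h4 h5 h6
    subst h5 h6
    obtain rfl := Fin.ext (hinj _ q2.2 _ b1.2 _ b2.2 (h1.symm.trans h3))
    rw [Fin.ext (h2.trans h4.symm)]
  · rw [Set.one_le_encard_iff_nonempty]
    exact ⟨(q, a, ⟨_, hout q q.2 a a.2⟩, ⟨_, hnxt q q.2 a a.2⟩), ⟨rfl, rfl⟩, rfl, rfl⟩

/-- For fixed `q` and `a` exactly one output and target survive the filter, so the lexicographical
list can be printed by two nested loops. -/
theorem flatMap_listTransitions_ofFun (hout : ∀ q < k, ∀ a < s, out q a < s)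
    (hnxt : ∀ q < k, ∀ a < s, nxt q a < k) :
    (listTransitions (ofFun k s out nxt)).flatMap encodeTransition =
      (List.range k).flatMap fun q => (List.range s).flatMap fun a =>
        encodeNum q ++ encodeNum a ++ encodeNum (out q a) ++ encodeNum (nxt q a) := by
  classical
  have hlist : listTransitions (ofFun k s out nxt) = (List.finRange k).flatMap fun q =>
      (List.finRange s).flatMap fun a =>
        [(q, a, ⟨_, hout q q.2 a a.2⟩, ⟨_, hnxt q q.2 a a.2⟩)] := by
    rw [listTransitions, show ∀ {X Y : Type} (l : List X) (l' : List Y),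
      l ×ˢ l' = l.flatMap fun x => l'.map (Prod.mk x) from fun _ _ => rfl, List.filter_flatMap]
    refine List.flatMap_congr fun q _ => ?_
    rw [show ∀ {X Y : Type} (l : List X) (l' : List Y),
      l ×ˢ l' = l.flatMap fun x => l'.map (Prod.mk x) from fun _ _ => rfl, List.map_flatMap,
      List.filter_flatMap]
    refine List.flatMap_congr fun a _ => ?_
    have hnd := (List.nodup_finRange s).product (List.nodup_finRange k)
    have hmem : ((⟨_, hout q q.2 a a.2⟩, ⟨_, hnxt q q.2 a a.2⟩) : Fin s × Fin k) ∈
      List.finRange s ×ˢ List.finRange k := by simp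
    rw [List.filter_map, List.filter_map, List.filter_congr (q := fun z =>
      decide (z = ((⟨_, hout q q.2 a a.2⟩, ⟨_, hnxt q q.2 a a.2⟩) : Fin s × Fin k))),
      List.filter_eq, List.count_eq_one_of_mem hnd hmem]
    · rfl
    · rintro ⟨b, p⟩ -
      rw [Function.comp_apply, Function.comp_apply, Bool.eq_iff_iff, decide_eq_true_iff,
        decide_eq_true_iff]
      simp [ofFun, Fin.ext_iff]
  rw [hlist]
  simp only [List.flatMap_assoc, List.flatMap_cons, List.flatMap_nil, List.append_nil,
    encodeTransition, ← List.map_coe_finRange_eq_range, List.flatMap_map]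

/-! ### Runs -/

variable {Q A : Type}

theorem Run.append {T : Automaton Q A A} {q p r : Q} {u v u' v' : List A} (h : T.Run q u v p)
    (h' : T.Run p u' v' r) : T.Run q (u ++ u') (v ++ v') r := by
  induction h with
  | nil => exact h'
  | cons ht _ ih => exact .cons ht (ih h')

theorem Run.inverse {T : Automaton Q A A} {q p : Q} {u v : List A} (h : T.Run q u v p) :
    T.inverse.Run q v u p := by
  induction h with
  | nil => exact .nil _
  | cons ht _ ih => exact .cons ht ih

theorem Run.inl {T : Automaton Q A A} {q p : Q} {u v : List A} (h : T.Run q u v p) :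
    T.withInverse.Run (Sum.inl q) u v (Sum.inl p) := by
  induction h with
  | nil => exact .nil _
  | cons ht _ ih => exact .cons (Or.inl ⟨_, _, _, _, ht, rfl⟩) ih

theorem Run.inr {T : Automaton Q A A} {q p : Q} {u v : List A} (h : T.Run q u v p) :
    T.withInverse.Run (Sum.inr q) v u (Sum.inr p) := by
  have := h.inverse
  clear h
  induction this with
  | nil => exact .nil _
  | cons ht _ ih => exact .cons (Or.inr ⟨_, _, _, _, ht, rfl⟩) ih

theorem IsDeterministic.eq {T : Automaton Q A A} (hT : T.IsDeterministic) {q p p' : Q} {a b b' : A}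
    (h : (q, a, b, p) ∈ T.δ) (h' : (q, a, b', p') ∈ T.δ) : b = b' ∧ p = p' := by
  have := Set.encard_le_one_iff.1 (hT q a) (q, a, b, p) (q, a, b', p') ⟨h, rfl, rfl⟩ ⟨h', rfl, rfl⟩
  simpa using this

theorem withInverse_isDeterministic {T : Automaton Q A A} (hT : T.IsGAutomaton) :
    T.withInverse.IsDeterministic := by
  intro q a
  rw [Set.encard_le_one_iff]
  rintro _ _ ⟨⟨q1, a1, b1, p1, h1, rfl⟩ | ⟨q1, a1, b1, p1, h1, rfl⟩, rfl, rfl⟩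
    ⟨⟨q2, a2, b2, p2, h2, rfl⟩ | ⟨q2, a2, b2, p2, h2, rfl⟩, h3, h4⟩
  · obtain rfl : q2 = q1 := by simpa using h3
    obtain rfl : a2 = a1 := h4
    obtain ⟨rfl, rfl⟩ := hT.1.eq h1 h2
    rfl
  · simp at h3
  · simp at h3
  · obtain rfl : q2 = q1 := by simpa using h3
    obtain rfl : a2 = a1 := h4
    obtain ⟨rfl, rfl⟩ := hT.2.1.eq h1 h2
    rfl

theorem Run.unique {T : Automaton Q A A} (hT : T.IsDeterministic) {q p p' : Q} {u v v' : List A}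
    (h : T.Run q u v p) (h' : T.Run q u v' p') : v = v' := by
  induction h generalizing v' with
  | nil => cases h'; rfl
  | cons ht _ ih =>
    cases h' with
    | cons ht' h'' =>
      obtain ⟨rfl, rfl⟩ := hT.eq ht ht'
      rw [ih h'']

theorem Run.stateMap_eq {T : Automaton Q A A} (hT : T.IsDeterministic) {q p : Q} {u v : List A}
    (h : T.Run q u v p) : T.stateMap q u = Part.some v := by
  refine Part.eq_some_iff.2 ⟨⟨v, p, h⟩, ?_⟩
  have hex : ∃ v, ∃ p, T.Run q u v p := ⟨v, p, h⟩
  exact hex.choose_spec.choose_spec.unique hT h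

theorem seqMap_concat (T : Automaton Q A A) (qs : List Q) (q : Q) :
    T.seqMap (qs ++ [q]) = (T.stateMap q).comp (T.seqMap qs) := by
  simp [seqMap]

theorem seqMap_eq_self {T : Automaton Q A A} (hT : T.IsDeterministic) (u : List A) (qs : List Q)
    (h : ∀ q ∈ qs, ∃ p, T.Run q u u p) : T.seqMap qs u = Part.some u := by
  induction qs using List.reverseRecOn with
  | nil => rfl
  | append_singleton qs q ih =>
    obtain ⟨p, hp⟩ := h q (by simp)
    rw [seqMap_concat, PFun.comp_apply, ih fun q hq => h q (by simp [hq])]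
    exact (Part.bind_some _ _).trans (hp.stateMap_eq hT)

/-- The action of a sequence of states which permute one letter of some words. -/
theorem seqMap_eq_perm {T : Automaton Q (Fin s) (Fin s)} (hT : T.IsDeterministic)
    (π : Q → Equiv.Perm ℕ) (u u' : List (Fin s)) (qs : List Q)
    (hlt : ∀ q ∈ qs, ∀ a < s, π q a < s)
    (h : ∀ q ∈ qs, ∀ a b : Fin s, (b : ℕ) = π q a →
      ∃ p, T.Run q (u ++ a :: u') (u ++ b :: u') p) (a : Fin s) :
    ∃ b : Fin s, (b : ℕ) = (qs.map π).reverse.prod a ∧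
      T.seqMap qs (u ++ a :: u') = Part.some (u ++ b :: u') := by
  induction qs using List.reverseRecOn with
  | nil => exact ⟨a, rfl, rfl⟩
  | append_singleton qs q ih =>
    obtain ⟨b, hb, hb'⟩ := ih (fun q hq => hlt q (by simp [hq])) fun q hq => h q (by simp [hq])
    have hlt' := hlt q (by simp) b b.2
    obtain ⟨p, hp⟩ := h q (by simp) b ⟨_, hlt'⟩ rfl
    refine ⟨⟨_, hlt'⟩, by simp [hb], ?_⟩
    rw [seqMap_concat, PFun.comp_apply, hb']
    exact (Part.bind_some _ _).trans (hp.stateMap_eq hT)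

end Automaton
end AutWP

namespace AutWP

/-! ## The automaton for a graph

The letters at the first `V` positions of a word describe a set of vertices (the positions of the
letters other than `0`); the next letter is the one that may be changed. -/

/-- The state that belongs to gate `r`, position `i` and `b` matching vertices found so far. -/
def stateNum (V r i b : ℕ) : ℕ := (r * (V + 2) + i) * 3 + b

/-- The gate of kind `t` for the edge from `x` to `y`. -/
def gate (V t x y : ℕ) : ℕ := (t * V + x) * V + y

def gateOf (V q : ℕ) : ℕ := q / 3 / (V + 2)
def posOf (V q : ℕ) : ℕ := q / 3 % (V + 2)
def countOf (q : ℕ) : ℕ := q % 3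
def srcOf (V r : ℕ) : ℕ := r / V % V
def tgtOf (V r : ℕ) : ℕ := r % V
def kindOf (V r : ℕ) : ℕ := r / V / V

/-- The rotation of the letters `0, …, m`. -/
def rotFun (m a : ℕ) : ℕ := if a < m then a + 1 else if a = m then 0 else a

/-- The transposition of two letters. -/
def swapFun (x y a : ℕ) : ℕ := if a = x then y else if a = y then x else a

/-- The output of a state. -/
def outNum (V q a : ℕ) : ℕ :=
  if posOf V q = V then
    if kindOf V (gateOf V q) = 0 then
      if countOf q = 2 then a else rotFun (V * V) a
    else if kindOf V (gateOf V q) = 1 then swapFun (V * V) (V * V + 1) a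
    else if countOf q = 2 then swapFun 0 (V * V + 2) a else a
  else a

/-- The state reached from a state. -/
def nextNum (V q a : ℕ) : ℕ :=
  if posOf V q < V then
    stateNum V (gateOf V q) (posOf V q + 1)
      (min 2 (countOf q + (if posOf V q = srcOf V (gateOf V q) ∧ a ≠ 0 then 1 else 0) +
        (if posOf V q = tgtOf V (gateOf V q) ∧ a = 0 then 1 else 0)))
  else stateNum V (gateOf V q) (V + 1) 0

theorem gateOf_stateNum {V r i b : ℕ} (hi : i < V + 2) (hb : b < 3) :
    gateOf V (stateNum V r i b) = r := by
  unfold gateOf stateNum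
  rw [mul_comm _ 3, Nat.mul_add_div (by omega), Nat.div_eq_of_lt hb, add_zero, mul_comm r,
    Nat.mul_add_div (by omega), Nat.div_eq_of_lt hi, add_zero]

theorem posOf_stateNum {V r i b : ℕ} (hi : i < V + 2) (hb : b < 3) :
    posOf V (stateNum V r i b) = i := by
  unfold posOf stateNum
  rw [mul_comm _ 3, Nat.mul_add_div (by omega), Nat.div_eq_of_lt hb, add_zero, mul_comm r,
    Nat.mul_add_mod, Nat.mod_eq_of_lt hi]

theorem countOf_stateNum {V r i b : ℕ} (hb : b < 3) : countOf (stateNum V r i b) = b := by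
  unfold countOf stateNum
  omega

theorem stateNum_lt {V r i b R : ℕ} (hr : r < R) (hi : i < V + 2) (hb : b < 3) :
    stateNum V r i b < R * (V + 2) * 3 := by
  unfold stateNum
  have : r * (V + 2) + i < R * (V + 2) := by nlinarith
  omega

theorem tgtOf_gate {V t x y : ℕ} (hy : y < V) : tgtOf V (gate V t x y) = y := by
  unfold tgtOf gate
  rw [mul_comm, Nat.mul_add_mod, Nat.mod_eq_of_lt hy]

theorem gate_div {V t x y : ℕ} (hy : y < V) : gate V t x y / V = t * V + x := by
  unfold gate
  rw [mul_comm, Nat.mul_add_div (by omega), Nat.div_eq_of_lt hy, add_zero]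

theorem srcOf_gate {V t x y : ℕ} (hx : x < V) (hy : y < V) : srcOf V (gate V t x y) = x := by
  rw [srcOf, gate_div hy, mul_comm, Nat.mul_add_mod, Nat.mod_eq_of_lt hx]

theorem kindOf_gate {V t x y : ℕ} (hx : x < V) (hy : y < V) : kindOf V (gate V t x y) = t := by
  rw [kindOf, gate_div hy, mul_comm, Nat.mul_add_div (by omega), Nat.div_eq_of_lt hx, add_zero]

theorem gate_lt {V t x y : ℕ} (ht : t < 3) (hx : x < V) (hy : y < V) :
    gate V t x y < 3 * V * V := by
  unfold gate
  have : t * V + x < 3 * V := by nlinarith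
  nlinarith

/-! ### Gates as permutations of the letters -/

/-- The rotation of the letters `0, …, m` as a permutation. -/
def rot (m : ℕ) : Equiv.Perm ℕ where
  toFun := rotFun m
  invFun a := if a = 0 then m else if a ≤ m then a - 1 else a
  left_inv a := by
    dsimp only
    unfold rotFun
    rcases lt_trichotomy a m with h | rfl | h
    · rw [if_pos h, if_neg (Nat.succ_ne_zero a), if_pos (Nat.succ_le_of_lt h), Nat.add_sub_cancel]
    · simp
    · simp only [if_neg h.not_gt, if_neg h.ne', if_neg h.not_ge]
      split_ifs <;> omega
  right_inv a := by dsimp only; unfold rotFun; split_ifs <;> omega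

theorem rot_apply (m a : ℕ) : rot m a = rotFun m a := rfl

theorem rot_pow_apply {m : ℕ} (c : ℕ) : ∀ a, a + c ≤ m → (rot m ^ c) a = a + c := by
  induction c with
  | zero => simp
  | succ c ih =>
    intro a h
    rw [pow_succ', Equiv.Perm.mul_apply, ih a (by omega), rot_apply, rotFun, if_pos (by omega)]
    rfl

theorem rot_pow_apply_of_lt {m a : ℕ} (h : m < a) (c : ℕ) : (rot m ^ c) a = a := by
  induction c with
  | zero => simp
  | succ c ih =>
    rw [pow_succ', Equiv.Perm.mul_apply, ih, rot_apply, rotFun, if_neg (by omega),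
      if_neg (by omega)]

theorem swap_eq_swapFun (x y a : ℕ) : Equiv.swap x y a = swapFun x y a := by
  rw [Equiv.swap_apply_def]; rfl

/-- The set of vertices described by `f` violates the edge from `x` to `y`. -/
def Violates (f : ℕ → ℕ) (x y : ℕ) : Prop := f x ≠ 0 ∧ f y = 0

open Classical in
/-- The permutation of a letter by a gate, depending on the letters before it. -/
noncomputable def gatePerm (V : ℕ) (f : ℕ → ℕ) (r : ℕ) : Equiv.Perm ℕ :=
  if kindOf V r = 0 then
    if Violates f (srcOf V r) (tgtOf V r) then 1 else rot (V * V)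
  else if kindOf V r = 1 then Equiv.swap (V * V) (V * V + 1)
  else if Violates f (srcOf V r) (tgtOf V r) then Equiv.swap 0 (V * V + 2) else 1

theorem rotFun_lt {m a s : ℕ} (hm : m < s) (ha : a < s) : rotFun m a < s := by
  unfold rotFun; split_ifs <;> omega

theorem swapFun_lt {x y a s : ℕ} (hx : x < s) (hy : y < s) (ha : a < s) : swapFun x y a < s := by
  unfold swapFun; split_ifs <;> omega

theorem gatePerm_lt {V : ℕ} (f : ℕ → ℕ) (r : ℕ) {a : ℕ} (ha : a < V * V + 3) :
    gatePerm V f r a < V * V + 3 := by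
  unfold gatePerm
  split_ifs
  · exact ha
  · exact rotFun_lt (by omega) ha
  · rw [swap_eq_swapFun]; exact swapFun_lt (by omega) (by omega) ha
  · rw [swap_eq_swapFun]; exact swapFun_lt (by omega) (by omega) ha
  · exact ha

/-- The count 2 means that both ends of the edge witness a violation. Gates of kind 1 ignore the
count. -/
theorem outNum_eq_gatePerm {V r b : ℕ} {f : ℕ → ℕ} (hb : b < 3)
    (h : b = 2 ↔ Violates f (srcOf V r) (tgtOf V r)) (a : ℕ) :
    outNum V (stateNum V r V b) a = gatePerm V f r a := by
  rw [outNum, posOf_stateNum (by omega) hb, gateOf_stateNum (by omega) hb, countOf_stateNum hb,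
    gatePerm, if_pos rfl]
  by_cases h0 : kindOf V r = 0
  · by_cases h2 : Violates f (srcOf V r) (tgtOf V r)
    · rw [if_pos h0, if_pos h0, if_pos h2, if_pos (h.2 h2)]; rfl
    · rw [if_pos h0, if_pos h0, if_neg h2, if_neg (mt h.1 h2)]; rfl
  · by_cases h1 : kindOf V r = 1
    · rw [if_neg h0, if_neg h0, if_pos h1, if_pos h1, swap_eq_swapFun]
    · by_cases h2 : Violates f (srcOf V r) (tgtOf V r)
      · rw [if_neg h0, if_neg h0, if_neg h1, if_neg h1, if_pos h2, if_pos (h.2 h2),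
          swap_eq_swapFun]
      · rw [if_neg h0, if_neg h0, if_neg h1, if_neg h1, if_neg h2, if_neg (mt h.1 h2)]; rfl

/-- The number of states. -/
def stateCount (V : ℕ) : ℕ := 3 * V * V * (V + 2) * 3

/-- The number of letters. -/
def letterCount (V : ℕ) : ℕ := V * V + 3

theorem gateOf_lt {V q : ℕ} (hq : q < stateCount V) : gateOf V q < 3 * V * V := by
  rw [gateOf, Nat.div_div_eq_div_mul, Nat.div_lt_iff_lt_mul (by positivity)]
  unfold stateCount at hq
  linarith

theorem outNum_lt {V : ℕ} : ∀ q < stateCount V, ∀ a < letterCount V,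
    outNum V q a < letterCount V := by
  intro q _ a ha
  unfold letterCount at *
  unfold outNum
  split_ifs
  · exact ha
  · exact rotFun_lt (by omega) ha
  · exact swapFun_lt (by omega) (by omega) ha
  · exact swapFun_lt (by omega) (by omega) ha
  · exact ha
  · exact ha

/-- The cap 2 in `nextNum` keeps the count in range even in states that no run from an initial state
reaches. -/
theorem nextNum_lt {V : ℕ} : ∀ q < stateCount V, ∀ a < letterCount V,
    nextNum V q a < stateCount V := by
  intro q hq a _
  unfold nextNum stateCount
  split_ifs <;> exact stateNum_lt (gateOf_lt hq) (by omega) (by omega)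

theorem outNum_injective (V q : ℕ) : Function.Injective (outNum V q) := by
  have h1 : Function.Injective (rotFun (V * V)) := (rot (V * V)).injective
  have h2 : ∀ x y, Function.Injective (swapFun x y) := fun x y => by
    have : swapFun x y = Equiv.swap x y := funext fun a => (swap_eq_swapFun x y a).symm
    rw [this]; exact (Equiv.swap x y).injective
  intro a b
  unfold outNum
  split_ifs
  · exact id
  · exact fun h => h1 h
  · exact fun h => h2 _ _ h
  · exact fun h => h2 _ _ h
  · exact id
  · exact id

/-- The automaton for graphs with `V` vertices. -/
def graphAutomaton (V : ℕ) :
    Automaton (Fin (stateCount V)) (Fin (letterCount V)) (Fin (letterCount V)) :=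
  .ofFun _ _ (outNum V) (nextNum V)

theorem graphAutomaton_isGAutomaton (V : ℕ) : (graphAutomaton V).IsGAutomaton :=
  Automaton.isGAutomaton_ofFun outNum_lt nextNum_lt fun q _ _ _ _ _ h => outNum_injective V q h

/-! ### Runs of the automaton for a graph -/

section Run

variable {V r : ℕ}

/-- The state of the automaton with a given number. -/
def stateFin (hr : r < 3 * V * V) {i b : ℕ} (hi : i < V + 2) (hb : b < 3) : Fin (stateCount V) :=
  ⟨stateNum V r i b, stateNum_lt hr hi hb⟩

theorem run_tail (hr : r < 3 * V * V) (u : List (Fin (letterCount V))) :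
    (graphAutomaton V).Run (stateFin hr (Nat.lt_succ_self (V + 1)) (Nat.zero_lt_succ 2)) u u
      (stateFin hr (Nat.lt_succ_self (V + 1)) (Nat.zero_lt_succ 2)) := by
  induction u with
  | nil => exact .nil _
  | cons a u ih =>
    refine .cons ⟨?_, ?_⟩ ih
    · simp [stateFin, outNum, posOf_stateNum]
    · simp [stateFin, nextNum, posOf_stateNum, gateOf_stateNum]

/-- The letter at some position of a word. -/
def letterAt {s : ℕ} (u : List (Fin s)) (j : ℕ) : ℕ := (u[j]?).elim 0 Fin.val

/-- How many of the ends of the edge witness, within the first `i` letters, that the edge is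
violated. -/
def witnesses (V r : ℕ) (f : ℕ → ℕ) (i : ℕ) : ℕ :=
  (if srcOf V r < i ∧ f (srcOf V r) ≠ 0 then 1 else 0) +
    (if tgtOf V r < i ∧ f (tgtOf V r) = 0 then 1 else 0)

theorem witnesses_lt (f : ℕ → ℕ) (i : ℕ) : witnesses V r f i < 3 := by
  unfold witnesses; split_ifs <;> omega

/-- Letters before position `V` are copied, while the count records which ends of the edge have been
seen to support a violation. -/
theorem run_take (hr : r < 3 * V * V) (u : List (Fin (letterCount V))) :
    ∀ i (_ : i ≤ u.length) (hi : i ≤ V), (graphAutomaton V).Run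
      (stateFin hr (Nat.zero_lt_succ (V + 1)) (Nat.zero_lt_succ 2)) (u.take i) (u.take i)
      (stateFin hr (show i < V + 2 by omega)
        (witnesses_lt (V := V) (r := r) (letterAt u) i)) := by
  intro i
  induction i with
  | zero => intro _ _; simpa [witnesses] using Automaton.Run.nil _
  | succ i ih =>
    intro h1 h2
    rw [List.take_add_one, List.getElem?_eq_getElem (by omega)]
    refine (ih (by omega) (by omega)).append (.cons ⟨?_, ?_⟩ (.nil _))
    · have h3 : i ≠ V := by omega
      simp [stateFin, outNum, posOf_stateNum (show i < V + 2 by omega) (witnesses_lt _ _), h3]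
    · have h3 : i < V := by omega
      simp only [stateFin, nextNum, posOf_stateNum (show i < V + 2 by omega) (witnesses_lt _ _),
        gateOf_stateNum (show i < V + 2 by omega) (witnesses_lt _ _),
        countOf_stateNum (witnesses_lt _ _), h3, if_true]
      congr 1
      have hf : (u[i] : ℕ) = letterAt u i := by
        rw [letterAt, List.getElem?_eq_getElem (by omega)]; rfl
      rw [hf]
      generalize letterAt u = f
      unfold witnesses
      -- Reading the letter at position `i` adds exactly the contribution of the ends that are
      -- located there.
      have h4 : ∀ (x : ℕ) (P : ℕ → Prop) [DecidablePred P], (if x < i + 1 ∧ P (f x) then 1 else 0) =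
          (if x < i ∧ P (f x) then 1 else 0) + (if i = x ∧ P (f i) then 1 else 0) := by
        intro x P _
        rcases lt_trichotomy x i with h | rfl | h
        · simp [h, h.trans (Nat.lt_succ_self i), h.ne']
        · simp
        · simp [h.not_gt, h.ne, show ¬ x < i + 1 by omega]
      rw [h4 _ (fun a => a ≠ 0), h4 _ (fun a => a = 0)]
      split_ifs <;> omega

/-- After `V` letters the count is 2 iff the edge is violated, which determines how the next letter
is permuted. Position `V + 1` is a sink that copies the rest. -/
theorem run_change (hr : r < 3 * V * V) (u u' : List (Fin (letterCount V))) (hu : u.length = V)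
    (a b : Fin (letterCount V))
    (hb : (b : ℕ) = gatePerm V (letterAt u) r a)
    (hsrc : srcOf V r < V) (htgt : tgtOf V r < V) :
    (graphAutomaton V).Run (stateFin hr (Nat.zero_lt_succ (V + 1)) (Nat.zero_lt_succ 2))
      (u ++ a :: u') (u ++ b :: u')
      (stateFin hr (Nat.lt_succ_self (V + 1)) (Nat.zero_lt_succ 2)) := by
  have h1 := run_take hr u V hu.ge le_rfl
  rw [List.take_of_length_le hu.le] at h1
  refine h1.append (.cons ⟨?_, ?_⟩ (run_tail hr u'))
  · have h2 : witnesses V r (letterAt u) V = 2 ↔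
        Violates (letterAt u) (srcOf V r) (tgtOf V r) := by
      unfold witnesses Violates
      simp only [hsrc, htgt, true_and]
      split_ifs <;> simp [*]
    exact hb.trans (outNum_eq_gatePerm (witnesses_lt _ _) h2 a).symm
  · simp [stateFin, nextNum, posOf_stateNum (show V < V + 2 by omega) (witnesses_lt _ _),
      gateOf_stateNum (show V < V + 2 by omega) (witnesses_lt _ _)]

end Run
end AutWP

namespace AutWP

/-! ## The instance of the word problem for a graph -/

/-- The state in which gate `r` starts. -/
def initialState {V : ℕ} (hV : 0 < V) (r : ℕ) : Fin (stateCount V) :=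
  stateFin (Nat.mod_lt r (show 0 < 3 * V * V by positivity)) (Nat.zero_lt_succ (V + 1))
    (Nat.zero_lt_succ 2)

theorem initialState_val {V : ℕ} (hV : 0 < V) (r : ℕ) :
    (initialState hV r : ℕ) = stateNum V (r % (3 * V * V)) 0 0 := rfl

open Classical in
/-- The gate for the pair of vertices with number `c`. For a pair that is not an edge, it is the
gate of an edge that is never violated. -/
noncomputable def edgeGate (V : ℕ) (E : ℕ → ℕ → Prop) (c : ℕ) : ℕ :=
  gate V 0 (c / V) (if E (c / V) (c % V) then c % V else c / V)

/-- The first sequence of states of the instance for a graph. -/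
noncomputable def leftSeq {V : ℕ} (hV : 0 < V) (E : ℕ → ℕ → Prop) :
    List (Fin (stateCount V) ⊕ Fin (stateCount V)) :=
  Sum.inl (initialState hV (gate V 2 0 (V - 1))) ::
    ((List.range (V * V)).map (fun c => Sum.inl (initialState hV (edgeGate V E c))) ++
    (Sum.inl (initialState hV (gate V 1 0 0)) ::
    (List.range (V * V)).map fun c => Sum.inr (initialState hV (edgeGate V E c))))

/-- The second sequence of states of the instance for a graph. -/
noncomputable def rightSeq {V : ℕ} (hV : 0 < V) (E : ℕ → ℕ → Prop) :
    List (Fin (stateCount V) ⊕ Fin (stateCount V)) :=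
  (List.range (V * V)).map (fun c => Sum.inl (initialState hV (edgeGate V E c))) ++
    (Sum.inl (initialState hV (gate V 1 0 0)) ::
    ((List.range (V * V)).map (fun c => Sum.inr (initialState hV (edgeGate V E c))) ++
    [Sum.inl (initialState hV (gate V 2 0 (V - 1)))]))

/-- The instance for a graph with vertices `0, …, V - 1` and edges `E`. -/
noncomputable def graphInstance {V : ℕ} (hV : 0 < V) (E : ℕ → ℕ → Prop) : WPInstance where
  numStates := stateCount V
  numStates_pos := by unfold stateCount; positivity
  numLetters := letterCount V
  numLetters_pos := by unfold letterCount; positivity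
  T := graphAutomaton V
  isGAutomaton := graphAutomaton_isGAutomaton V
  left := leftSeq hV E
  right := rightSeq hV E

section

variable {V : ℕ} (hV : 0 < V) (E : ℕ → ℕ → Prop)

/-- The permutation of a letter by a state or its inverse, depending on the letters before it. -/
noncomputable def statePerm (V : ℕ) (f : ℕ → ℕ) :
    Fin (stateCount V) ⊕ Fin (stateCount V) → Equiv.Perm ℕ :=
  Sum.elim (fun q => gatePerm V f (gateOf V q)) fun q => (gatePerm V f (gateOf V q))⁻¹

theorem gateOf_initialState {r : ℕ} (hr : r < 3 * V * V) : gateOf V (initialState hV r) = r := by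
  rw [initialState_val, Nat.mod_eq_of_lt hr, gateOf_stateNum (by omega) (by omega)]

/-- An injective map of a finite set to itself is onto, so preimages of small letters are small. -/
theorem inv_lt {s : ℕ} {π : Equiv.Perm ℕ} (h : ∀ a < s, π a < s) : ∀ a < s, π⁻¹ a < s := by
  intro a ha
  have hinj : Set.InjOn π (Finset.range s) := π.injective.injOn
  have hmaps : Set.MapsTo π (Finset.range s) (Finset.range s) := fun a ha => by
    simpa using h a (by simpa using ha)
  obtain ⟨b, hb, rfl⟩ := Finset.surjOn_of_injOn_of_card_le π hmaps hinj le_rfl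
    (show a ∈ (Finset.range s : Set ℕ) by simpa using ha)
  simpa using hb

theorem statePerm_lt (f : ℕ → ℕ) (q : Fin (stateCount V) ⊕ Fin (stateCount V)) :
    ∀ a < letterCount V, statePerm V f q a < letterCount V := by
  rcases q with q | q
  · exact fun a => gatePerm_lt f _
  · exact inv_lt fun a => gatePerm_lt f _

theorem edgeGate_prop {c : ℕ} (hc : c < V * V) :
    ∃ x < V, ∃ y < V, edgeGate V E c = gate V 0 x y := by
  have hV : 0 < V := Nat.pos_of_ne_zero (by rintro rfl; simp at hc)
  have h1 : c / V < V := Nat.div_lt_of_lt_mul hc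
  refine ⟨_, h1, _, ?_, rfl⟩
  split_ifs
  · exact Nat.mod_lt _ hV
  · exact h1

theorem exists_of_mem_seq {q : Fin (stateCount V) ⊕ Fin (stateCount V)}
    (h : q ∈ leftSeq hV E ∨ q ∈ rightSeq hV E) :
    ∃ t < 3, ∃ x < V, ∃ y < V, q = Sum.inl (initialState hV (gate V t x y)) ∨
      q = Sum.inr (initialState hV (gate V t x y)) := by
  have key : q = Sum.inl (initialState hV (gate V 2 0 (V - 1))) ∨
      q = Sum.inl (initialState hV (gate V 1 0 0)) ∨
      ∃ c < V * V, q = Sum.inl (initialState hV (edgeGate V E c)) ∨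
        q = Sum.inr (initialState hV (edgeGate V E c)) := by
    simp only [leftSeq, rightSeq, List.mem_cons, List.mem_append, List.mem_map, List.mem_range,
      List.not_mem_nil, or_false] at h
    aesop
  rcases key with h | h | ⟨c, hc, h⟩
  · exact ⟨2, by omega, 0, hV, V - 1, by omega, Or.inl h⟩
  · exact ⟨1, by omega, 0, hV, 0, hV, Or.inl h⟩
  · obtain ⟨x, hx, y, hy, e⟩ := edgeGate_prop E hc
    rw [e] at h
    exact ⟨0, by omega, x, hx, y, hy, h⟩

theorem initialState_eq {r : ℕ} (hr : r < 3 * V * V) : initialState hV r =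
    stateFin hr (Nat.zero_lt_succ (V + 1)) (Nat.zero_lt_succ 2) := by
  unfold initialState
  congr 1
  exact Nat.mod_eq_of_lt hr

/-- Short words are not changed. -/
theorem seqMap_graphInstance_short {u : List (Fin (letterCount V))} (hu : u.length ≤ V)
    {qs : List (Fin (stateCount V) ⊕ Fin (stateCount V))}
    (hqs : qs = leftSeq hV E ∨ qs = rightSeq hV E) :
    (graphAutomaton V).withInverse.seqMap qs u = Part.some u := by
  refine Automaton.seqMap_eq_self (Automaton.withInverse_isDeterministic
    (graphAutomaton_isGAutomaton V)) u qs fun q hq => ?_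
  obtain ⟨t, ht, x, hx, y, hy, h⟩ := exists_of_mem_seq hV E (q := q) (by
    rcases hqs with rfl | rfl
    · exact Or.inl hq
    · exact Or.inr hq)
  have hr := gate_lt ht hx hy
  have key := run_take hr u u.length le_rfl hu
  rw [List.take_length] at key
  rw [initialState_eq hV hr] at h
  rcases h with rfl | rfl
  · exact ⟨_, key.inl⟩
  · exact ⟨_, key.inr⟩

/-- One letter of long words is permuted. -/
theorem seqMap_graphInstance_long {u : List (Fin (letterCount V))} (hu : u.length = V)
    (a : Fin (letterCount V)) (u' : List (Fin (letterCount V)))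
    {qs : List (Fin (stateCount V) ⊕ Fin (stateCount V))}
    (hqs : qs = leftSeq hV E ∨ qs = rightSeq hV E) :
    ∃ b : Fin (letterCount V), (b : ℕ) = (qs.map (statePerm V (letterAt u))).reverse.prod a ∧
      (graphAutomaton V).withInverse.seqMap qs (u ++ a :: u') = Part.some (u ++ b :: u') := by
  refine Automaton.seqMap_eq_perm (Automaton.withInverse_isDeterministic
    (graphAutomaton_isGAutomaton V)) _ u u' qs (fun q _ => statePerm_lt _ q) (fun q hq a b hb => ?_) a
  obtain ⟨t, ht, x, hx, y, hy, h⟩ := exists_of_mem_seq hV E (q := q) (by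
    rcases hqs with rfl | rfl
    · exact Or.inl hq
    · exact Or.inr hq)
  have hr := gate_lt ht hx hy
  have hg := gateOf_initialState hV hr
  have hsrc : srcOf V (gate V t x y) < V := by rwa [srcOf_gate hx hy]
  have htgt : tgtOf V (gate V t x y) < V := by rwa [tgtOf_gate hy]
  rcases h with rfl | rfl
  · rw [statePerm, Sum.elim_inl, hg] at hb
    rw [initialState_eq hV hr]
    exact ⟨_, (run_change hr u u' hu a b hb hsrc htgt).inl⟩
  · rw [statePerm, Sum.elim_inr, hg, Equiv.Perm.eq_inv_iff_eq] at hb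
    rw [initialState_eq hV hr]
    exact ⟨_, (run_change hr u u' hu b a hb.symm hsrc htgt).inr⟩

/-! ### The permutations induced by the two sequences -/

theorem reverse_prod_pow {G X : Type*} [Group G] (g : G) (ε : X → ℕ) (l : List X) :
    (l.map fun x => g ^ ε x).reverse.prod = g ^ (l.map ε).sum := by
  induction l with
  | nil => simp
  | cons x l ih => simp [ih, ← pow_add, add_comm]

/-- Powers of one element commute, so the inverse gates can be listed in the same order as the gates
and still compose to the inverse. -/
theorem reverse_prod_pow_inv {G X : Type*} [Group G] (g : G) (ε : X → ℕ) (l : List X) :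
    (l.map fun x => (g ^ ε x)⁻¹).reverse.prod = (g ^ (l.map ε).sum)⁻¹ := by
  have := reverse_prod_pow g⁻¹ ε l
  simpa only [inv_pow] using this

open Classical in
/-- The number of pairs whose gate is not violated. -/
noncomputable def satisfiedCount (V : ℕ) (E : ℕ → ℕ → Prop) (f : ℕ → ℕ) : ℕ :=
  ((List.range (V * V)).map fun c => if Violates f (srcOf V (edgeGate V E c))
    (tgtOf V (edgeGate V E c)) then 0 else 1).sum

theorem sum_map_range_le (ε : ℕ → ℕ) (hε : ∀ c, ε c ≤ 1) (m : ℕ) :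
    ((List.range m).map ε).sum ≤ m ∧
      (((List.range m).map ε).sum = m ↔ ∀ c < m, ε c = 1) := by
  induction m with
  | zero => simp
  | succ m ih =>
    have h1 := hε m
    simp only [List.range_succ, List.map_append, List.sum_append, List.map_cons, List.map_nil,
      List.sum_cons, List.sum_nil, Nat.lt_succ_iff_lt_or_eq, or_imp, forall_and, forall_eq,
      ← ih.2]
    omega

theorem satisfiedCount_le (f : ℕ → ℕ) : satisfiedCount V E f ≤ V * V :=
  (sum_map_range_le _ (fun c => by split_ifs <;> omega) _).1

/-- Gates of pairs that are not edges are never violated, so the full count is reached iff no edge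
is violated. -/
theorem satisfiedCount_eq_iff (hV : 0 < V) (f : ℕ → ℕ) : satisfiedCount V E f = V * V ↔
    ∀ x < V, ∀ y < V, E x y → f x ≠ 0 → f y ≠ 0 := by
  rw [satisfiedCount, (sum_map_range_le _ (fun c => by split_ifs <;> omega) _).2]
  have h1 : ∀ c < V * V, Violates f (srcOf V (edgeGate V E c)) (tgtOf V (edgeGate V E c)) ↔
      E (c / V) (c % V) ∧ f (c / V) ≠ 0 ∧ f (c % V) = 0 := by
    intro c hc
    have hx : c / V < V := Nat.div_lt_of_lt_mul hc
    have hy := Nat.mod_lt c hV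
    unfold edgeGate
    split_ifs with h
    · rw [srcOf_gate hx hy, tgtOf_gate hy, Violates]; simp [h]
    · rw [srcOf_gate hx hx, tgtOf_gate hx, Violates]; simp [h]
  constructor
  · intro h x hx y hy hE hfx hfy
    have hc : V * x + y < V * V := by nlinarith
    have h2 := h _ hc
    have e1 : (V * x + y) / V = x := by
      rw [Nat.mul_add_div hV, Nat.div_eq_of_lt hy, add_zero]
    have e2 : (V * x + y) % V = y := by rw [Nat.mul_add_mod, Nat.mod_eq_of_lt hy]
    rw [if_pos ((h1 _ hc).2 (by rw [e1, e2]; exact ⟨hE, hfx, hfy⟩))] at h2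
    omega
  · intro h c hc
    rw [if_neg]
    rw [h1 c hc]
    rintro ⟨hE, hx, hy⟩
    exact h _ (Nat.div_lt_of_lt_mul hc) _ (Nat.mod_lt c hV) hE hx hy

open Classical in
/-- The permutation of the letter `0` when the last vertex does not belong to the set. -/
noncomputable def endPerm (V : ℕ) (f : ℕ → ℕ) : Equiv.Perm ℕ :=
  if Violates f 0 (V - 1) then Equiv.swap 0 (V * V + 2) else 1

/-- The transposition that depends on the number of satisfied gates. -/
noncomputable def countPerm (V : ℕ) (E : ℕ → ℕ → Prop) (f : ℕ → ℕ) : Equiv.Perm ℕ :=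
  Equiv.swap (V * V - satisfiedCount V E f) (V * V + 1)

/-- Conjugating a transposition renames its two points. As `c ≤ m`, turning back by `c` takes `m` to
`m - c` without wrapping around, and `m + 1` is not rotated. -/
theorem rot_conj {m c : ℕ} (h : c ≤ m) :
    (rot m ^ c)⁻¹ * Equiv.swap m (m + 1) * rot m ^ c = Equiv.swap (m - c) (m + 1) := by
  have h1 : (rot m ^ c)⁻¹ m = m - c := by
    rw [Equiv.Perm.inv_eq_iff_eq, rot_pow_apply c _ (by omega)]; omega
  have h2 : (rot m ^ c)⁻¹ (m + 1) = m + 1 := by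
    rw [Equiv.Perm.inv_eq_iff_eq, rot_pow_apply_of_lt (by omega)]
  have := Equiv.swap_apply_apply (rot m ^ c)⁻¹ m (m + 1)
  rw [h1, h2, inv_inv] at this
  exact this.symm

theorem statePerm_inl {t x y : ℕ} (ht : t < 3) (hx : x < V) (hy : y < V) (f : ℕ → ℕ) :
    statePerm V f (Sum.inl (initialState hV (gate V t x y))) = gatePerm V f (gate V t x y) := by
  rw [statePerm, Sum.elim_inl, gateOf_initialState hV (gate_lt ht hx hy)]

theorem statePerm_end (f : ℕ → ℕ) :
    statePerm V f (Sum.inl (initialState hV (gate V 2 0 (V - 1)))) = endPerm V f := by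
  rw [statePerm_inl hV (by omega) hV (by omega), gatePerm, kindOf_gate hV (by omega),
    srcOf_gate hV (by omega), tgtOf_gate (by omega), if_neg (by omega), if_neg (by omega), endPerm]

theorem statePerm_mid (f : ℕ → ℕ) :
    statePerm V f (Sum.inl (initialState hV (gate V 1 0 0))) =
      Equiv.swap (V * V) (V * V + 1) := by
  rw [statePerm_inl hV (by omega) hV hV, gatePerm, kindOf_gate hV hV, if_neg (by omega), if_pos rfl]

open Classical in
theorem statePerm_edge (f : ℕ → ℕ) {c : ℕ} (hc : c < V * V) :
    statePerm V f (Sum.inl (initialState hV (edgeGate V E c))) =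
      rot (V * V) ^ (if Violates f (srcOf V (edgeGate V E c))
        (tgtOf V (edgeGate V E c)) then 0 else 1) := by
  obtain ⟨x, hx, y, hy, e⟩ := edgeGate_prop E hc
  rw [e, statePerm_inl hV (by omega) hx hy, gatePerm, kindOf_gate hx hy, if_pos rfl]
  split_ifs <;> simp

theorem statePerm_inr (f : ℕ → ℕ) (q : Fin (stateCount V)) :
    statePerm V f (Sum.inr q) = (statePerm V f (Sum.inl q))⁻¹ := rfl

theorem prod_edges (f : ℕ → ℕ) :
    (((List.range (V * V)).map (fun c => Sum.inl (initialState hV (edgeGate V E c)))).map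
      (statePerm V f)).reverse.prod = rot (V * V) ^ satisfiedCount V E f := by
  rw [satisfiedCount, ← reverse_prod_pow, List.map_map]
  congr 2
  refine List.map_congr_left fun c hc => ?_
  exact statePerm_edge hV E f (List.mem_range.1 hc)

theorem prod_edges_inv (f : ℕ → ℕ) :
    (((List.range (V * V)).map (fun c => Sum.inr (initialState hV (edgeGate V E c)))).map
      (statePerm V f)).reverse.prod = (rot (V * V) ^ satisfiedCount V E f)⁻¹ := by
  rw [satisfiedCount, ← reverse_prod_pow_inv, List.map_map]
  congr 2
  refine List.map_congr_left fun c hc => ?_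
  rw [Function.comp_apply, statePerm_inr, statePerm_edge hV E f (List.mem_range.1 hc)]

/-- The first state of a sequence acts first and is the rightmost factor. This is why the end gate,
at the head of the list, stands on the right. -/
theorem prod_left (f : ℕ → ℕ) :
    ((leftSeq hV E).map (statePerm V f)).reverse.prod =
      countPerm V E f * endPerm V f := by
  rw [countPerm, ← rot_conj (satisfiedCount_le E f), ← prod_edges hV E f, inv_eq_of_mul_eq_one_left
    (show (((List.range (V * V)).map (fun c => Sum.inr (initialState hV (edgeGate V E c)))).map
      (statePerm V f)).reverse.prod * _ = 1 by rw [prod_edges, prod_edges_inv, inv_mul_cancel]),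
    ← statePerm_end hV, ← statePerm_mid hV f]
  simp only [leftSeq, List.map_cons, List.map_append, List.reverse_cons, List.reverse_append,
    List.prod_append, List.prod_cons, List.prod_nil, mul_one, mul_assoc]

theorem prod_right (f : ℕ → ℕ) :
    ((rightSeq hV E).map (statePerm V f)).reverse.prod =
      endPerm V f * countPerm V E f := by
  rw [countPerm, ← rot_conj (satisfiedCount_le E f), ← prod_edges hV E f, inv_eq_of_mul_eq_one_left
    (show (((List.range (V * V)).map (fun c => Sum.inr (initialState hV (edgeGate V E c)))).map
      (statePerm V f)).reverse.prod * _ = 1 by rw [prod_edges, prod_edges_inv, inv_mul_cancel]),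
    ← statePerm_end hV, ← statePerm_mid hV f]
  simp only [rightSeq, List.map_cons, List.map_append, List.reverse_cons, List.reverse_append,
    List.prod_append, List.prod_cons, List.prod_nil, mul_one, mul_assoc, List.map_nil,
    List.reverse_nil, List.nil_append]

/-- If the end gate is active, the count is not full, so `V * V - satisfiedCount V E f` differs from
0 and the two transpositions are disjoint. -/
theorem commute_perms {f : ℕ → ℕ}
    (h : ¬ (Violates f 0 (V - 1) ∧ satisfiedCount V E f = V * V)) :
    countPerm V E f * endPerm V f = endPerm V f * countPerm V E f := by
  unfold endPerm
  split_ifs with h1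
  · have h2 := satisfiedCount_le (V := V) E f
    have h3 : satisfiedCount V E f ≠ V * V := fun h' => h ⟨h1, h'⟩
    refine (Equiv.Perm.disjoint_swap_swap ?_).commute
    simp
    omega
  · simp

/-- Both transpositions now move the letter 0: one order takes it to `V * V + 2`, the other to `V *
V + 1`. -/
theorem not_commute_perms {f : ℕ → ℕ}
    (h : Violates f 0 (V - 1) ∧ satisfiedCount V E f = V * V) :
    (countPerm V E f * endPerm V f) 0 ≠ (endPerm V f * countPerm V E f) 0 := by
  rw [endPerm, if_pos h.1, countPerm, h.2, Nat.sub_self]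
  simp [Equiv.swap_apply_def]

/-- The two sequences of the instance act in the same way if and only if no set of vertices is closed
under edges, contains the vertex `0` and does not contain the last vertex. -/
theorem graphInstance_mem_yes : graphInstance hV E ∈ uniformWordProblem.yes ↔
    ¬ ∃ S : ℕ → Prop, S 0 ∧ ¬ S (V - 1) ∧ ∀ x < V, ∀ y < V, E x y → S x → S y := by
  classical
  constructor
  · rintro h ⟨S, h0, h1, hS⟩
    -- The characteristic word of the set; a letter 0 will be appended as the letter on which the
    -- two sequences differ.
    let u : List (Fin (letterCount V)) := (List.range V).map fun j =>
      if S j then ⟨1, by unfold letterCount; omega⟩ else ⟨0, by unfold letterCount; omega⟩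
    have hu : u.length = V := by simp [u]
    have hf : ∀ j < V, letterAt u j = if S j then 1 else 0 := by
      intro j hj
      simp only [letterAt, u, List.getElem?_map, List.getElem?_range hj, Option.map_some,
        Option.elim_some]
      split_ifs <;> rfl
    obtain ⟨b, hb, hb'⟩ := seqMap_graphInstance_long hV E hu
      ⟨0, by unfold letterCount; omega⟩ [] (Or.inl rfl)
    obtain ⟨c, hc, hc'⟩ := seqMap_graphInstance_long hV E hu
      ⟨0, by unfold letterCount; omega⟩ [] (Or.inr rfl)
    have heq := h (u ++ [⟨0, by unfold letterCount; omega⟩])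
    have hbc : b = c := by
      have := Part.some_injective (hb'.symm.trans (heq.trans hc'))
      simpa using this
    rw [prod_left] at hb
    rw [prod_right] at hc
    refine not_commute_perms (V := V) E (f := letterAt u) ⟨⟨?_, ?_⟩, ?_⟩
      (hb.symm.trans ((congrArg Fin.val hbc).trans hc))
    · simp [hf 0 hV, h0]
    · simp [hf (V - 1) (by omega), h1]
    · rw [satisfiedCount_eq_iff E hV]
      intro x hx y hy hE
      have := hS x hx y hy hE
      simpa [hf x hx, hf y hy] using this
  · intro h (u : List (Fin (letterCount V)))
    change (graphAutomaton V).withInverse.seqMap (leftSeq hV E) u =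
      (graphAutomaton V).withInverse.seqMap (rightSeq hV E) u
    rcases le_or_gt u.length V with hu | hu
    · exact (seqMap_graphInstance_short hV E hu (Or.inl rfl)).trans
        (seqMap_graphInstance_short hV E hu (Or.inr rfl)).symm
    · have hlen : (u.take V).length = V := by simp; omega
      have hsplit : u = u.take V ++ u[V] :: u.drop (V + 1) := by
        rw [← List.drop_eq_getElem_cons, List.take_append_drop]
      obtain ⟨b, hb, hb'⟩ := seqMap_graphInstance_long hV E hlen u[V] (u.drop (V + 1)) (Or.inl rfl)
      obtain ⟨c, hc, hc'⟩ := seqMap_graphInstance_long hV E hlen u[V] (u.drop (V + 1)) (Or.inr rfl)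
      rw [← hsplit] at hb' hc'
      have hbc : b = c := by
        refine Fin.ext (hb.trans (Eq.trans ?_ hc.symm))
        rw [prod_left, prod_right, commute_perms]
        -- If the permutations did not commute, the first `V` letters of `u` would describe a
        -- forbidden set.
        rintro ⟨⟨h1, h2⟩, h3⟩
        rw [satisfiedCount_eq_iff E hV] at h3
        exact h ⟨fun j => letterAt (u.take V) j ≠ 0, h1, fun h' => h' h2, h3⟩
      rw [hbc] at hb'
      exact hb'.trans hc'.symm

end
end AutWP

namespace AutWP

/-! ## Writing the instance in logarithmic space -/

section

variable {α : Type} {V f g h i : List α → (ℕ → ℕ) → ℕ}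

theorem IsLogFun.stateNum (hV : IsLogFun V) (hf : IsLogFun f) (hg : IsLogFun g) (hh : IsLogFun h) :
    IsLogFun fun w v => stateNum (V w v) (f w v) (g w v) (h w v) :=
  (((hf.mul hV.succ.succ).add hg).mul (.const 3)).add hh

theorem IsLogFun.gate (hV : IsLogFun V) (hf : IsLogFun f) (hg : IsLogFun g) (hh : IsLogFun h) :
    IsLogFun fun w v => gate (V w v) (f w v) (g w v) (h w v) :=
  (((hf.mul hV).add hg).mul hV).add hh

theorem IsLogFun.gateOf (hV : IsLogFun V) (hf : IsLogFun f) :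
    IsLogFun fun w v => gateOf (V w v) (f w v) :=
  (hf.div (.const 3)).div hV.succ.succ

theorem IsLogFun.posOf (hV : IsLogFun V) (hf : IsLogFun f) :
    IsLogFun fun w v => posOf (V w v) (f w v) :=
  (hf.div (.const 3)).mod hV.succ.succ

theorem IsLogFun.countOf (hf : IsLogFun f) : IsLogFun fun w v => countOf (f w v) :=
  hf.mod (.const 3)

theorem IsLogFun.srcOf (hV : IsLogFun V) (hf : IsLogFun f) :
    IsLogFun fun w v => srcOf (V w v) (f w v) :=
  (hf.div hV).mod hV

theorem IsLogFun.tgtOf (hV : IsLogFun V) (hf : IsLogFun f) :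
    IsLogFun fun w v => tgtOf (V w v) (f w v) :=
  hf.mod hV

theorem IsLogFun.kindOf (hV : IsLogFun V) (hf : IsLogFun f) :
    IsLogFun fun w v => kindOf (V w v) (f w v) :=
  (hf.div hV).div hV

theorem IsLogFun.rotFun (hf : IsLogFun f) (hg : IsLogFun g) :
    IsLogFun fun w v => rotFun (f w v) (g w v) :=
  (ite (.lt hg hf) hg.succ (ite (.eq hg hf) zero hg)).of_eq fun w v => by
    unfold AutWP.rotFun; congr

theorem IsLogFun.swapFun (hf : IsLogFun f) (hg : IsLogFun g) (hh : IsLogFun h) :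
    IsLogFun fun w v => swapFun (f w v) (g w v) (h w v) :=
  (ite (.eq hh hf) hg (ite (.eq hh hg) hf hh)).of_eq fun w v => by
    unfold AutWP.swapFun; congr

theorem IsLogFun.outNum (hV : IsLogFun V) (hf : IsLogFun f) (hg : IsLogFun g) :
    IsLogFun fun w v => outNum (V w v) (f w v) (g w v) := by
  have hk := hV.kindOf (hV.gateOf hf)
  have hm := hV.mul hV
  refine (ite (.eq (hV.posOf hf) hV) (ite (.eq hk zero) (ite (.eq hf.countOf (const 2)) hg
    (hm.rotFun hg)) (ite (.eq hk (const 1)) (hm.swapFun hm.succ hg)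
    (ite (.eq hf.countOf (const 2)) (zero.swapFun hm.succ.succ hg) hg))) hg).of_eq fun w v => ?_
  unfold AutWP.outNum
  congr

theorem IsLogFun.nextNum (hV : IsLogFun V) (hf : IsLogFun f) (hg : IsLogFun g) :
    IsLogFun fun w v => nextNum (V w v) (f w v) (g w v) := by
  have hr := hV.gateOf hf
  have hp := hV.posOf hf
  have hc1 := ite (.and (.eq hp (hV.srcOf hr)) (.not (.eq hg zero))) (const 1) zero
  have hc2 := ite (.and (.eq hp (hV.tgtOf hr)) (.eq hg zero)) (const 1) zero
  refine (ite (.lt hp hV) (hV.stateNum hr hp.succ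
    ((const 2).min ((hf.countOf.add hc1).add hc2))) (hV.stateNum hr hV.succ zero)).of_eq
    fun w v => ?_
  unfold AutWP.nextNum
  congr

theorem IsLogFun.stateCount (hV : IsLogFun V) : IsLogFun fun w v => stateCount (V w v) :=
  ((((const 3).mul hV).mul hV).mul hV.succ.succ).mul (const 3)

theorem IsLogFun.letterCount (hV : IsLogFun V) : IsLogFun fun w v => letterCount (V w v) :=
  (hV.mul hV).succ.succ.succ

theorem IsLogFun.edgeGate {V : List α → ℕ} (hV : IsLogFun fun w _ => V w)
    {E : List α → ℕ → ℕ → Prop}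
    (hE : ∀ X Y, IsLogFun X → IsLogFun Y → IsLogPred fun w v => E w (X w v) (Y w v))
    (hf : IsLogFun f) : IsLogFun fun w v => edgeGate (V w) (E w) (f w v) :=
  hV.gate zero (hf.div hV) (ite (hE _ _ (hf.div hV) (hf.mod hV)) (hf.mod hV) (hf.div hV))

theorem IsLogOutput.encodeSigned {V : List α → ℕ} (hV : IsLogFun fun w _ => V w)
    (hV0 : ∀ w, 0 < V w) (hf : IsLogFun f) :
    IsLogOutput (fun w v => encodeSigned (Sum.inl (initialState (hV0 w) (f w v)))) ∧
      IsLogOutput fun w v => encodeSigned (Sum.inr (initialState (hV0 w) (f w v))) := by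
  have h1 := IsLogOutput.encodeNum (hV.stateNum
    (hf.mod (((IsLogFun.const 3).mul hV).mul hV)) .zero .zero)
  exact ⟨((singleton (Symbol.bit false)).append h1).of_eq fun w v => rfl,
    ((singleton (Symbol.bit true)).append h1).of_eq fun w v => rfl⟩

theorem IsLogOutput.encodeInstance {V : List α → ℕ} (hV : IsLogFun fun w _ => V w)
    (hV0 : ∀ w, 0 < V w) {E : List α → ℕ → ℕ → Prop}
    (hE : ∀ X Y, IsLogFun X → IsLogFun Y → IsLogPred fun w v => E w (X w v) (Y w v)) :
    IsLogOutput fun w _ => encodeInstance (graphInstance (hV0 w) (E w)) := by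
  have hedge := hV.edgeGate hE (.var 0)
  have hE1 := flatMap_range (hV.mul hV) (encodeSigned hV hV0 hedge).1
  have hE2 := flatMap_range (hV.mul hV) (encodeSigned hV hV0 hedge).2
  have hmid := (encodeSigned hV hV0 (hV.gate (.const 1) .zero .zero)).1
  have hend := (encodeSigned hV hV0 (hV.gate (.const 2) .zero hV.pred)).1
  have hsemi := singleton (α := α) Symbol.semicolon
  -- In the nested loops, variable 1 is the state and variable 0 is the letter.
  have hT := flatMap_range hV.stateCount (flatMap_range hV.letterCount
    ((((encodeNum (.var 1)).append (encodeNum (.var 0))).append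
      (encodeNum (hV.outNum (.var 1) (.var 0)))).append
      (encodeNum (hV.nextNum (.var 1) (.var 0)))))
  refine ((encodeNum hV.stateCount).append <| (encodeNum hV.letterCount).append <|
    hT.append <| hsemi.append <| hend.append <| hE1.append <| hmid.append <| hE2.append <|
    hsemi.append <| hE1.append <| hmid.append <| hE2.append <| hend.append hsemi).of_eq
    fun w v => ?_
  have h1 := Automaton.flatMap_listTransitions_ofFun (outNum_lt (V := V w)) nextNum_lt
  simp only [push_zero, push_one] at *
  rw [← h1]
  simp only [AutWP.encodeInstance, graphInstance, leftSeq, rightSeq, List.flatMap_cons,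
    List.flatMap_append, List.flatMap_map, List.flatMap_nil, List.append_nil, List.append_assoc]
  rfl

end

/-- This is the number of cells used by the machine of `exists_machine` when counters are bounded by
`(n + 2) ^ e`: the size of a power is about `e` times the size of its base. -/
theorem inBigO_size_pow (e : ℕ) : InBigO (fun n => ((n + 2) ^ e).size + 2) fun n => Real.log n := by
  have hlog2 : 0 < Real.log 2 := Real.log_pos (by norm_num)
  refine Asymptotics.IsBigO.of_bound (e * (1 + 2 / Real.log 2) + 3) ?_
  -- For `n ≥ 3` the logarithm is at least 1, which absorbs additive constants, and `n + 2 ≤ n ^ 2`.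
  filter_upwards [Filter.eventually_ge_atTop 3] with n hn
  have hn3 : (3 : ℝ) ≤ n := by exact_mod_cast hn
  have hlog : 1 ≤ Real.log n := by
    rw [Real.le_log_iff_exp_le (by linarith)]
    exact (Real.exp_one_lt_d9.le.trans (by norm_num)).trans hn3
  have h1 : ((n + 2) ^ e).size ≤ e * (n + 2).size + 1 := by
    rw [Nat.size_le, pow_succ, mul_comm e, pow_mul]
    have := Nat.pow_le_pow_left (Nat.lt_size_self (n + 2)).le e
    have : 0 < (2 ^ (n + 2).size) ^ e := by positivity
    omega
  have h2 : ((n + 2).size : ℝ) ≤ 1 + 2 / Real.log 2 * Real.log n := by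
    obtain ⟨m, hm⟩ : ∃ m, (n + 2).size = m + 1 :=
      ⟨(n + 2).size - 1, by have := Nat.size_pos.2 (show 0 < n + 2 by omega); omega⟩
    have h3 : 2 ^ m ≤ n + 2 := Nat.lt_size.1 (by omega)
    have h4 : (2 : ℝ) ^ m ≤ (n : ℝ) ^ 2 := by
      have : ((2 ^ m : ℕ) : ℝ) ≤ ((n + 2 : ℕ) : ℝ) := by exact_mod_cast h3
      push_cast at this
      nlinarith
    have h5 := Real.log_le_log (by positivity) h4
    rw [Real.log_pow, Real.log_pow, ← le_div_iff₀ hlog2] at h5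
    rw [hm]
    push_cast at h5 ⊢
    have : 2 * Real.log n / Real.log 2 = 2 / Real.log 2 * Real.log n := by ring
    linarith
  rw [Real.norm_of_nonneg (by positivity), Real.norm_of_nonneg (by linarith)]
  have h1' : (((n + 2) ^ e).size : ℝ) ≤ e * (n + 2).size + 1 := by exact_mod_cast h1
  have he : (0 : ℝ) ≤ e := Nat.cast_nonneg e
  push_cast
  calc (((n + 2) ^ e).size : ℝ) + 2 ≤ e * (1 * Real.log n + 2 / Real.log 2 * Real.log n) +
        3 * Real.log n := by
        have := mul_le_mul_of_nonneg_left (h2.trans (by linarith : _ ≤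
          1 * Real.log n + 2 / Real.log 2 * Real.log n)) he
        linarith
    _ = (e * (1 + 2 / Real.log 2) + 3) * Real.log n := by ring

end AutWP

/-! ### The reduction -/

theorem mainTheorem4 : AutWP.IsHardFor AutWP.uniformWordProblem AutWP.NL := by
  intro P hP
  obtain ⟨N, E, -, hN, hE, hyes⟩ := AutWP.exists_graph_of_mem_NL hP
  -- There are `N w + 1` vertices, so the last one is the extra vertex `N w`.
  obtain ⟨e, he⟩ := AutWP.IsLogOutput.encodeInstance (V := fun w => N w + 1) hN.succ
    (fun w => Nat.succ_pos _) hE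
  -- The output does not depend on the variables, so all of them may be placed in counter 0.
  obtain ⟨p, hp⟩ := he (fun _ => 0) 1 fun _ => Nat.zero_lt_one
  obtain ⟨M, hM, hrun⟩ := p.exists_machine
  refine ⟨fun x => AutWP.graphInstance (Nat.succ_pos (N (P.encode x))) (E (P.encode x)),
    fun x => ?_, M, fun n => ((n + 2) ^ e).size + 2, hM, AutWP.inBigO_size_pow e, ?_, ?_⟩
  · refine (hyes x).trans (Iff.trans ?_ (AutWP.graphInstance_mem_yes _ _).symm)
    simp only [Nat.succ_sub_one, Nat.lt_succ_iff]
  all_goals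
    have key : ∀ w, AutWP.Program.Prints w ((w.length + 2) ^ e) 1 p ⟨fun _ => 0, 0, []⟩
        (AutWP.encodeInstance (AutWP.graphInstance (Nat.succ_pos (N w)) (E w))) := fun w =>
      hp w (w.length + 2) ⟨fun _ => 0, 0, []⟩ le_rfl fun _ _ => Nat.zero_le _
  · rintro w -
    obtain ⟨s, hs, -⟩ := key w
    exact (hrun w _ s hs).2
  · intro x
    obtain ⟨s, hs, -, hout⟩ := key (P.encode x)
    have hs' := (hrun _ _ s hs).1
    rw [hout, List.nil_append] at hs'
    exact hs'
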